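/- **Model.** A parallel distributed transactional system (PDTS) has $n$ nodes, each with an unbounded supply of processes that share the base objects of that node and access them by atomic primitives (a primitive is *non-trivial* if it may modify the object), and any number of clients. Clients and nodes exchange messages, which may be delayed arbitrarily; nodes may crash, clients do not. The database has a set of items with given initial values. A transaction $T$ is a program of reads and writes, where later operations may depend on values read. An *implementation* consists of a coordinator handler for each transaction, run by a client when $T$ is invoked, and of message handlers, each triggered at an arbitrary idle process of a node by a message sent to that node. A handler is a sequential algorithm whose steps are its invocation, primitives on base objects of its node (message handlers only), sending or receiving a message of $T$, and its response; it has no clock. The response of the coordinator handler *decides* $T$: it returns commit or abort and the list of executed reads and writes with their values, in order, which must be those of a partial run of the program of $T$, and of a complete run if $T$ commits. The read set, write set and data set of a decided $T$ are read off this list. An execution is a sequence of handler steps and node crashes. The interval of $T$ begins with its invocation and ends when its coordinator handler has responded, all messages of $T$ sent to non-crashed nodes have been received there, and all handlers of $T$ on non-crashed nodes have responded; transactions are concurrent if their intervals overlap. They contend if they are concurrent and apply primitives, at least one of them non-trivial, to the same base object. *Happened-before* is the transitive relation generated by: an earlier step of a handler before a later step of the same handler; the sending of a message before its receipt; a non-trivial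 primitive of a transaction on a base object before any later primitive of the same transaction on this object. The *depth* of a step is the maximum number of messages on a chain of these relations leading to it, and the depth $d_E(T)$ of a decided $T$ is the depth of the response of its coordinator handler. For a prefix $P$ of $E$ in which $T$ is not decided, the partial depth $d_E(T,P)$ is the maximal depth of a step of $T$ in $P$ that happened before the response of its coordinator handler in $E$ ($0$ if there is none). A process knows a property in an execution if it holds in all executions with the same projection on this process. The value of an item is decided for $T$ in $E$ if, in all extensions of $E$ in which $T$ is decided, $T$ returns a read of this item with this same value. An execution is synchronous if, for suitable times of its steps, every message that its target can receive is received within a fixed delay $\Delta>0$ of being sent. **Properties.** - *Client-driven replication*: message handlers on nodes send messages only to the client of their transaction. - *Weak progress* ($f\ge 0$ is the number of tolerated crashes): in every fair execution with at most $f$ crashes every transaction is eventually decided, and every transaction not concurrent with another one eventually commits. In such executions all message handlers on non-crashed nodes also eventually respond. - *$1$-seamless fault tolerance*: for every failure-free execution $E$, every prefix $P$ of $E$ and every node $N$, some execution $E'$ begins with $P$ followed by a crash of $N$, has the same sequence of invocation and response steps of coordinator handlers (with returned values) as $E$, and gives every decided transaction the same depth as $E$. - *Fast decision*: for every failure-free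 synchronous execution $E$, every $T$ decided in $E$ and not concurrent with another transaction, and every prefix $P$ of $E$ in which $T$ is not decided and with $d_E(T,P)<d_E(T)-2$, there is a prefix $P'$ of $E$, in which $T$ is not decided, with $d_E(T,P')=d_E(T,P)+2$ in which the number of items whose value for $T$ is known by some process to be decided is larger than in $P$. - *Invisible reads*: a decided transaction with empty write set executes no non-trivial primitive; and for every execution $E$ and every transaction $T$ committed in $E$ there is an execution identical to $E$ except that the steps of $T$ are replaced by steps of a transaction $T'$ whose first and last steps are at the places of those of $T$, and which commits, performs the same writes in the same order, and reads nothing. - *Disjoint-access parallelism*: two transactions decided in an execution, with disjoint data sets, do not contend in it. - *Serializability*: for every execution, the committed transactions can be ordered so that, when their operations are executed serially in this order from the initial values, each read returns the last value written to its item (its initial value if there is none). **Theorem (R-FIDS).** Let the database have at least $\max(n,2)$ items (three items for three nodes), whose values range over a set with at least two elements. For every $f\ge 0$ and $\Delta>0$, no implementation of a PDTS on $n$ nodes that uses client-driven replication guarantees weak progress and simultaneously provides $1$-seamless fault tolerance, fast decision, invisible reads, disjoint-access parallelism and serializability. -/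

import Mathlib

/-!
A model of parallel distributed transactional systems: clients and nodes exchange messages, and
the processes of one node share memory.
-/

universe u v w

namespace PDTS

/-! ### Transactions -/

/-- A transaction program: reads and writes of data items, where everything after a read may depend
on the value that it returns. -/
inductive Prog (Item : Type u) (Val : Type v) : Type (max u v)
  | done : Prog Item Val
  | read (x : Item) (k : Val → Prog Item Val) : Prog Item Val
  | write (x : Item) (a : Val) (k : Prog Item Val) : Prog Item Val

/-- A transaction: a program together with an identifier, so that one program can be invoked
many times. -/
structure Txn (Item : Type u) (Val : Type v) : Type (max u v) where
  id : ℕ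
  prog : Prog Item Val

/-- A read or write operation, with the value read or written. -/
inductive Op (Item : Type u) (Val : Type v) : Type (max u v)
  | read (x : Item) (a : Val) : Op Item Val
  | write (x : Item) (a : Val) : Op Item Val

section Operations

variable {Item : Type u} {Val : Type v}

/-- The operations are those of an initial part of a run of the program. -/
def Prog.PartialRun : Prog Item Val → List (Op Item Val) → Prop
  | _, [] => True
  | .read x k, .read y a :: l => x = y ∧ (k a).PartialRun l
  | .write x a k, .write y b :: l => x = y ∧ a = b ∧ k.PartialRun l
  | _, _ :: _ => False

/-- The operations are those of a complete run of the program. -/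
def Prog.FullRun : Prog Item Val → List (Op Item Val) → Prop
  | .done, [] => True
  | .read x k, .read y a :: l => x = y ∧ (k a).FullRun l
  | .write x a k, .write y b :: l => x = y ∧ a = b ∧ k.FullRun l
  | _, _ => False

def Op.isWrite : Op Item Val → Bool
  | .read _ _ => false
  | .write _ _ => true

def readSet (ops : List (Op Item Val)) : Set Item := {x | ∃ a, Op.read x a ∈ ops}

def writeSet (ops : List (Op Item Val)) : Set Item := {x | ∃ a, Op.write x a ∈ ops}

def dataSet (ops : List (Op Item Val)) : Set Item := readSet ops ∪ writeSet ops

open Classical in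
/-- Executed one after the other from the database contents `db`, every read in the list returns the
last value written to its item (or the value in `db` if there is none). -/
def Legal (db : Item → Val) : List (Op Item Val) → Prop
  | [] => True
  | .read x a :: l => db x = a ∧ Legal db l
  | .write x a :: l => Legal (Function.update db x a) l

end Operations

inductive Outcome
  | commit
  | abort

/-! ### Implementations -/

/-- The processes: any number of clients, and, on each of the `n` nodes, an unbounded supply of
node processes. -/
inductive Proc (n : ℕ)
  | client (c : ℕ) : Proc n
  | node (i : Fin n) (k : ℕ) : Proc n

/-- Handlers of one transaction are named by how they were triggered: `[]` is the coordinator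
handler, and `k :: h` is the message handler triggered by the `k`-th message sent by handler `h`. -/
abbrev HId := List ℕ

/-- Destinations on nodes: a message sent to a node triggers a new message handler there, or it is
for the message handler `k :: h`, to be picked up by a receive step of that handler. -/
inductive NodeDest (n : ℕ)
  | fresh (i : Fin n) : NodeDest n
  | running (k : ℕ) (h : HId) : NodeDest n

/-- Destinations: the coordinator handler (on its client), or a destination on a node. -/
inductive Dest (n : ℕ)
  | toClient : Dest n
  | toNode (d : NodeDest n) : Dest n

/-- The next action of a coordinator handler with local states `S`: send a message to a node,
wait for a message, or return from the call with the outcome and the executed operations. -/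
inductive CAction (n : ℕ) (Item : Type u) (Val : Type v) (Msg S : Type w) : Type (max u v w)
  | send (d : NodeDest n) (m : Msg) (s : S)
  | recv (k : Msg → S)
  | ret (o : Outcome) (ops : List (Op Item Val))

/-- The next action of a message handler with local states `S`: apply an atomic primitive (which
maps the value of a base object to its new value and a return value) to a base object of the node,
send a message, wait for a message, or return. -/
inductive HAction (n : ℕ) (Msg Obj OVal Ret S : Type w) : Type w
  | prim (x : Obj) (op : OVal → OVal × Ret) (k : Ret → S)
  | send (d : Dest n) (m : Msg) (s : S)
  | recv (k : Msg → S)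
  | ret

/-- An implementation: the base objects of the nodes with their initial values, and the algorithms of
the coordinator handler (which may use the identity of its client and the transaction) and of the
message handlers (which may use the node, the transaction, the name of the handler and the
triggering message). -/
structure Implementation (n : ℕ) (Item : Type u) (Val : Type v) : Type (max u v (w + 1)) where
  Msg : Type w
  Obj : Type w
  OVal : Type w
  Ret : Type w
  CState : Type w
  HState : Type w
  initObj : Fin n → Obj → OVal
  coordInit : ℕ → Txn Item Val → CState
  coordNext : CState → CAction n Item Val Msg CState
  handlerInit : Fin n → Txn Item Val → HId → Msg → HState
  handlerNext : HState → HAction n Msg Obj OVal Ret HState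

/-- A primitive is non-trivial if it may modify the object. -/
def NonTrivial {V R : Type w} (op : V → V × R) : Prop := ∃ a, (op a).1 ≠ a

section Executions

variable {n : ℕ} {Item : Type u} {Val : Type v}

/-- What a handler does in a step. The invocation step `start` of a message handler is at the same
time the receipt of the triggering message. The message sent by a handler `h` as its `k`-th one (from
`0`) is identified within the transaction by `(h, k)`; `recv h k m` is its receipt. -/
inductive Act (I : Implementation.{u, v, w} n Item Val) : Type (max u v w)
  | invoke
  | respond (o : Outcome) (ops : List (Op Item Val))
  | start (m : I.Msg)
  | finish
  | prim (x : I.Obj) (op : I.OVal → I.OVal × I.Ret) (r : I.Ret)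
  | send (k : ℕ) (d : Dest n) (m : I.Msg)
  | recv (src : HId) (k : ℕ) (m : I.Msg)

/-- A node crash, or a step of handler `h` of transaction `T` run by process `p`. -/
inductive Step (I : Implementation.{u, v, w} n Item Val) : Type (max u v w)
  | crash (i : Fin n)
  | act (p : Proc n) (T : Txn Item Val) (h : HId) (a : Act I)

/-- The handler that a process is running: its transaction, its name, the number of messages it has
sent, and its local state. -/
structure Running (I : Implementation.{u, v, w} n Item Val) : Type (max u v w) where
  txn : Txn Item Val
  hid : HId
  sent : ℕ
  loc : I.CState ⊕ I.HState

/-- A message in transit. -/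
structure Packet (I : Implementation.{u, v, w} n Item Val) : Type (max u v w) where
  txn : Txn Item Val
  src : HId
  idx : ℕ
  dest : Dest n
  msg : I.Msg

structure Config (I : Implementation.{u, v, w} n Item Val) : Type (max u v w) where
  /-- contents of the shared memory of each node -/
  mem : Fin n → I.Obj → I.OVal
  /-- crashed nodes -/
  crashed : Set (Fin n)
  /-- identifiers of the transactions invoked so far -/
  used : Set ℕ
  /-- the handler that each process runs; `none` for an idle process -/
  running : Proc n → Option (Running I)
  /-- messages sent and not yet received -/
  transit : Set (Packet I)

variable (I : Implementation.{u, v, w} n Item Val)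

def initConfig : Config I where
  mem := I.initObj
  crashed := ∅
  used := ∅
  running := fun _ => none
  transit := ∅

variable {I}

open Classical in
/-- Process `p` now runs the handler `r` (or is idle). -/
noncomputable def Config.setRunning (C : Config I) (p : Proc n) (r : Option (Running I)) :
    Config I :=
  { C with running := Function.update C.running p r }

open Classical in
noncomputable def Config.setObj (C : Config I) (i : Fin n) (x : I.Obj) (a : I.OVal) : Config I :=
  { C with mem := Function.update C.mem i (Function.update (C.mem i) x a) }

def Config.addPacket (C : Config I) (q : Packet I) : Config I :=
  { C with transit := insert q C.transit }

def Config.removePacket (C : Config I) (q : Packet I) : Config I :=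
  { C with transit := C.transit \ {q} }

/-- The steps of an implementation. A message may be received at any time after it was sent; a
message to a node is received by an arbitrary idle process of that node; no process of a crashed
node takes a step. -/
inductive Trans : Config I → Step I → Config I → Prop
  | crash (C : Config I) (i : Fin n) (hi : i ∉ C.crashed) :
      Trans C (.crash i) { C with crashed := insert i C.crashed }
  | invoke (C : Config I) (c : ℕ) (T : Txn Item Val) (idle : C.running (.client c) = none)
      (new : T.id ∉ C.used) :
      Trans C (.act (.client c) T [] .invoke)
        (({ C with used := insert T.id C.used }).setRunning (.client c)
          (some ⟨T, [], 0, .inl (I.coordInit c T)⟩))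
  | coordSend (C : Config I) (c : ℕ) (T : Txn Item Val) (h : HId) (k : ℕ) (s s' : I.CState)
      (d : NodeDest n) (m : I.Msg)
      (run : C.running (.client c) = some ⟨T, h, k, .inl s⟩)
      (next : I.coordNext s = .send d m s') :
      Trans C (.act (.client c) T h (.send k (.toNode d) m))
        ((C.addPacket ⟨T, h, k, .toNode d, m⟩).setRunning (.client c)
          (some ⟨T, h, k + 1, .inl s'⟩))
  | coordRecv (C : Config I) (c : ℕ) (T : Txn Item Val) (h : HId) (k : ℕ) (s : I.CState)
      (f : I.Msg → I.CState) (src : HId) (j : ℕ) (m : I.Msg)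
      (run : C.running (.client c) = some ⟨T, h, k, .inl s⟩)
      (next : I.coordNext s = .recv f)
      (sent : (⟨T, src, j, .toClient, m⟩ : Packet I) ∈ C.transit) :
      Trans C (.act (.client c) T h (.recv src j m))
        ((C.removePacket ⟨T, src, j, .toClient, m⟩).setRunning (.client c)
          (some ⟨T, h, k, .inl (f m)⟩))
  | respond (C : Config I) (c : ℕ) (T : Txn Item Val) (h : HId) (k : ℕ) (s : I.CState)
      (o : Outcome) (ops : List (Op Item Val))
      (run : C.running (.client c) = some ⟨T, h, k, .inl s⟩)
      (next : I.coordNext s = .ret o ops) :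
      Trans C (.act (.client c) T h (.respond o ops)) (C.setRunning (.client c) none)
  | start (C : Config I) (i : Fin n) (l : ℕ) (T : Txn Item Val) (src : HId) (j : ℕ) (m : I.Msg)
      (live : i ∉ C.crashed) (idle : C.running (.node i l) = none)
      (sent : (⟨T, src, j, .toNode (.fresh i), m⟩ : Packet I) ∈ C.transit) :
      Trans C (.act (.node i l) T (j :: src) (.start m))
        ((C.removePacket ⟨T, src, j, .toNode (.fresh i), m⟩).setRunning (.node i l)
          (some ⟨T, j :: src, 0, .inr (I.handlerInit i T (j :: src) m)⟩))
  | prim (C : Config I) (i : Fin n) (l : ℕ) (T : Txn Item Val) (h : HId) (k : ℕ) (s : I.HState)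
      (x : I.Obj) (op : I.OVal → I.OVal × I.Ret) (f : I.Ret → I.HState)
      (live : i ∉ C.crashed)
      (run : C.running (.node i l) = some ⟨T, h, k, .inr s⟩)
      (next : I.handlerNext s = .prim x op f) :
      Trans C (.act (.node i l) T h (.prim x op (op (C.mem i x)).2))
        ((C.setObj i x (op (C.mem i x)).1).setRunning (.node i l)
          (some ⟨T, h, k, .inr (f (op (C.mem i x)).2)⟩))
  | handlerSend (C : Config I) (i : Fin n) (l : ℕ) (T : Txn Item Val) (h : HId) (k : ℕ)
      (s s' : I.HState) (d : Dest n) (m : I.Msg)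
      (live : i ∉ C.crashed)
      (run : C.running (.node i l) = some ⟨T, h, k, .inr s⟩)
      (next : I.handlerNext s = .send d m s') :
      Trans C (.act (.node i l) T h (.send k d m))
        ((C.addPacket ⟨T, h, k, d, m⟩).setRunning (.node i l) (some ⟨T, h, k + 1, .inr s'⟩))
  | handlerRecv (C : Config I) (i : Fin n) (l : ℕ) (T : Txn Item Val) (j' : ℕ) (h' : HId) (k : ℕ)
      (s : I.HState) (f : I.Msg → I.HState) (src : HId) (j : ℕ) (m : I.Msg)
      (live : i ∉ C.crashed)
      (run : C.running (.node i l) = some ⟨T, j' :: h', k, .inr s⟩)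
      (next : I.handlerNext s = .recv f)
      (sent : (⟨T, src, j, .toNode (.running j' h'), m⟩ : Packet I) ∈ C.transit) :
      Trans C (.act (.node i l) T (j' :: h') (.recv src j m))
        ((C.removePacket ⟨T, src, j, .toNode (.running j' h'), m⟩).setRunning (.node i l)
          (some ⟨T, j' :: h', k, .inr (f m)⟩))
  | finish (C : Config I) (i : Fin n) (l : ℕ) (T : Txn Item Val) (h : HId) (k : ℕ) (s : I.HState)
      (live : i ∉ C.crashed)
      (run : C.running (.node i l) = some ⟨T, h, k, .inr s⟩)
      (next : I.handlerNext s = .ret) :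
      Trans C (.act (.node i l) T h .finish) (C.setRunning (.node i l) none)

/-- The step sequence leads from the initial configuration to the given one. -/
inductive Reaches : List (Step I) → Config I → Prop
  | nil : Reaches [] (initConfig I)
  | snoc {E : List (Step I)} {C C' : Config I} {s : Step I} :
      Reaches E C → Trans C s C' → Reaches (E ++ [s]) C'

/-- The (finite) executions of the implementation. -/
def IsExec (E : List (Step I)) : Prop := ∃ C, Reaches E C

/-! ### Vocabulary for executions -/

def Step.proc : Step I → Option (Proc n)
  | .crash _ => none
  | .act p _ _ _ => some p

def Step.txn : Step I → Option (Txn Item Val)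
  | .crash _ => none
  | .act _ T _ _ => some T

def Step.isCrash : Step I → Bool
  | .crash _ => true
  | .act _ _ _ _ => false

/-- Invocation and response steps of coordinator handlers. -/
def Step.isCoordEvent : Step I → Bool
  | .act _ _ _ .invoke => true
  | .act _ _ _ (.respond _ _) => true
  | _ => false

/-- Handler steps that do not need a message to arrive or a call by the application. -/
def Step.IsLocal : Step I → Prop
  | .act _ _ _ (.respond _ _) => True
  | .act _ _ _ .finish => True
  | .act _ _ _ (.prim _ _ _) => True
  | .act _ _ _ (.send _ _ _) => True
  | _ => False

/-- The step sends message `(src, k)` of transaction `T`. -/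
def Step.Sends (s : Step I) (T : Txn Item Val) (src : HId) (k : ℕ) : Prop :=
  ∃ p d m, s = .act p T src (.send k d m)

/-- The step receives message `(src, k)` of transaction `T`. -/
def Step.Receives (s : Step I) (T : Txn Item Val) (src : HId) (k : ℕ) : Prop :=
  (∃ p m, s = .act p T (k :: src) (.start m)) ∨ ∃ p h m, s = .act p T h (.recv src k m)

def Crashed (E : List (Step I)) (i : Fin n) : Prop := Step.crash i ∈ E

def numCrashes (E : List (Step I)) : ℕ := E.countP Step.isCrash

def FailureFree (E : List (Step I)) : Prop := numCrashes E = 0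

def Invoked (E : List (Step I)) (T : Txn Item Val) : Prop := ∃ p h, Step.act p T h .invoke ∈ E

/-- The call of `T` returns in `E`, with the outcome `o` and the operations `ops`. -/
def Returns (E : List (Step I)) (T : Txn Item Val) (o : Outcome) (ops : List (Op Item Val)) : Prop :=
  ∃ p h, Step.act p T h (.respond o ops) ∈ E

def Decided (E : List (Step I)) (T : Txn Item Val) : Prop := ∃ o ops, Returns E T o ops

def Committed (E : List (Step I)) (T : Txn Item Val) : Prop := ∃ ops, Returns E T .commit ops

/-- The interval of `T` has ended: the coordinator handler has responded, every message that `T` sent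
to a node that has not crashed has been received, and so has every message handler of `T` on such a
node responded. (Messages to a handler that has already responded are dropped.) -/
def IntervalOver (E : List (Step I)) (T : Txn Item Val) : Prop :=
  Decided E T ∧
  (∀ p h k i m, Step.act p T h (.send k (.toNode (.fresh i)) m) ∈ E → ¬ Crashed E i →
    ∃ q m', Step.act q T (k :: h) (.start m') ∈ E) ∧
  (∀ i l h m, Step.act (.node i l) T h (.start m) ∈ E → ¬ Crashed E i →
    Step.act (.node i l) T h .finish ∈ E)

/-- The interval of `T` ends in `E` before `T'` is invoked. -/
def Precedes (E : List (Step I)) (T T' : Txn Item Val) : Prop :=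
  ∃ P, P <+: E ∧ IntervalOver P T ∧ ¬ Invoked P T'

/-- The intervals of the two transactions overlap. -/
def Concurrent (E : List (Step I)) (T T' : Txn Item Val) : Prop :=
  T ≠ T' ∧ Invoked E T ∧ Invoked E T' ∧ ¬ Precedes E T T' ∧ ¬ Precedes E T' T

/-- The two transactions are concurrent, and on some node apply primitives to the same object, one
of them non-trivial. -/
def Contend (E : List (Step I)) (T T' : Txn Item Val) : Prop :=
  Concurrent E T T' ∧
  ∃ i x l h op r l' h' op' r',
    Step.act (.node i l) T h (.prim x op r) ∈ E ∧
    Step.act (.node i l') T' h' (.prim x op' r') ∈ E ∧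
    (NonTrivial op ∨ NonTrivial op')

/-! ### Depth -/

/-- Steps `i < j` belong to the same handler. -/
def HandlerEdge (E : List (Step I)) (i j : ℕ) : Prop :=
  i < j ∧ ∃ p p' T h a a', E[i]? = some (.act p T h a) ∧ E[j]? = some (.act p' T h a')

/-- Step `j` receives the message sent in step `i < j`. -/
def MsgEdge (E : List (Step I)) (i j : ℕ) : Prop :=
  i < j ∧ ∃ s s' T src k, E[i]? = some s ∧ E[j]? = some s' ∧ s.Sends T src k ∧ s'.Receives T src k

/-- Step `j` accesses a base object to which the same transaction applied a non-trivial primitive in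
step `i < j`. -/
def MemEdge (E : List (Step I)) (i j : ℕ) : Prop :=
  i < j ∧ ∃ ν x T l h op r l' h' op' r',
    E[i]? = some (.act (.node ν l) T h (.prim x op r)) ∧
    E[j]? = some (.act (.node ν l') T h' (.prim x op' r')) ∧ NonTrivial op

/-- Step `i` happened before step `j`. -/
def HappenedBefore (E : List (Step I)) (i j : ℕ) : Prop :=
  Relation.TransGen (fun a b => HandlerEdge E a b ∨ MsgEdge E a b ∨ MemEdge E a b) i j

open Classical in
/-- The depth of step `j` of `E`: the largest number of messages on a causal path to it within its
transaction. -/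
noncomputable def stepDepth (E : List (Step I)) (j : ℕ) : ℕ :=
  Finset.univ.sup fun i : Fin j =>
    if MsgEdge E i j then stepDepth E i + 1
    else if HandlerEdge E i j ∨ MemEdge E i j then stepDepth E i
    else 0
termination_by j
decreasing_by all_goals exact i.2

/-- Step `j` of `E` is the response step of the coordinator handler of `T`. -/
def IsResponse (E : List (Step I)) (T : Txn Item Val) (j : ℕ) : Prop :=
  ∃ p h o ops, E[j]? = some (.act p T h (.respond o ops))

open Classical in
/-- The depth of a decided transaction: the depth of the response step of its coordinator handler. -/
noncomputable def txnDepth (E : List (Step I)) (T : Txn Item Val) : ℕ :=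
  (Finset.range E.length).sup fun j => if IsResponse E T j then stepDepth E j else 0

open Classical in
/-- The partial depth, in a prefix `P` of `E`, of a transaction that is decided in `E` but not in `P`:
the largest depth of a step of `T` in `P` that happened before the response step of its coordinator
handler in `E`. -/
noncomputable def partialDepth (E : List (Step I)) (T : Txn Item Val) (P : List (Step I)) : ℕ :=
  (Finset.range P.length).sup fun j =>
    if (∃ p h a, E[j]? = some (.act p T h a)) ∧ ∃ r, IsResponse E T r ∧ HappenedBefore E j r then
      stepDepth E j
    else 0

/-! ### Knowledge -/

open Classical in
/-- The projection of an execution on a process. -/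
noncomputable def proj (p : Proc n) (E : List (Step I)) : List (Step I) :=
  E.filter fun s => s.proc = some p

/-- Process `p` knows `φ` in `E`: it holds in all executions that `p` cannot distinguish from `E`. -/
def Knows (p : Proc n) (E : List (Step I)) (φ : List (Step I) → Prop) : Prop :=
  ∀ E', IsExec E' → proj p E' = proj p E → φ E'

/-- In every extension of `E` in which `T` is decided, its call returns a read of `x` with value `a`. -/
def ValueDecided (T : Txn Item Val) (x : Item) (a : Val) (E : List (Step I)) : Prop :=
  ∀ E', IsExec E' → E <+: E' → ∀ o ops, Returns E' T o ops → Op.read x a ∈ ops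

/-- The number of data items whose value is known by some process to be decided for `T`. -/
noncomputable def numKnown (T : Txn Item Val) (E : List (Step I)) : ℕ∞ :=
  Set.encard {x | ∃ p a, Knows p E (ValueDecided T x a)}

/-! ### Infinite executions -/

/-- An execution given by its growing finite prefixes; `ρ (t + 1) = ρ t` is allowed, so finite
executions are included. -/
def IsRun (ρ : ℕ → List (Step I)) : Prop :=
  ρ 0 = [] ∧ ∀ t, IsExec (ρ t) ∧ (ρ (t + 1) = ρ t ∨ ∃ s, ρ (t + 1) = ρ t ++ [s])

/-- Every process takes steps as long as its handler is not waiting for a message (and its node has not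
crashed), and no message stays receivable, or becomes receivable again and again, forever. -/
def Fair (ρ : ℕ → List (Step I)) : Prop :=
  (∀ p t, ∃ t', t ≤ t' ∧
    ((∃ s, ρ (t' + 1) = ρ t' ++ [s] ∧ s.proc = some p) ∨
      ¬ ∃ s, IsExec (ρ t' ++ [s]) ∧ s.proc = some p ∧ s.IsLocal)) ∧
  ∀ T src k, ∃ t, ∀ t', t ≤ t' → ¬ ∃ s, IsExec (ρ t' ++ [s]) ∧ s.Receives T src k

/-- The execution is synchronous with delay bound `Δ`: its steps can be given times such that no
message is still receivable when more than `Δ` has passed since it was sent. -/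
def Synchronous (Δ : ℝ) (E : List (Step I)) : Prop :=
  ∃ τ : ℕ → ℝ, Monotone τ ∧
    ∀ i j s T src k, i < j → j < E.length → E[i]? = some s → s.Sends T src k → τ i + Δ < τ j →
      ¬ ∃ s', IsExec (E.take j ++ [s']) ∧ s'.Receives T src k

end Executions

/-! ### Properties of implementations -/

namespace Implementation

variable {n : ℕ} {Item : Type u} {Val : Type v} (I : Implementation.{u, v, w} n Item Val)

/-- The operations that a call returns are those of a run of its program, in order; they are those of
a complete run if the transaction commits. -/
def RespectsPrograms : Prop :=
  ∀ (E : List (Step I)) (T : Txn Item Val) (o : Outcome) (ops : List (Op Item Val)),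
    IsExec E → Returns E T o ops → T.prog.PartialRun ops ∧ (o = .commit → T.prog.FullRun ops)

/-- In fair executions with at most `f` crashes, every message handler on a node that does not crash
reaches its response step. -/
def HandlersReturn (f : ℕ) : Prop :=
  ∀ ρ : ℕ → List (Step I), IsRun ρ → Fair ρ → (∀ t, numCrashes (ρ t) ≤ f) →
    ∀ t i l T h m, Step.act (.node i l) T h (.start m) ∈ ρ t →
      ∃ t', Step.act (.node i l) T h .finish ∈ ρ t' ∨ Crashed (ρ t') i

/-- In fair executions with at most `f` crashes, every transaction is eventually decided, and every
transaction that is not concurrent with another one eventually commits. -/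
def WeakProgress (f : ℕ) : Prop :=
  ∀ ρ : ℕ → List (Step I), IsRun ρ → Fair ρ → (∀ t, numCrashes (ρ t) ≤ f) →
    ∀ T t, Invoked (ρ t) T →
      (∃ t', Decided (ρ t') T) ∧
      ((∀ T' t', ¬ Concurrent (ρ t') T T') → ∃ t', Committed (ρ t') T)

/-- Nodes send messages to clients only: replicas do not communicate with each other. -/
def ClientDriven : Prop :=
  ∀ E : List (Step I), IsExec E → ∀ i l T h k d m,
    Step.act (.node i l) T h (.send k d m) ∈ E → d = .toClient

/-- For every execution there is an order of the committed transactions such that their operations,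
executed serially in this order from the initial database contents, are legal. -/
def Serializable (init : Item → Val) : Prop :=
  ∀ E : List (Step I), IsExec E → ∃ L : List (Txn Item Val × List (Op Item Val)),
    L.Nodup ∧ (∀ T ops, (T, ops) ∈ L ↔ Returns E T .commit ops) ∧
    Legal init (L.flatMap Prod.snd)

/-- Two transactions whose data sets do not intersect do not contend. -/
def DisjointAccessParallel : Prop :=
  ∀ E : List (Step I), IsExec E → ∀ T T' o ops o' ops',
    T ≠ T' → Returns E T o ops → Returns E T' o' ops' → Disjoint (dataSet ops) (dataSet ops') →
      ¬ Contend E T T'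

/-- A transaction with an empty write set does not execute non-trivial primitives. -/
def WeakInvisibleReads : Prop :=
  ∀ E : List (Step I), IsExec E → ∀ T o ops, Returns E T o ops → writeSet ops = ∅ →
    ∀ p h x op r, Step.act p T h (.prim x op r) ∈ E → ¬ NonTrivial op

open Classical in
/-- `E'` is `E` with the steps of `T` replaced by steps of `T'`, where the first and last steps of `T'`
are at the places of the first and last steps of `T`. -/
def ReplacedBy {I : Implementation.{u, v, w} n Item Val} (E : List (Step I)) (T : Txn Item Val)
    (E' : List (Step I)) (T' : Txn Item Val) : Prop :=
  ∃ A M M' B, E = A ++ M ++ B ∧ E' = A ++ M' ++ B ∧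
    (∀ s ∈ A ++ B, s.txn ≠ some T ∧ s.txn ≠ some T') ∧
    M.head?.bind Step.txn = some T ∧ M.getLast?.bind Step.txn = some T ∧
    M'.head?.bind Step.txn = some T' ∧ M'.getLast?.bind Step.txn = some T' ∧
    (M.filter fun s => s.txn ≠ some T) = M'.filter fun s => s.txn ≠ some T'

/-- Weak invisible reads, and every committed transaction can be replaced in every execution by one
with the same interval that performs the same writes in the same order and reads nothing. -/
def InvisibleReads : Prop :=
  I.WeakInvisibleReads ∧
  ∀ E : List (Step I), IsExec E → ∀ T ops, Returns E T .commit ops →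
    ∃ E' T', IsExec E' ∧ ReplacedBy E T E' T' ∧ Returns E' T' .commit (ops.filter Op.isWrite)

/-- In failure-free synchronous executions, for a decided transaction that is not concurrent with
another one: whenever more than two message delays remain, two message delays suffice for some
process to know one more decided value. -/
def FastDeciding (Δ : ℝ) : Prop :=
  ∀ E : List (Step I), IsExec E → FailureFree E → Synchronous Δ E →
    ∀ T, Decided E T → (∀ T', ¬ Concurrent E T T') →
      ∀ P, P <+: E → ¬ Decided P T → partialDepth E T P + 2 < txnDepth E T →
        ∃ P', P' <+: E ∧ ¬ Decided P' T ∧ partialDepth E T P' = partialDepth E T P + 2 ∧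
          numKnown T P < numKnown T P'

/-- `s`-seamless fault tolerance. -/
def Seamless : ℕ → Prop
  | 0 => True
  | s + 1 => Seamless s ∧
      ∀ E : List (Step I), IsExec E → numCrashes E = s →
        ∀ P, P <+: E → numCrashes P = s → ∀ i, ¬ Crashed P i →
          ∃ E' : List (Step I), IsExec E' ∧ P ++ [Step.crash i] <+: E' ∧
            E'.filter Step.isCoordEvent = E.filter Step.isCoordEvent ∧
            ∀ T, Decided E T → txnDepth E' T = txnDepth E T

end Implementation

end PDTS

/-! Take a cycle of `m + 2 = max n 2` transactions (`cycleTxn`): transaction `i` reads item `X i`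
and, if it finds the initial value, writes another value to `X (i + 1)`. If all of them commit in
one execution after reading initial values, it is not serializable: the first one in the serial
order, say `i`, overwrites `X (i + 1)`, nobody writes the initial value back, and transaction `i +
1` reads it later (`not_serializable_cycle`). The work lies in building such an execution, by
interleaving solo runs so that no transaction notices the others (`Guarantees.exists_cycle`).

The solo runs. Run alone, transaction `i` commits and reads the initial value. Seamless fault
tolerance, with node `i` crashing at the very start, yields a run with the same response that never
touches node `i` (`exists_avoiding`). Fast decision bounds the depth of the response by four, since
only one value can become known (`txnDepth_le_four`). Nodes talk to clients only, so client steps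
have even depth and node steps odd depth (`depth_parity`); up to the response only depths one and
three concern the nodes. Primitives of depth one are trivial (`Guarantees.depth_one_trivial`): the
steps leading to them do not depend on the value of `X i`, so they also fit into an execution in
which the transaction turns out to be read-only. Hence all changes of shared memory happen at depth
three.

The interleaving. All transactions take their steps of depth at most two, then those of depth three
node by node, then those of depth four. On node `j` the transactions act in the cyclic order `j -
1`, `j - 2`, ..., `j + 1`; transaction `j` avoids this node, and its absence cuts the cycle open, so
that on no node does `i + 1` act after `i` (`nodeOrder`). Those acting before `i` are therefore of
two kinds. If the data set is disjoint from that of `i`, disjoint-access parallelism forbids changes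
to any object that `i` accesses (`Family.mops_eq_nil_of_disjoint`). Transaction `i + 1` shares with
`i` only an item that it reads; by invisible reads it can be replaced by a transaction that performs
its writes only. This one has a disjoint data set, and the replacement leaves the values returned to
`i` as they are (`Family.matches_afterCommit`, `Family.ret_after`). So every primitive returns what
it returned in the solo run.

Two tools serve throughout. A step depends only on the history of its process, on the message it
receives and on the effects of non-trivial primitives on the object it accesses
(`IsExec.transfer_fix`). A fair scheduler turns progress, a statement about infinite executions,
into finite ones (`exists_fair_run`). -/

namespace PDTS

variable {n : ℕ} {Item : Type u} {Val : Type v} {I : Implementation.{u, v, w} n Item Val}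

/-! ### Local states and memory contents as functions of the execution -/

/-- The local state after sending a message. -/
def sendLoc (I : Implementation.{u, v, w} n Item Val) :
    I.CState ⊕ I.HState → I.CState ⊕ I.HState
  | .inl s => match I.coordNext s with
    | .send _ _ s' => .inl s'
    -- A handler that performs a send is in a sending state, so this default is never used along an
    -- execution; the same holds for the other defaults below.
    | _ => .inl s
  | .inr s => match I.handlerNext s with
    | .send _ _ s' => .inr s'
    | _ => .inr s

/-- The local state after receiving the message `m`. -/
def recvLoc (I : Implementation.{u, v, w} n Item Val) (m : I.Msg) :
    I.CState ⊕ I.HState → I.CState ⊕ I.HState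
  | .inl s => match I.coordNext s with
    | .recv f => .inl (f m)
    | _ => .inl s
  | .inr s => match I.handlerNext s with
    | .recv f => .inr (f m)
    | _ => .inr s

/-- The local state after a primitive that returned `r`. -/
def primLoc (I : Implementation.{u, v, w} n Item Val) (r : I.Ret) :
    I.CState ⊕ I.HState → I.CState ⊕ I.HState
  | .inl s => .inl s
  | .inr s => match I.handlerNext s with
    | .prim _ _ f => .inr (f r)
    | _ => .inr s

/-- The handler that a process runs after a step of its own. -/
def upd (ro : Option (Running I)) : Step I → Option (Running I)
  | .crash _ => ro
  | .act (.client c) T _ .invoke => some ⟨T, [], 0, .inl (I.coordInit c T)⟩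
  | .act (.node _ _) _ _ .invoke => ro
  | .act (.client _) _ _ (.start _) => ro
  | .act (.node i _) T h (.start m) => some ⟨T, h, 0, .inr (I.handlerInit i T h m)⟩
  | .act _ _ _ (.respond _ _) => none
  | .act _ _ _ .finish => none
  | .act _ _ _ (.send _ _ _) => ro.map fun r => ⟨r.txn, r.hid, r.sent + 1, sendLoc I r.loc⟩
  | .act _ _ _ (.recv _ _ m) => ro.map fun r => ⟨r.txn, r.hid, r.sent, recvLoc I m r.loc⟩
  | .act _ _ _ (.prim _ _ a) => ro.map fun r => ⟨r.txn, r.hid, r.sent, primLoc I a r.loc⟩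

/-- The handler that process `p` runs at the end of `E`. -/
noncomputable def runOf (E : List (Step I)) (p : Proc n) : Option (Running I) :=
  (proj p E).foldl upd none

open Classical in
/-- The effect of a step on object `x` of node `i`, if it may be non-trivial. -/
noncomputable def stepMop (i : Fin n) (x : I.Obj) : Step I → Option (I.OVal → I.OVal)
  | .act (.node j _) _ _ (.prim y op _) =>
      if j = i ∧ y = x ∧ NonTrivial op then some fun a => (op a).1 else none
  | _ => none

/-- The effects of the non-trivial primitives on object `x` of node `i`. -/
noncomputable def mops (i : Fin n) (x : I.Obj) (E : List (Step I)) : List (I.OVal → I.OVal) :=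
  E.filterMap (stepMop i x)

/-- The contents of object `x` of node `i` after the given effects. -/
def foldMem (I : Implementation.{u, v, w} n Item Val) (i : Fin n) (x : I.Obj)
    (l : List (I.OVal → I.OVal)) : I.OVal :=
  l.foldl (fun a f => f a) (I.initObj i x)

theorem mops_append (i : Fin n) (x : I.Obj) (E F : List (Step I)) :
    mops i x (E ++ F) = mops i x E ++ mops i x F := List.filterMap_append

theorem proj_append (p : Proc n) (E F : List (Step I)) :
    proj p (E ++ F) = proj p E ++ proj p F := List.filter_append ..

open Classical in
theorem runOf_snoc (E : List (Step I)) (s : Step I) (p : Proc n) :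
    runOf (E ++ [s]) p = if s.proc = some p then upd (runOf E p) s else runOf E p := by
  unfold runOf
  rw [proj_append, List.foldl_append]
  by_cases h : s.proc = some p
  · simp [proj, h]
  · simp [proj, h]

/-- Apart from the previous state, everything that enters the new state (message received, value
returned) is recorded in the step itself. So a process state can be computed from the steps alone.
-/
theorem Trans.running_eq {C C' : Config I} {s : Step I} (h : Trans C s C') (p : Proc n) :
    (s.proc = some p → C'.running p = upd (C.running p) s) ∧
      (s.proc ≠ some p → C'.running p = C.running p) := by
  classical
  cases h <;> refine ⟨fun hp => ?_, fun hp => ?_⟩ <;>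
    first
    | (simp only [Step.proc, Option.some.injEq, reduceCtorEq] at hp
       subst hp
       simp_all [Config.setRunning, upd, Config.addPacket, Config.removePacket, Config.setObj,
        sendLoc, recvLoc, primLoc])
    | (simp only [Step.proc, Option.some.injEq, ne_eq] at hp
       simp [Config.setRunning, Config.addPacket, Config.removePacket, Config.setObj,
        Ne.symm hp])
    | rfl

-- Trivial primitives may be left out of the list of effects, because they fix every value.
open Classical in
theorem foldMem_snoc_mops (i : Fin n) (x : I.Obj) (E : List (Step I)) (s : Step I) :
    foldMem I i x (mops i x (E ++ [s])) = match s with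
      | .act (.node j _) _ _ (.prim y op _) =>
          if j = i ∧ y = x then (op (foldMem I i x (mops i x E))).1 else foldMem I i x (mops i x E)
      | _ => foldMem I i x (mops i x E) := by
  rw [mops_append]
  have hm : mops i x [s] = (stepMop i x s).toList := by
    simp only [mops, List.filterMap_cons, List.filterMap_nil]
    cases stepMop i x s <;> rfl
  rw [hm]
  rcases s with j | ⟨p, T, h, a⟩
  · simp [stepMop]
  · rcases p with c | ⟨j, l⟩
    · simp [stepMop]
    · cases a
      case prim y op r =>
        by_cases h1 : j = i ∧ y = x
        · by_cases h2 : NonTrivial op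
          · simp [stepMop, h1, h2, foldMem]
          · simp only [stepMop, h1, h2, and_false, if_false, and_self, if_true, List.append_nil,
              Option.toList_none]
            simp only [NonTrivial, not_exists, not_not, ne_eq] at h2
            simp [h2]
        · have h3 : ¬ (j = i ∧ y = x ∧ NonTrivial op) := fun h => h1 ⟨h.1, h.2.1⟩
          simp [stepMop, h1, h3]
      all_goals simp [stepMop]

/-- To compare an object in two executions it suffices to compare the non-trivial primitives applied
to it, in order. -/
theorem Reaches.mem_eq {E : List (Step I)} {C : Config I} (h : Reaches E C) (i : Fin n)
    (x : I.Obj) : C.mem i x = foldMem I i x (mops i x E) := by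
  classical
  induction h with
  | nil => rfl
  | snoc hE ht ih =>
    rw [foldMem_snoc_mops]
    cases ht
    case prim j l T h k s y op f live run next =>
      by_cases h1 : i = j
      · subst h1
        by_cases h2 : x = y
        · subst h2
          simp [Config.setRunning, Config.setObj, ih]
        · simp [Config.setRunning, Config.setObj, ih, h2, Ne.symm h2]
      · simp [Config.setRunning, Config.setObj, ih, h1, Ne.symm h1]
    all_goals simp [Config.setRunning, Config.addPacket, Config.removePacket, ih]

/-- Indistinguishability: a process with the same projection in two executions is in the same state
in both. -/
theorem Reaches.running_eq {E : List (Step I)} {C : Config I} (h : Reaches E C) (p : Proc n) :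
    C.running p = runOf E p := by
  classical
  induction h with
  | nil => rfl
  | snoc hE ht ih =>
    rw [runOf_snoc, ← ih]
    split_ifs with h
    · exact (ht.running_eq p).1 h
    · exact (ht.running_eq p).2 h

theorem Reaches.crashed_iff {E : List (Step I)} {C : Config I} (h : Reaches E C) (i : Fin n) :
    i ∈ C.crashed ↔ Crashed E i := by
  induction h with
  | nil => simp [initConfig, Crashed]
  | snoc hE ht ih =>
    cases ht <;> simp_all [Crashed, Config.setRunning, Config.addPacket, Config.removePacket,
      Config.setObj, or_comm]

theorem Reaches.used_iff {E : List (Step I)} {C : Config I} (h : Reaches E C) (k : ℕ) :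
    k ∈ C.used ↔ ∃ T, Invoked E T ∧ T.id = k := by
  induction h with
  | nil => simp [initConfig, Invoked]
  | snoc hE ht ih =>
    cases ht
    case invoke T _ _ =>
      simp only [Config.setRunning, Set.mem_insert_iff, ih, Invoked, List.mem_append,
        List.mem_singleton]
      constructor
      · rintro (rfl | ⟨T', ⟨p, h, h'⟩, rfl⟩)
        · exact ⟨_, ⟨_, _, Or.inr rfl⟩, rfl⟩
        · exact ⟨T', ⟨p, h, Or.inl h'⟩, rfl⟩
      · rintro ⟨T', ⟨p, h, h' | h'⟩, rfl⟩
        · exact Or.inr ⟨T', ⟨p, h, h'⟩, rfl⟩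
        · cases h'; exact Or.inl rfl
    all_goals simp_all [Invoked, Config.setRunning, Config.addPacket, Config.removePacket,
      Config.setObj]

/-! ### Prefixes and one-step extensions of executions -/

theorem IsExec.nil : IsExec ([] : List (Step I)) := ⟨_, .nil⟩

theorem Reaches.prefix {E F : List (Step I)} {C : Config I} (h : Reaches (E ++ F) C) :
    IsExec E := by
  induction F using List.reverseRecOn generalizing C with
  | nil => exact ⟨C, by simpa using h⟩
  | append_singleton F s ih =>
    rw [← List.append_assoc] at h
    generalize hG : E ++ F ++ [s] = G at h
    cases h with
    | nil => simp at hG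
    | snoc hE ht =>
      have := List.append_inj_left' hG (by simp)
      subst this
      exact ih hE

theorem IsExec.of_append {E F : List (Step I)} (h : IsExec (E ++ F)) : IsExec E :=
  h.choose_spec.prefix

theorem IsExec.of_prefix {E F : List (Step I)} (h : IsExec F) (hp : E <+: F) : IsExec E := by
  obtain ⟨G, rfl⟩ := hp
  exact h.of_append

theorem isExec_snoc_iff {E : List (Step I)} {s : Step I} :
    IsExec (E ++ [s]) ↔ ∃ C C', Reaches E C ∧ Trans C s C' := by
  constructor
  · rintro ⟨C, h⟩
    generalize hG : E ++ [s] = G at h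
    cases h with
    | nil => simp at hG
    | snoc hE ht =>
      have h1 := List.append_inj_left' hG (by simp)
      have h2 := List.append_inj_right' hG (by simp)
      subst h1
      cases h2
      exact ⟨_, _, hE, ht⟩
  · rintro ⟨C, C', h, ht⟩
    exact ⟨C', h.snoc ht⟩

end PDTS

namespace PDTS

variable {n : ℕ} {Item : Type u} {Val : Type v} {I : Implementation.{u, v, w} n Item Val}

/-! ### Uniqueness of handlers, messages and responses -/

/-- Facts about the configuration `C` reached by `E`. -/
structure Inv (E : List (Step I)) (C : Config I) : Prop where
  client : ∀ c r, C.running (.client c) = some r → r.hid = [] ∧ (∃ st, r.loc = .inl st) ∧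
    Step.act (.client c) r.txn [] .invoke ∈ E ∧ ¬ Decided E r.txn
  node : ∀ i l r, C.running (.node i l) = some r → (∃ k src, r.hid = k :: src) ∧
    (∃ st, r.loc = .inr st) ∧ (∃ m, Step.act (.node i l) r.txn r.hid (.start m) ∈ E) ∧
    ∀ p, Step.act p r.txn r.hid .finish ∉ E
  inj : ∀ p p' r r', C.running p = some r → C.running p' = some r' → r.txn = r'.txn →
    r.hid = r'.hid → p = p'
  sent : ∀ p r, C.running p = some r → ∀ p' k d m,
    Step.act p' r.txn r.hid (.send k d m) ∈ E → k < r.sent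
  transit : ∀ q : Packet I, q ∈ C.transit ↔
    (∃ p, Step.act p q.txn q.src (.send q.idx q.dest q.msg) ∈ E) ∧
      ∀ s ∈ E, ¬ s.Receives q.txn q.src q.idx
  begun : ∀ p T h a, Step.act p T h a ∈ E →
    (∃ c, p = .client c ∧ h = [] ∧ Step.act p T [] .invoke ∈ E) ∨
    (∃ i l k src m, p = .node i l ∧ h = k :: src ∧ Step.act p T h (.start m) ∈ E)
  invoked : ∀ p T h a, Step.act p T h a ∈ E → Invoked E T
  id_inj : ∀ T T', Invoked E T → Invoked E T' → T.id = T'.id → T = T'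
  send_uniq : E.Pairwise fun s s' => ∀ T src k, s.Sends T src k → ¬ s'.Sends T src k
  recv_uniq : E.Pairwise fun s s' => ∀ T src k, s.Receives T src k → ¬ s'.Receives T src k
  invoke_uniq : E.Pairwise fun s s' => ∀ p p' T h h',
    s = .act p T h .invoke → s' ≠ .act p' T h' .invoke
  respond_uniq : E.Pairwise fun s s' => ∀ p p' T h h' o o' ops ops',
    s = .act p T h (.respond o ops) → s' ≠ .act p' T h' (.respond o' ops')
  start_sent : ∀ i l T k src m, Step.act (.node i l) T (k :: src) (.start m) ∈ E →
    ∃ p, Step.act p T src (.send k (.toNode (.fresh i)) m) ∈ E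
  recv_sent : ∀ p T h src k m, Step.act p T h (.recv src k m) ∈ E →
    ∃ p' d, Step.act p' T src (.send k d m) ∈ E ∧
      ((∃ c, p = .client c ∧ d = .toClient) ∨
        ∃ i l k' src', p = .node i l ∧ h = k' :: src' ∧ d = .toNode (.running k' src'))

theorem decided_snoc (E : List (Step I)) (s : Step I) (T : Txn Item Val) :
    Decided (E ++ [s]) T ↔ Decided E T ∨ ∃ p h o ops, s = .act p T h (.respond o ops) := by
  simp only [Decided, Returns, List.mem_append, List.mem_singleton]
  constructor
  · rintro ⟨o, ops, p, h, h1 | h1⟩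
    · exact .inl ⟨o, ops, p, h, h1⟩
    · exact .inr ⟨p, h, o, ops, h1.symm⟩
  · rintro (⟨o, ops, p, h, h1⟩ | ⟨p, h, o, ops, h1⟩)
    · exact ⟨o, ops, p, h, .inl h1⟩
    · exact ⟨o, ops, p, h, .inr h1.symm⟩

theorem invoked_snoc (E : List (Step I)) (s : Step I) (T : Txn Item Val) :
    Invoked (E ++ [s]) T ↔ Invoked E T ∨ ∃ p h, s = .act p T h .invoke := by
  simp only [Invoked, List.mem_append, List.mem_singleton]
  constructor
  · rintro ⟨p, h, h1 | h1⟩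
    · exact .inl ⟨p, h, h1⟩
    · exact .inr ⟨p, h, h1.symm⟩
  · rintro (⟨p, h, h1⟩ | ⟨p, h, h1⟩)
    · exact ⟨p, h, .inl h1⟩
    · exact ⟨p, h, .inr h1.symm⟩

theorem setRunning_self (C : Config I) (p : Proc n) (r : Option (Running I)) :
    (C.setRunning p r).running p = r := by simp [Config.setRunning]

/-- The kinds of steps, and their effects on the handlers and the messages in transit. -/
theorem Trans.view {C C' : Config I} {s : Step I} (ht : Trans C s C') :
    (∃ i, s = .crash i ∧ C'.running = C.running ∧ C'.transit = C.transit) ∨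
    ∃ p T h a, s = .act p T h a ∧ (∀ p', p' ≠ p → C'.running p' = C.running p') ∧
      ((∃ c st, p = .client c ∧ h = [] ∧ a = .invoke ∧ T.id ∉ C.used ∧
          C'.running p = some ⟨T, h, 0, .inl st⟩ ∧ C'.transit = C.transit) ∨
       (∃ i l j src m st, p = .node i l ∧ h = j :: src ∧ a = .start m ∧
          (⟨T, src, j, .toNode (.fresh i), m⟩ : Packet I) ∈ C.transit ∧
          C'.running p = some ⟨T, h, 0, .inr st⟩ ∧
          C'.transit = C.transit \ {⟨T, src, j, .toNode (.fresh i), m⟩}) ∨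
       (∃ k loc loc', C.running p = some ⟨T, h, k, loc⟩ ∧ C'.running p = some ⟨T, h, k, loc'⟩ ∧
          loc.isLeft = loc'.isLeft ∧ (∃ x op r, a = .prim x op r) ∧ C'.transit = C.transit) ∨
       (∃ k loc loc' d m, C.running p = some ⟨T, h, k, loc⟩ ∧
          C'.running p = some ⟨T, h, k + 1, loc'⟩ ∧ loc.isLeft = loc'.isLeft ∧
          a = .send k d m ∧ C'.transit = insert ⟨T, h, k, d, m⟩ C.transit) ∨
       (∃ k loc loc' src j d m, C.running p = some ⟨T, h, k, loc⟩ ∧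
          C'.running p = some ⟨T, h, k, loc'⟩ ∧ loc.isLeft = loc'.isLeft ∧
          a = .recv src j m ∧ (⟨T, src, j, d, m⟩ : Packet I) ∈ C.transit ∧
          ((∃ c, p = .client c ∧ d = .toClient) ∨
            ∃ i l k' src', p = .node i l ∧ h = k' :: src' ∧ d = .toNode (.running k' src')) ∧
          C'.transit = C.transit \ {⟨T, src, j, d, m⟩}) ∨
       (∃ k loc, C.running p = some ⟨T, h, k, loc⟩ ∧ C'.running p = none ∧
          C'.transit = C.transit ∧
          ((∃ c o ops, p = .client c ∧ a = .respond o ops) ∨ ∃ i l, p = .node i l ∧ a = .finish))) := by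
  cases ht
  case crash => exact .inl ⟨_, rfl, rfl, rfl⟩
  all_goals
    refine .inr ⟨_, _, _, _, rfl, fun p' hp' => ?_, ?_⟩
    · simp [Config.setRunning, Config.addPacket, Config.removePacket, Config.setObj, hp']
  case invoke c T idle new =>
    exact .inl ⟨_, _, rfl, rfl, rfl, new, setRunning_self .., rfl⟩
  case start i l T src j m live idle sent =>
    exact .inr (.inl ⟨_, _, _, _, _, _, rfl, rfl, rfl, sent, setRunning_self .., rfl⟩)
  case prim i l T h k s x op f live run next =>
    exact .inr (.inr (.inl ⟨_, _, _, run, setRunning_self .., rfl, ⟨_, _, _, rfl⟩,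
      rfl⟩))
  case coordSend c T h k s s' d m run next =>
    exact .inr (.inr (.inr (.inl ⟨_, _, _, _, _, run, setRunning_self .., rfl, rfl,
      rfl⟩)))
  case handlerSend i l T h k s s' d m live run next =>
    exact .inr (.inr (.inr (.inl ⟨_, _, _, _, _, run, setRunning_self .., rfl, rfl,
      rfl⟩)))
  case coordRecv c T h k s f src j m run next sent =>
    exact .inr (.inr (.inr (.inr (.inl ⟨_, _, _, _, _, _, _, run,
      setRunning_self .., rfl, rfl, sent, .inl ⟨_, rfl, rfl⟩, rfl⟩))))
  case handlerRecv i l T j' h' k s f src j m live run next sent =>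
    exact .inr (.inr (.inr (.inr (.inl ⟨_, _, _, _, _, _, _, run,
      setRunning_self .., rfl, rfl, sent, .inr ⟨_, _, _, _, rfl, rfl, rfl⟩, rfl⟩))))
  case respond c T h k s o ops run next =>
    exact .inr (.inr (.inr (.inr (.inr ⟨_, _, run, setRunning_self .., rfl,
      .inl ⟨_, _, _, rfl, rfl⟩⟩))))
  case finish i l T h k s live run next =>
    exact .inr (.inr (.inr (.inr (.inr ⟨_, _, run, setRunning_self .., rfl,
      .inr ⟨_, _, rfl, rfl⟩⟩))))

theorem receives_act {p : Proc n} {T : Txn Item Val} {h : HId} {a : Act I} {T' : Txn Item Val}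
    {src : HId} {k : ℕ} :
    (Step.act p T h a).Receives T' src k ↔ T = T' ∧
      ((h = k :: src ∧ ∃ m, a = .start m) ∨ ∃ m, a = .recv src k m) := by
  simp only [Step.Receives, Step.act.injEq]
  grind

theorem sends_act {p : Proc n} {T : Txn Item Val} {h : HId} {a : Act I} {T' : Txn Item Val}
    {src : HId} {k : ℕ} :
    (Step.act p T h a).Sends T' src k ↔ T = T' ∧ h = src ∧ ∃ d m, a = .send k d m := by
  simp only [Step.Sends, Step.act.injEq]
  grind

theorem Step.Receives.exists_act {s : Step I} {T : Txn Item Val} {src : HId} {k : ℕ}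
    (h : s.Receives T src k) : ∃ p hid a, s = .act p T hid a := by
  rcases h with ⟨p, m, rfl⟩ | ⟨p, h, m, rfl⟩ <;> exact ⟨_, _, _, rfl⟩

theorem Inv.sent_of_receives {E : List (Step I)} {C : Config I} (hi : Inv E C) {s : Step I}
    (hs : s ∈ E) {T : Txn Item Val} {src : HId} {k : ℕ} (hr : s.Receives T src k) :
    ∃ p d m, Step.act p T src (.send k d m) ∈ E := by
  rcases hr with ⟨p, m, rfl⟩ | ⟨p, h, m, rfl⟩
  · rcases hi.begun _ _ _ _ hs with ⟨c, _, h, _⟩ | ⟨i, l, k', src', m', rfl, h, _⟩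
    · cases h
    · obtain ⟨p, hp⟩ := hi.start_sent _ _ _ _ _ _ hs
      exact ⟨_, _, _, hp⟩
  · obtain ⟨p, d, h, _⟩ := hi.recv_sent _ _ _ _ _ _ hs
    exact ⟨_, _, _, h⟩

theorem right_of_isLeft_eq {α β : Type*} {x y : α ⊕ β} {b : β} (h : x = .inr b)
    (hxy : x.isLeft = y.isLeft) : ∃ b', y = .inr b' := by
  cases y <;> simp_all

theorem pairwise_unique {α : Type*} {R : α → Prop} {l : List α}
    (h : l.Pairwise fun a b => R a → ¬ R b) {a b : α} (ha : a ∈ l) (hb : b ∈ l) (hRa : R a)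
    (hRb : R b) : a = b := by
  induction l with
  | nil => cases ha
  | cons c l ih =>
    rw [List.pairwise_cons] at h
    rcases List.mem_cons.1 ha with rfl | ha' <;> rcases List.mem_cons.1 hb with rfl | hb'
    · rfl
    · exact absurd hRb (h.1 _ hb' hRa)
    · exact absurd hRa (h.1 _ ha' hRb)
    · exact ih h.2 ha' hb'

theorem Inv.send_eq {E : List (Step I)} {C : Config I} (hi : Inv E C) {s s' : Step I}
    (hs : s ∈ E) (hs' : s' ∈ E) {T : Txn Item Val} {src : HId} {k : ℕ} (h : s.Sends T src k)
    (h' : s'.Sends T src k) : s = s' :=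
  pairwise_unique (hi.send_uniq.imp fun h => h T src k) hs hs' h h'

theorem Inv.recv_eq {E : List (Step I)} {C : Config I} (hi : Inv E C) {s s' : Step I}
    (hs : s ∈ E) (hs' : s' ∈ E) {T : Txn Item Val} {src : HId} {k : ℕ} (h : s.Receives T src k)
    (h' : s'.Receives T src k) : s = s' :=
  pairwise_unique (hi.recv_uniq.imp fun h => h T src k) hs hs' h h'

-- The facts have to be carried through together. An unused identifier makes an invoked transaction
-- new, the removal of a packet from transit prevents a second handler of the same name, the counter
-- `sent` makes every message new, and a running coordinator is undecided, which excludes a second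
-- response.
set_option maxHeartbeats 2000000 in
theorem Inv.snoc {E : List (Step I)} {C C' : Config I} {s : Step I} (hR : Reaches E C)
    (hi : Inv E C) (ht : Trans C s C') : Inv (E ++ [s]) C' := by
  have hused := hR.used_iff
  have hpw : ∀ {R : Step I → Step I → Prop}, E.Pairwise R → (∀ s' ∈ E, R s' s) →
      (E ++ [s]).Pairwise R := by
    intro R h1 h2
    rw [List.pairwise_append]
    exact ⟨h1, List.pairwise_singleton _ _, fun a ha b hb => by
      rw [List.mem_singleton] at hb; subst hb; exact h2 a ha⟩
  have hsr := @Inv.sent_of_receives _ _ _ _ _ _ hi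
  rcases ht.view with ⟨i, rfl, h1, h2⟩ | ⟨p, T, h, a, rfl, hp, hv⟩
  · have h3 : ∀ T, Invoked (E ++ [Step.crash i]) T ↔ Invoked E T := by
      intro T; rw [invoked_snoc]; simp
    have h4 : ∀ T, Decided (E ++ [Step.crash i]) T ↔ Decided E T := by
      intro T; rw [decided_snoc]; simp
    obtain ⟨f1, f2, f3, f4, f5, f6, f7, f8, f9, f10, f11, f12, f13, f14⟩ := hi
    constructor
    case send_uniq => exact hpw f9 (by simp [Step.Sends])
    case recv_uniq => exact hpw f10 (by simp [Step.Receives])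
    case invoke_uniq => exact hpw f11 (by simp)
    case respond_uniq => exact hpw f12 (by simp)
    case transit =>
      intro q
      rw [h2, f5 q]
      simp [or_imp, forall_and, Step.Receives]
    all_goals simp only [h1, h3, h4, List.mem_append, List.mem_singleton, reduceCtorEq, or_false]
    all_goals assumption
  · have f1 := hi.client
    have f2 := hi.node
    have f3 := hi.inj
    have f4 := hi.sent
    have f5 := hi.transit
    have f6 := hi.begun
    have f7 := hi.invoked
    have f8 := hi.id_inj
    have hdec : ∀ T, Decided E T → Invoked E T := by
      rintro T ⟨o, ops, p, h, h1⟩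
      exact f7 _ _ _ _ h1
    have hmem : ∀ s, s ∈ E ++ [Step.act p T h a] ↔ s ∈ E ∨ s = .act p T h a := by simp
    have hrun : ∀ p', p' = p ∨ C'.running p' = C.running p' := fun p' => by
      by_cases h : p' = p
      · exact .inl h
      · exact .inr (hp p' h)
    clear hp ht hR
    have hd : ∀ T1, Decided (E ++ [Step.act p T h a]) T1 ↔
        Decided E T1 ∨ (T = T1 ∧ ∃ o ops, a = .respond o ops) := by
      intro T1; rw [decided_snoc]; simp only [Step.act.injEq]; grind
    have hiv : ∀ T1, Invoked (E ++ [Step.act p T h a]) T1 ↔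
        Invoked E T1 ∨ (T = T1 ∧ a = .invoke) := by
      intro T1; rw [invoked_snoc]; simp only [Step.act.injEq]; grind
    have hnew : T.id ∉ C.used → ∀ p h a, Step.act p T h a ∉ E := by
      intro h1 p h a h2
      exact h1 ((hused _).2 ⟨T, f7 _ _ _ _ h2, rfl⟩)
    have hfin : ∀ p k src m, Step.act p T (k :: src) (.start m) ∈ E → ∀ d m',
        (⟨T, src, k, d, m'⟩ : Packet I) ∉ C.transit := by
      intro p k src m h1 d m' h2
      exact ((f5 _).1 h2).2 _ h1 (.inl ⟨_, _, rfl⟩)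
    have hbeg : ∀ p' T' k src a', Step.act p' T' (k :: src) a' ∈ E →
        ∃ p m, Step.act p T' (k :: src) (.start m) ∈ E := by
      intro p' T' k src a' h1
      rcases f6 _ _ _ _ h1 with ⟨_, _, h2, _⟩ | ⟨_, _, _, _, m, _, h3, h4⟩
      · cases h2
      · exact ⟨_, _, h4⟩
    constructor
    case client =>
      intro c r hr
      rw [hd, hmem]
      rcases hrun (.client c) with rfl | h1
      · clear f2 f3 f4 f5 f6 f8 hsr hpw
        rcases hv with h | h | h | h | h | h <;> grind
      · rw [h1] at hr
        have h2 := f1 _ _ hr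
        have h3 := fun p' r' => f3 _ p' _ r' hr
        clear f2 f3 f4 f5 f6 f8 hsr hpw
        rcases hv with h | h | h | h | h | h <;> grind
    case node =>
      intro c l r hr
      simp only [hmem, Step.act.injEq]
      rcases hrun (.node c l) with rfl | h1
      · rcases hv with ⟨c, st, h1, -⟩ | ⟨i, l, j, src, m, st, h1, rfl, rfl, h2, h3, -⟩ |
          ⟨k, loc, loc', h1, h2, h3, ⟨x, op, r', rfl⟩, -⟩ | ⟨k, loc, loc', d, m, h1, h2, h3, rfl, -⟩ |
          ⟨k, loc, loc', src, j, d, m, h1, h2, h3, rfl, -⟩ | ⟨k, loc, h1, h2, -⟩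
        · cases h1
        · cases h1
          rw [h3] at hr
          cases hr
          refine ⟨⟨_, _, rfl⟩, ⟨_, rfl⟩, ⟨m, .inr ⟨rfl, rfl, rfl, rfl⟩⟩, fun p => ?_⟩
          rintro (h5 | ⟨_, _, _, h5⟩)
          · obtain ⟨p, m, h6⟩ := hbeg _ _ _ _ _ h5
            exact hfin _ _ _ _ h6 _ _ h2
          · cases h5
        · rw [h2] at hr; cases hr
          obtain ⟨g1, ⟨st, g2⟩, ⟨m, g3⟩, g4⟩ := f2 _ _ _ h1
          refine ⟨g1, ?_, ⟨m, .inl g3⟩, fun p => ?_⟩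
          · exact right_of_isLeft_eq g2 h3
          · simp [g4]
        · rw [h2] at hr; cases hr
          obtain ⟨g1, ⟨st, g2⟩, ⟨m, g3⟩, g4⟩ := f2 _ _ _ h1
          refine ⟨g1, ?_, ⟨m, .inl g3⟩, fun p => ?_⟩
          · exact right_of_isLeft_eq g2 h3
          · simp [g4]
        · rw [h2] at hr; cases hr
          obtain ⟨g1, ⟨st, g2⟩, ⟨m, g3⟩, g4⟩ := f2 _ _ _ h1
          refine ⟨g1, ?_, ⟨m, .inl g3⟩, fun p => ?_⟩
          · exact right_of_isLeft_eq g2 h3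
          · simp [g4]
        · rw [h2] at hr; cases hr
      · rw [h1] at hr
        obtain ⟨g1, g2, ⟨m, g3⟩, g4⟩ := f2 _ _ _ hr
        refine ⟨g1, g2, ⟨m, .inl g3⟩, fun p' => ?_⟩
        rintro (h5 | ⟨rfl, rfl, rfl, rfl⟩)
        · exact g4 _ h5
        · rcases hv with h | h | h | h | h | ⟨k, loc, h3, h4, -⟩
          · grind
          · grind
          · grind
          · grind
          · grind
          · have := f3 _ _ _ _ hr h3 rfl rfl
            subst this
            rw [h1, hr] at h4
            cases h4
    case inj =>
      have key : ∀ p' r r', p' ≠ p → C.running p' = some r → C'.running p = some r' →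
          r.txn = r'.txn → r.hid = r'.hid → False := by
        intro p' r r' hne h1 h2 h3 h4
        rcases hv with ⟨c, st, rfl, rfl, rfl, h6, h7, -⟩ |
          ⟨i, l, j, src, m, st, rfl, rfl, rfl, h6, h7, -⟩ |
          ⟨k, loc, loc', h6, h7, -⟩ | ⟨k, loc, loc', d, m, h6, h7, -⟩ |
          ⟨k, loc, loc', src, j, d, m, h6, h7, -⟩ | ⟨k, loc, h6, h7, -⟩
        · rw [h7] at h2; cases h2
          dsimp only at h3 h4
          rcases p' with c' | ⟨i', l'⟩
          · exact hnew h6 _ _ _ (h3 ▸ (f1 _ _ h1).2.2.1)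
          · obtain ⟨m, h8⟩ := (f2 _ _ _ h1).2.2.1
            exact hnew h6 _ _ _ (h3 ▸ h8)
        · rw [h7] at h2; cases h2
          dsimp only at h3 h4
          rcases p' with c' | ⟨i', l'⟩
          · rw [(f1 _ _ h1).1] at h4; cases h4
          · obtain ⟨m', h8⟩ := (f2 _ _ _ h1).2.2.1
            rw [h3, h4] at h8
            exact hfin _ _ _ _ h8 _ _ h6
        · rw [h7] at h2; cases h2
          exact hne (f3 _ _ _ _ h1 h6 h3 h4)
        · rw [h7] at h2; cases h2
          exact hne (f3 _ _ _ _ h1 h6 h3 h4)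
        · rw [h7] at h2; cases h2
          exact hne (f3 _ _ _ _ h1 h6 h3 h4)
        · rw [h7] at h2; cases h2
      intro p1 p2 r r' hr hr' h1 h2
      by_contra hne
      rcases hrun p1 with rfl | h3
      · rcases hrun p2 with rfl | h4
        · exact hne rfl
        · rw [h4] at hr'
          exact key _ _ _ (Ne.symm hne) hr' hr h1.symm h2.symm
      · rw [h3] at hr
        rcases hrun p2 with rfl | h4
        · exact key _ _ _ hne hr hr' h1 h2
        · rw [h4] at hr'
          exact hne (f3 _ _ _ _ hr hr' h1 h2)
    case sent =>
      have hsnd : ∀ {k d m}, a = .send k d m → ∃ loc, C.running p = some ⟨T, h, k, loc⟩ ∧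
          ∃ loc', C'.running p = some ⟨T, h, k + 1, loc'⟩ := by
        intro k d m ha
        clear hpw hsr
        rcases hv with h | h | h | h | h | h <;> grind
      intro p1 r hr p2 k d m hs
      rcases hrun p1 with rfl | h3
      · rcases hv with ⟨c, st, rfl, rfl, rfl, h6, h7, -⟩ |
          ⟨i, l, j, src, m, st, rfl, rfl, rfl, h6, h7, -⟩ |
          ⟨k, loc, loc', h6, h7, -, ⟨x, op, r', rfl⟩, -⟩ | ⟨k, loc, loc', d, m, h6, h7, -, rfl, -⟩ |
          ⟨k, loc, loc', src, j, d, m, h6, h7, -, rfl, -⟩ | ⟨k, loc, h6, h7, -⟩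
        · rw [h7] at hr; cases hr
          rw [hmem] at hs
          rcases hs with hs | hs
          · exact absurd hs (hnew h6 _ _ _)
          · cases hs
        · rw [h7] at hr; cases hr
          rw [hmem] at hs
          rcases hs with hs | hs
          · obtain ⟨p, m, h8⟩ := hbeg _ _ _ _ _ hs
            exact absurd h6 (hfin _ _ _ _ h8 _ _)
          · cases hs
        · rw [h7] at hr; cases hr
          rw [hmem] at hs
          rcases hs with hs | hs
          · exact f4 _ _ h6 _ _ _ _ hs
          · cases hs
        · rw [h7] at hr; cases hr
          rw [hmem] at hs
          rcases hs with hs | hs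
          · exact (f4 _ _ h6 _ _ _ _ hs).trans (Nat.lt_succ_self _)
          · cases hs; exact Nat.lt_succ_self _
        · rw [h7] at hr; cases hr
          rw [hmem] at hs
          rcases hs with hs | hs
          · exact f4 _ _ h6 _ _ _ _ hs
          · cases hs
        · rw [h7] at hr; cases hr
      · rw [h3] at hr
        rw [hmem] at hs
        rcases hs with hs | hs
        · exact f4 _ _ hr _ _ _ _ hs
        · simp only [Step.act.injEq] at hs
          obtain ⟨rfl, h5, h6, h7⟩ := hs
          obtain ⟨loc, g1, loc', g2⟩ := hsnd h7.symm
          have := f3 _ _ _ _ hr g1 h5 h6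
          subst this
          rw [h3, hr] at g2
          rw [hr] at g1
          cases g1
          cases g2
    case transit =>
      -- Steps that neither send nor receive change neither side of the equivalence; `hrem` below
      -- treats the two kinds of receipt.
      have hsame : C'.transit = C.transit → (∀ k d m, a ≠ .send k d m) → (∀ m, a ≠ .start m) →
          (∀ src k m, a ≠ .recv src k m) → ∀ q : Packet I, q ∈ C'.transit ↔
            (∃ p', Step.act p' q.txn q.src (.send q.idx q.dest q.msg) ∈ E ++ [Step.act p T h a]) ∧
            ∀ s ∈ E ++ [Step.act p T h a], ¬ s.Receives q.txn q.src q.idx := by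
        intro h1 h2 h3 h4 q
        rw [h1, f5]
        simp only [hmem, or_imp, forall_and, forall_eq, receives_act, Step.act.injEq]
        constructor
        · rintro ⟨⟨p', h5⟩, h6⟩
          refine ⟨⟨p', .inl h5⟩, h6, ?_⟩
          rintro ⟨-, ⟨-, m, h7⟩ | ⟨m, h7⟩⟩
          · exact h3 _ h7
          · exact h4 _ _ _ h7
        · rintro ⟨⟨p', h5 | ⟨-, -, -, h5⟩⟩, h6, -⟩
          · exact ⟨⟨p', h5⟩, h6⟩
          · exact absurd h5.symm (h2 _ _ _)
      have hrem : ∀ q0 ∈ C.transit, C'.transit = C.transit \ {q0} → (∀ k d m, a ≠ .send k d m) →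
          (∀ T' src k, (Step.act p T h a).Receives T' src k ↔
            T' = q0.txn ∧ src = q0.src ∧ k = q0.idx) →
          ∀ q : Packet I, q ∈ C'.transit ↔
            (∃ p', Step.act p' q.txn q.src (.send q.idx q.dest q.msg) ∈ E ++ [Step.act p T h a]) ∧
            ∀ s ∈ E ++ [Step.act p T h a], ¬ s.Receives q.txn q.src q.idx := by
        intro q0 h0 h1 h2 h3 q
        rw [h1, Set.mem_sdiff, f5, Set.mem_singleton_iff]
        simp only [hmem, or_imp, forall_and, forall_eq, h3, Step.act.injEq]
        obtain ⟨⟨p0, h00⟩, -⟩ := (f5 _).1 h0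
        constructor
        · rintro ⟨⟨⟨p', h5⟩, h6⟩, h7⟩
          refine ⟨⟨p', .inl h5⟩, h6, ?_⟩
          rintro ⟨h8, h9, h10⟩
          rw [h8, h9, h10] at h5
          -- A packet is determined by its transaction, its source and its index, so the receipt
          -- concerns no packet except `q0`.
          have := hi.send_eq h5 h00 ⟨_, _, _, rfl⟩ ⟨_, _, _, rfl⟩
          simp only [Step.act.injEq, Act.send.injEq] at this
          apply h7
          obtain ⟨_, _, _, _, _⟩ := q
          obtain ⟨_, _, _, _, _⟩ := q0
          dsimp only at h8 h9 h10 this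
          obtain ⟨-, -, -, -, rfl, rfl⟩ := this
          subst h8 h9 h10
          rfl
        · rintro ⟨⟨p', h5 | ⟨-, -, -, h5⟩⟩, h6, h7⟩
          · refine ⟨⟨⟨p', h5⟩, h6⟩, ?_⟩
            rintro rfl
            exact h7 ⟨rfl, rfl, rfl⟩
          · exact absurd h5.symm (h2 _ _ _)
      rcases hv with ⟨c, st, rfl, rfl, rfl, -, -, h7⟩ |
          ⟨i, l, j, src, m, st, rfl, rfl, rfl, h6, -, h7⟩ |
          ⟨k, loc, loc', -, -, -, ⟨x, op, r, rfl⟩, h7⟩ |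
          ⟨k, loc, loc', d, m, h6, -, -, rfl, h7⟩ |
          ⟨k, loc, loc', src, j, d, m, -, -, -, rfl, h6, -, h7⟩ |
          ⟨k, loc, -, -, h7, ⟨c, o, ops, -, rfl⟩ | ⟨i, l, -, rfl⟩⟩
      · exact hsame h7 (by simp) (by simp) (by simp)
      · refine hrem _ h6 h7 (by simp) fun T' src' k' => ?_
        rw [receives_act]
        simp only [List.cons.injEq, Act.start.injEq, reduceCtorEq, exists_false, or_false,
          exists_eq', and_true]
        constructor
        · rintro ⟨rfl, rfl, rfl⟩; exact ⟨rfl, rfl, rfl⟩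
        · rintro ⟨rfl, rfl, rfl⟩; exact ⟨rfl, rfl, rfl⟩
      · exact hsame h7 (by simp) (by simp) (by simp)
      · intro q
        rw [h7, Set.mem_insert_iff, f5]
        simp only [hmem, or_imp, forall_and, forall_eq, receives_act, Step.act.injEq]
        constructor
        · rintro (rfl | ⟨⟨p', h8⟩, h9⟩)
          · refine ⟨⟨p, .inr ⟨rfl, rfl, rfl, rfl⟩⟩, fun s hs hr => ?_, by simp⟩
            obtain ⟨p', d', m', h8⟩ := hsr hs hr
            exact lt_irrefl _ (f4 _ _ h6 _ _ _ _ h8)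
          · exact ⟨⟨p', .inl h8⟩, h9, by simp⟩
        · rintro ⟨⟨p', h8 | ⟨-, h8, h9, h10⟩⟩, h11, -⟩
          · exact .inr ⟨⟨p', h8⟩, h11⟩
          · left
            obtain ⟨_, _, _, _, _⟩ := q
            dsimp only at h8 h9 h10
            simp only [Act.send.injEq] at h10
            obtain ⟨rfl, rfl, rfl⟩ := h10
            subst h8 h9
            rfl
      · refine hrem _ h6 h7 (by simp) fun T' src' k' => ?_
        rw [receives_act]
        simp only [Act.recv.injEq, reduceCtorEq, exists_false, and_false, false_or]
        constructor
        · rintro ⟨rfl, m, rfl, rfl, -⟩; exact ⟨rfl, rfl, rfl⟩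
        · rintro ⟨rfl, rfl, rfl⟩; exact ⟨rfl, m, rfl, rfl, rfl⟩
      · exact hsame h7 (by simp) (by simp) (by simp)
      · exact hsame h7 (by simp) (by simp) (by simp)
    case begun =>
      clear hpw hsr
      have : ∀ c r, C.running (.client c) = some r → r.hid = [] ∧
        Step.act (.client c) r.txn [] .invoke ∈ E := fun c r h => ⟨(f1 c r h).1, (f1 c r h).2.2.1⟩
      intro p' T' h' a' hs
      simp only [hmem] at hs ⊢
      rcases hs with hs | hs
      · rcases f6 _ _ _ _ hs with ⟨c, h1, h2, h3⟩ | ⟨i, l, k, src, m, h1, h2, h3⟩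
        · exact .inl ⟨c, h1, h2, .inl h3⟩
        · exact .inr ⟨i, l, k, src, m, h1, h2, .inl h3⟩
      · cases hs
        have key : ∀ k loc, C.running p = some ⟨T, h, k, loc⟩ →
           (∃ c, p = .client c ∧ h = [] ∧ (Step.act p T [] .invoke ∈ E ∨
              Step.act p T [] .invoke = Step.act p T h a)) ∨
          (∃ i l k src m, p = .node i l ∧ h = k :: src ∧ (Step.act p T h (.start m) ∈ E ∨
            Step.act p T h (.start m) = Step.act p T h a)) := by
          intro k loc hr
          rcases p with c | ⟨i, l⟩
          · exact .inl ⟨c, rfl, (this _ _ hr).1, .inl (this _ _ hr).2⟩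
          · obtain ⟨⟨k', src, g1⟩, -, ⟨m, g3⟩, -⟩ := f2 _ _ _ hr
            exact .inr ⟨i, l, k', src, m, rfl, g1, .inl g3⟩
        rcases hv with ⟨c, st, rfl, rfl, rfl, h6, h7, -⟩ |
          ⟨i, l, j, src, m, st, rfl, rfl, rfl, h6, h7, -⟩ |
          ⟨k, loc, loc', h6, -⟩ | ⟨k, loc, loc', d, m, h6, -⟩ |
          ⟨k, loc, loc', src, j, d, m, h6, -⟩ | ⟨k, loc, h6, -⟩
        · exact .inl ⟨c, rfl, rfl, .inr rfl⟩
        · exact .inr ⟨i, l, j, src, m, rfl, rfl, .inr rfl⟩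
        all_goals exact key _ _ h6
    case invoked =>
      intro p' T' h' a' hs
      rw [hmem] at hs
      rw [hiv]
      rcases hs with hs | hs
      · exact .inl (f7 _ _ _ _ hs)
      · cases hs
        have key : ∀ k loc, C.running p = some ⟨T, h, k, loc⟩ → Invoked E T := by
          intro k loc hr
          rcases p with c | ⟨i, l⟩
          · exact f7 _ _ _ _ (f1 _ _ hr).2.2.1
          · obtain ⟨-, -, ⟨m, g3⟩, -⟩ := f2 _ _ _ hr
            exact f7 _ _ _ _ g3
        rcases hv with ⟨c, st, rfl, rfl, rfl, h6, h7, -⟩ |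
          ⟨i, l, j, src, m, st, rfl, rfl, rfl, h6, h7, -⟩ |
          ⟨k, loc, loc', h6, -⟩ | ⟨k, loc, loc', d, m, h6, -⟩ |
          ⟨k, loc, loc', src, j, d, m, h6, -⟩ | ⟨k, loc, h6, -⟩
        · exact .inr ⟨rfl, rfl⟩
        · obtain ⟨⟨p, h8⟩, -⟩ := (f5 _).1 h6
          exact .inl (f7 _ _ _ _ h8)
        all_goals exact .inl (key _ _ h6)
    case id_inj =>
      have hfr : a = .invoke → ∀ T', Invoked E T' → T'.id ≠ T.id := by
        intro h1 T' h2 h3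
        have : T.id ∉ C.used := by
          clear hpw hsr
          rcases hv with h | h | h | h | h | h <;> grind
        exact this ((hused _).2 ⟨T', h2, h3⟩)
      intro T1 T2 h1 h2 h3
      rw [hiv] at h1 h2
      rcases h1 with h1 | ⟨rfl, h1⟩ <;> rcases h2 with h2 | ⟨rfl, h2⟩
      · exact f8 _ _ h1 h2 h3
      · exact absurd h3 (hfr h2 _ h1)
      · exact absurd h3.symm (hfr h1 _ h2)
      · rfl
    case send_uniq =>
      refine hpw hi.send_uniq fun s hs T' src k h1 h2 => ?_
      rw [sends_act] at h2
      obtain ⟨rfl, rfl, d, m, rfl⟩ := h2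
      obtain ⟨p', d', m', rfl⟩ := h1
      have : ∃ loc, C.running p = some ⟨T, h, k, loc⟩ := by
        clear hpw hsr
        rcases hv with h | h | h | h | h | h <;> grind
      obtain ⟨loc, h3⟩ := this
      exact lt_irrefl _ (f4 _ _ h3 _ _ _ _ hs)
    case recv_uniq =>
      refine hpw hi.recv_uniq fun s hs T' src k h1 h2 => ?_
      rw [receives_act] at h2
      obtain ⟨rfl, h2⟩ := h2
      have : ∃ d m, (⟨T, src, k, d, m⟩ : Packet I) ∈ C.transit := by
        clear hpw hsr
        rcases hv with h | h | h | h | h | h <;> grind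
      obtain ⟨d, m, h3⟩ := this
      exact ((f5 _).1 h3).2 _ hs h1
    case invoke_uniq =>
      refine hpw hi.invoke_uniq fun s hs p1 p2 T' h h' h1 h2 => ?_
      cases h2
      have : T.id ∉ C.used := by
        clear hpw hsr
        rcases hv with h | h | h | h | h | h <;> grind
      exact hnew this _ _ _ (h1 ▸ hs)
    case respond_uniq =>
      refine hpw hi.respond_uniq fun s hs p1 p2 T' h0 h' o o' ops ops' h1 h2 => ?_
      cases h2
      have : ∃ c k loc, p = .client c ∧ C.running p = some ⟨T, h, k, loc⟩ := by
        clear hpw hsr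
        rcases hv with h | h | h | h | h | h <;> grind
      obtain ⟨c, k, loc, rfl, h3⟩ := this
      exact (f1 _ _ h3).2.2.2 ⟨_, _, _, _, h1 ▸ hs⟩
    case start_sent =>
      intro i l T' k src m hs
      simp only [hmem] at hs ⊢
      rcases hs with hs | hs
      · obtain ⟨p, h1⟩ := hi.start_sent _ _ _ _ _ _ hs
        exact ⟨p, .inl h1⟩
      · cases hs
        have : (⟨T, src, k, .toNode (.fresh i), m⟩ : Packet I) ∈ C.transit := by
          clear hpw hsr
          rcases hv with h | h | h | h | h | h <;> grind
        obtain ⟨⟨p, h8⟩, -⟩ := (f5 _).1 this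
        exact ⟨p, .inl h8⟩
    case recv_sent =>
      intro p' T' h' src k m hs
      simp only [hmem] at hs ⊢
      rcases hs with hs | hs
      · obtain ⟨p, d, h1, h2⟩ := hi.recv_sent _ _ _ _ _ _ hs
        exact ⟨p, d, .inl h1, h2⟩
      · cases hs
        have : ∃ d, (⟨T, src, k, d, m⟩ : Packet I) ∈ C.transit ∧
           ((∃ c, p = .client c ∧ d = .toClient) ∨
            ∃ i l k' src', p = .node i l ∧ h = k' :: src' ∧ d = .toNode (.running k' src')) := by
          clear hpw hsr
          rcases hv with h | h | h | h | h | h <;> grind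
        obtain ⟨d, h1, h2⟩ := this
        obtain ⟨⟨p, h8⟩, -⟩ := (f5 _).1 h1
        exact ⟨p, d, .inl h8, h2⟩

theorem Reaches.inv {E : List (Step I)} {C : Config I} (h : Reaches E C) : Inv E C := by
  induction h with
  | nil => constructor <;> simp [initConfig, Invoked]
  | snoc hE ht ih => exact ih.snoc hE ht

end PDTS

namespace PDTS

variable {n : ℕ} {Item : Type u} {Val : Type v} {I : Implementation.{u, v, w} n Item Val}

/-! ### Transfer of steps between executions -/

/-- A step looks only at the state of its own process, at whether its node is up, at the message it
receives, at the freshness of an identifier, and at the value returned by a primitive. The rest of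
the configuration is irrelevant. -/
theorem Trans.transfer {C C' D : Config I} {p : Proc n} {T : Txn Item Val} {h : HId} {a : Act I}
    (ht : Trans C (.act p T h a) C') (hrun : D.running p = C.running p)
    (hlive : ∀ i l, p = .node i l → i ∉ D.crashed) (hused : a = .invoke → T.id ∉ D.used)
    (htr : ∀ q ∈ C.transit, (Step.act p T h a).Receives q.txn q.src q.idx → q ∈ D.transit)
    (hmem : ∀ i l x op r, p = .node i l → a = .prim x op r → (op (D.mem i x)).2 = r) :
    ∃ D', Trans D (.act p T h a) D' := by
  cases ht
  case invoke => exact ⟨_, .invoke _ _ _ (hrun.trans ‹_›) (hused rfl)⟩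
  case coordSend => exact ⟨_, .coordSend _ _ _ _ _ _ _ _ _ (hrun.trans ‹_›) ‹_›⟩
  case coordRecv =>
    exact ⟨_, .coordRecv _ _ _ _ _ _ _ _ _ _ (hrun.trans ‹_›) ‹_›
      (htr _ ‹_› (receives_act.2 ⟨rfl, .inr ⟨_, rfl⟩⟩))⟩
  case respond => exact ⟨_, .respond _ _ _ _ _ _ _ _ (hrun.trans ‹_›) ‹_›⟩
  case start =>
    exact ⟨_, .start _ _ _ _ _ _ _ (hlive _ _ rfl) (hrun.trans ‹_›)
      (htr _ ‹_› (receives_act.2 ⟨rfl, .inl ⟨rfl, _, rfl⟩⟩))⟩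
  case prim i l k s x op f _ next run =>
    have := Trans.prim D _ _ _ _ _ _ _ op f (hlive _ _ rfl) (hrun.trans run) next
    rw [hmem _ _ _ _ _ rfl rfl] at this
    exact ⟨_, this⟩
  case handlerSend =>
    exact ⟨_, .handlerSend _ _ _ _ _ _ _ _ _ _ (hlive _ _ rfl) (hrun.trans ‹_›) ‹_›⟩
  case handlerRecv =>
    exact ⟨_, .handlerRecv _ _ _ _ _ _ _ _ _ _ _ _ (hlive _ _ rfl) (hrun.trans ‹_›) ‹_›
      (htr _ ‹_› (receives_act.2 ⟨rfl, .inr ⟨_, rfl⟩⟩))⟩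
  case finish => exact ⟨_, .finish _ _ _ _ _ _ _ (hlive _ _ rfl) (hrun.trans ‹_›) ‹_›⟩

/-- The step with the value returned by a primitive replaced by the one that the memory contents `mem`
yield. -/
def fixRet (mem : Fin n → I.Obj → I.OVal) : Step I → Step I
  | .act (.node i l) T h (.prim x op _) => .act (.node i l) T h (.prim x op (op (mem i x)).2)
  | s => s

/-- Primitives are never blocked by the contents of memory: different contents only change the
returned value. -/
theorem Trans.transfer_fix {C C' D : Config I} {p : Proc n} {T : Txn Item Val} {h : HId} {a : Act I}
    (ht : Trans C (.act p T h a) C') (hrun : D.running p = C.running p)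
    (hlive : ∀ i l, p = .node i l → i ∉ D.crashed) (hused : a = .invoke → T.id ∉ D.used)
    (htr : ∀ q ∈ C.transit, (Step.act p T h a).Receives q.txn q.src q.idx → q ∈ D.transit) :
    ∃ D', Trans D (fixRet D.mem (.act p T h a)) D' := by
  by_cases h1 : ∃ i l x op r, p = .node i l ∧ a = .prim x op r
  · obtain ⟨i, l, x, op, r, rfl, rfl⟩ := h1
    cases ht
    exact ⟨_, Trans.prim D _ _ _ _ _ _ _ op _ (hlive _ _ rfl) (hrun.trans ‹_›) ‹_›⟩
  · have h2 : fixRet D.mem (.act p T h a) = .act p T h a := by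
      unfold fixRet
      split
      · rename_i h3
        simp only [Step.act.injEq] at h3
        obtain ⟨rfl, rfl, rfl, rfl⟩ := h3
        exact absurd ⟨_, _, _, _, _, rfl, rfl⟩ h1
      · rfl
    rw [h2]
    exact ht.transfer hrun hlive hused htr fun i l x op r h3 h4 =>
      absurd ⟨_, _, _, _, _, h3, h4⟩ h1

/-- Memory contents as a function of the execution. -/
noncomputable def memOf (E : List (Step I)) (i : Fin n) (x : I.Obj) : I.OVal :=
  foldMem I i x (mops i x E)

theorem Reaches.memOf_eq {E : List (Step I)} {C : Config I} (h : Reaches E C) : C.mem = memOf E := by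
  funext i x
  exact h.mem_eq i x

/-- A step that is possible after `E₀` is possible after `E`, up to the value returned by a primitive,
if the process cannot distinguish the two and the message, if any, is in transit. -/
theorem IsExec.transfer_fix {E E₀ : List (Step I)} {p : Proc n} {T : Txn Item Val} {h : HId}
    {a : Act I} (hE : IsExec E) (hE₀ : IsExec (E₀ ++ [.act p T h a])) (hp : proj p E = proj p E₀)
    (hlive : ∀ i l, p = .node i l → ¬ Crashed E i)
    (hused : a = .invoke → ∀ T', Invoked E T' → T'.id ≠ T.id)
    (hsent : ∀ src k, (Step.act p T h a).Receives T src k → ∀ s ∈ E₀, s.Sends T src k → s ∈ E)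
    (hrecv : ∀ src k, (Step.act p T h a).Receives T src k → ∀ s ∈ E, ¬ s.Receives T src k) :
    IsExec (E ++ [fixRet (memOf E) (.act p T h a)]) := by
  obtain ⟨D, hD⟩ := hE
  obtain ⟨C, C', hC, ht⟩ := isExec_snoc_iff.1 hE₀
  rw [isExec_snoc_iff, ← hD.memOf_eq]
  obtain ⟨D', hD'⟩ := ht.transfer_fix (D := D) (by rw [hD.running_eq, hC.running_eq, runOf, hp]; rfl)
    (fun i l h1 h2 => hlive i l h1 ((hD.crashed_iff i).1 h2))
    (fun h1 h2 => by
      obtain ⟨T', h3, h4⟩ := (hD.used_iff _).1 h2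
      exact hused h1 T' h3 h4)
    (fun q hq hr => by
      obtain rfl : T = q.txn := (receives_act.1 hr).1
      obtain ⟨⟨p', h1⟩, h2⟩ := (hC.inv.transit q).1 hq
      exact (hD.inv.transit q).2 ⟨⟨p', hsent _ _ hr _ h1 ⟨_, _, _, rfl⟩⟩, hrecv _ _ hr⟩)
  exact ⟨D, D', hD, hD'⟩

theorem fixRet_eq_self {mem : Fin n → I.Obj → I.OVal} {s : Step I}
    (h : ∀ i l T hid x op r, s = .act (.node i l) T hid (.prim x op r) → (op (mem i x)).2 = r) :
    fixRet mem s = s := by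
  unfold fixRet
  split
  · rw [h _ _ _ _ _ _ _ rfl]
  · rfl

/-- This reads an equation between memory contents and returned value off a step; the comparison of
interleavings with solo runs consists of such equations. -/
theorem IsExec.prim_ret {E : List (Step I)} {i : Fin n} {l : ℕ} {T : Txn Item Val} {h : HId}
    {x : I.Obj} {op : I.OVal → I.OVal × I.Ret} {r : I.Ret}
    (hE : IsExec (E ++ [.act (.node i l) T h (.prim x op r)])) : r = (op (memOf E i x)).2 := by
  obtain ⟨C, C', hC, ht⟩ := isExec_snoc_iff.1 hE
  rw [← hC.memOf_eq]
  cases ht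
  rfl

/-! ### Consequences of uniqueness -/

section

variable {E : List (Step I)}

theorem IsExec.inv (hE : IsExec E) : ∃ C, Reaches E C ∧ Inv E C := by
  obtain ⟨C, h⟩ := hE
  exact ⟨C, h, h.inv⟩

theorem IsExec.begun (hE : IsExec E) {p : Proc n} {T : Txn Item Val} {h : HId} {a : Act I}
    (hs : Step.act p T h a ∈ E) :
    (∃ c, p = .client c ∧ h = [] ∧ Step.act p T [] .invoke ∈ E) ∨
    (∃ i l k src m, p = .node i l ∧ h = k :: src ∧ Step.act p T h (.start m) ∈ E) := by
  obtain ⟨C, -, hi⟩ := hE.inv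
  exact hi.begun _ _ _ _ hs

theorem IsExec.invoked (hE : IsExec E) {p : Proc n} {T : Txn Item Val} {h : HId} {a : Act I}
    (hs : Step.act p T h a ∈ E) : Invoked E T := by
  obtain ⟨C, -, hi⟩ := hE.inv
  exact hi.invoked _ _ _ _ hs

theorem Decided.invoked (hE : IsExec E) {T : Txn Item Val} (h : Decided E T) : Invoked E T := by
  obtain ⟨o, ops, p, hid, h⟩ := h
  exact hE.invoked h

theorem IsExec.id_inj (hE : IsExec E) {T T' : Txn Item Val} (h : Invoked E T) (h' : Invoked E T')
    (he : T.id = T'.id) : T = T' := by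
  obtain ⟨C, -, hi⟩ := hE.inv
  exact hi.id_inj _ _ h h' he

theorem pairwise_index {α : Type*} {R : α → Prop} {l : List α}
    (h : l.Pairwise fun a b => R a → ¬ R b) {i j : ℕ} {a b : α} (hi : l[i]? = some a)
    (hj : l[j]? = some b) (ha : R a) (hb : R b) : i = j := by
  rw [List.pairwise_iff_getElem] at h
  obtain ⟨hi', rfl⟩ := List.getElem?_eq_some_iff.1 hi
  obtain ⟨hj', rfl⟩ := List.getElem?_eq_some_iff.1 hj
  rcases lt_trichotomy i j with h1 | h1 | h1
  · exact absurd hb (h _ _ hi' hj' h1 ha)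
  · exact h1
  · exact absurd ha (h _ _ hj' hi' h1 hb)

theorem IsExec.send_index (hE : IsExec E) {i j : ℕ} {s s' : Step I} (hi : E[i]? = some s)
    (hj : E[j]? = some s') {T : Txn Item Val} {src : HId} {k : ℕ} (h : s.Sends T src k)
    (h' : s'.Sends T src k) : i = j := by
  obtain ⟨C, -, hI⟩ := hE.inv
  exact pairwise_index (hI.send_uniq.imp fun h => h T src k) hi hj h h'

theorem IsExec.recv_index (hE : IsExec E) {i j : ℕ} {s s' : Step I} (hi : E[i]? = some s)
    (hj : E[j]? = some s') {T : Txn Item Val} {src : HId} {k : ℕ} (h : s.Receives T src k)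
    (h' : s'.Receives T src k) : i = j := by
  obtain ⟨C, -, hI⟩ := hE.inv
  exact pairwise_index (hI.recv_uniq.imp fun h => h T src k) hi hj h h'

theorem IsExec.respond_index (hE : IsExec E) {i j : ℕ} {T : Txn Item Val} (hi : IsResponse E T i)
    (hj : IsResponse E T j) : i = j := by
  obtain ⟨C, -, hI⟩ := hE.inv
  obtain ⟨p, h, o, ops, hi⟩ := hi
  obtain ⟨p', h', o', ops', hj⟩ := hj
  refine pairwise_index (R := fun s => ∃ p h o ops, s = Step.act p T h (.respond o ops))
    (hI.respond_uniq.imp ?_) hi hj ⟨_, _, _, _, rfl⟩ ⟨_, _, _, _, rfl⟩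
  rintro s s' h1 ⟨p, h, o, ops, rfl⟩ ⟨p', h', o', ops', rfl⟩
  exact h1 _ _ _ _ _ _ _ _ _ rfl rfl

theorem IsExec.returns_eq (hE : IsExec E) {T : Txn Item Val} {o o' : Outcome}
    {ops ops' : List (Op Item Val)} (h : Returns E T o ops) (h' : Returns E T o' ops') :
    o = o' ∧ ops = ops' := by
  obtain ⟨p, hid, h⟩ := h
  obtain ⟨p', hid', h'⟩ := h'
  obtain ⟨i, hi⟩ := List.mem_iff_getElem?.1 h
  obtain ⟨j, hj⟩ := List.mem_iff_getElem?.1 h'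
  have := hE.respond_index ⟨_, _, _, _, hi⟩ ⟨_, _, _, _, hj⟩
  subst this
  rw [hi] at hj
  simp only [Option.some.injEq, Step.act.injEq, Act.respond.injEq] at hj
  exact hj.2.2.2

theorem Decided.mono {E F : List (Step I)} (h : E <+: F) {T : Txn Item Val} (hd : Decided E T) :
    Decided F T := by
  obtain ⟨o, ops, p, hid, h1⟩ := hd
  exact ⟨o, ops, p, hid, h.subset h1⟩

theorem Invoked.mono {E F : List (Step I)} (h : E <+: F) {T : Txn Item Val} (hd : Invoked E T) :
    Invoked F T := by
  obtain ⟨p, hid, h1⟩ := hd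
  exact ⟨p, hid, h.subset h1⟩

theorem crashed_false (hf : FailureFree E) (i : Fin n) : ¬ Crashed E i := by
  intro h
  have := List.countP_eq_zero.1 hf _ h
  simp [Step.isCrash] at this

theorem failureFree_iff : FailureFree E ↔ ∀ s ∈ E, s.isCrash = false := by
  simp [FailureFree, numCrashes, List.countP_eq_zero]

theorem FailureFree.of_prefix {E F : List (Step I)} (h : FailureFree F) (hp : E <+: F) :
    FailureFree E := by
  rw [failureFree_iff] at *
  exact fun s hs => h s (hp.subset hs)

end

/-! ### The end of the interval of a transaction -/

/-- After the end of its interval a transaction takes no steps. -/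
theorem no_step_after_over {P Q : List (Step I)} (hQ : IsExec (P ++ Q))
    (hf : FailureFree (P ++ Q)) {T : Txn Item Val} (hov : IntervalOver P T) :
    ∀ s ∈ Q, s.txn ≠ some T := by
  induction Q using List.reverseRecOn with
  | nil => simp
  | append_singleton Q s ih =>
    rw [← List.append_assoc] at hQ hf
    have ih := ih hQ.of_append (hf.of_prefix ⟨[s], rfl⟩)
    intro s' hs'
    rw [List.mem_append, List.mem_singleton] at hs'
    rcases hs' with hs' | rfl
    · exact ih _ hs'
    intro hT
    obtain ⟨C, C', hC, ht⟩ := isExec_snoc_iff.1 hQ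
    have hmemP : ∀ p h a, Step.act p T h a ∈ P ++ Q → Step.act p T h a ∈ P := by
      intro p h a h1
      rcases List.mem_append.1 h1 with h1 | h1
      · exact h1
      · exact absurd rfl (ih _ h1)
    have hinc : ∀ s, s ∈ P → s ∈ P ++ Q := fun s h => List.mem_append_left _ h
    obtain ⟨hd, hm, hh⟩ := hov
    have hncr : ∀ i, ¬ Crashed P i := crashed_false (hf.of_prefix ⟨Q ++ [s'], by simp⟩)
    have hi := hC.inv
    -- A running coordinator is undecided, and every handler of `T` that was started before the end
    -- of the interval has finished there; hence no process runs `T`.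
    have hrunc : ∀ c k loc h, C.running (.client c) ≠ some ⟨T, h, k, loc⟩ := by
      intro c k loc h h1
      exact (hi.client _ _ h1).2.2.2 (hd.mono ⟨Q, rfl⟩)
    have hrunn : ∀ i l k loc h, C.running (.node i l) ≠ some ⟨T, h, k, loc⟩ := by
      intro i l k loc h h1
      obtain ⟨-, -, ⟨m, h2⟩, h3⟩ := hi.node _ _ _ h1
      exact h3 _ (hinc _ (hh _ _ _ _ (hmemP _ _ _ h2) (hncr i)))
    cases ht <;> simp only [Step.txn, Option.some.injEq, reduceCtorEq] at hT <;> subst hT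
    case invoke =>
      have h1 := (hd.mono ⟨Q, rfl⟩).invoked hQ.of_append
      exact absurd ((hC.used_iff _).2 ⟨_, h1, rfl⟩) ‹_›
    case start =>
      -- A late start would need a message in transit, but all messages to nodes had been received
      -- when the interval ended.
      obtain ⟨⟨p, h1⟩, h2⟩ := (hi.transit _).1 ‹_›
      obtain ⟨q, m', h3⟩ := hm _ _ _ _ _ (hmemP _ _ _ h1) (hncr _)
      exact h2 _ (hinc _ h3) (.inl ⟨_, _, rfl⟩)
    all_goals first | exact hrunc _ _ _ _ (by assumption) | exact hrunn _ _ _ _ _ (by assumption)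

end PDTS

namespace PDTS

variable {n : ℕ} {Item : Type u} {Val : Type v} {I : Implementation.{u, v, w} n Item Val}

/-! ### One process per handler -/

/-- The number of the node process that runs handler `h` of `T` in clean executions. -/
def procCode (T : Txn Item Val) (h : HId) : ℕ := Encodable.encode (T.id, h)

theorem procCode_inj {T T' : Txn Item Val} {h h' : HId} (he : procCode T h = procCode T' h') :
    T.id = T'.id ∧ h = h' := by
  have := Encodable.encode_injective he
  simpa using this

/-- The step with every handler of a node moved to a process of its own. -/
def canonStep : Step I → Step I
  | .act (.node i _) T h a => .act (.node i (procCode T h)) T h a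
  | s => s

/-- The execution without crashes and with every handler of a node moved to a process of its own. -/
def clean (E : List (Step I)) : List (Step I) := (E.filter fun s => !s.isCrash).map canonStep

/-- Every handler on a node is run by the process with the number given by `procCode`. -/
def Canon (E : List (Step I)) : Prop :=
  ∀ i l T h a, Step.act (.node i l) T h a ∈ E → l = procCode T h

theorem mem_clean {E : List (Step I)} {s : Step I} :
    s ∈ clean E ↔ ∃ s' ∈ E, s'.isCrash = false ∧ canonStep s' = s := by
  simp [clean, and_assoc]

theorem mem_clean_node {E : List (Step I)} {i : Fin n} {l : ℕ} {T : Txn Item Val} {h : HId}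
    {a : Act I} : Step.act (.node i l) T h a ∈ clean E ↔
      l = procCode T h ∧ ∃ l', Step.act (.node i l') T h a ∈ E := by
  rw [mem_clean]
  constructor
  · rintro ⟨s, h1, h2, h3⟩
    rcases s with i | ⟨c' | ⟨i, l⟩, T', h', a'⟩
    · cases h3
    · cases h3
    · cases h3; exact ⟨rfl, _, h1⟩
  · rintro ⟨rfl, l', h1⟩
    exact ⟨_, h1, rfl, rfl⟩

theorem canon_clean (E : List (Step I)) : Canon (clean E) := by
  intro i l T h a hs
  exact (mem_clean_node.1 hs).1

theorem failureFree_clean (E : List (Step I)) : FailureFree (clean E) := by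
  rw [failureFree_iff]
  intro s hs
  obtain ⟨s', h1, h2, rfl⟩ := mem_clean.1 hs
  rcases s' with i | ⟨c' | ⟨i, l⟩, T', h', a'⟩ <;> simp_all [canonStep, Step.isCrash]

theorem clean_snoc (E : List (Step I)) (s : Step I) :
    clean (E ++ [s]) = if s.isCrash then clean E else clean E ++ [canonStep s] := by
  cases h : s.isCrash <;> simp [clean, h]

theorem IsExec.trans_of_mem {E : List (Step I)} (hE : IsExec E) {s : Step I} (hs : s ∈ E) :
    ∃ A C C', A ++ [s] <+: E ∧ Reaches A C ∧ Trans C s C' := by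
  obtain ⟨A, B, rfl⟩ := List.append_of_mem hs
  have h1 : A ++ [s] <+: A ++ s :: B := ⟨B, by simp⟩
  obtain ⟨C, C', hC, ht⟩ := isExec_snoc_iff.1 (hE.of_prefix h1)
  exact ⟨A, C, C', h1, hC, ht⟩

/-- Invocations and responses happen on clients, and cleaning touches only crashes and node
processes. -/
theorem clean_coordEvents {E : List (Step I)} (hE : IsExec E) :
    (clean E).filter Step.isCoordEvent = E.filter Step.isCoordEvent := by
  have key : ∀ s ∈ E, s.isCoordEvent = true → s.isCrash = false ∧ canonStep s = s := by
    intro s hs h1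
    obtain ⟨A, C, C', -, -, ht⟩ := hE.trans_of_mem hs
    cases ht <;> simp_all [Step.isCoordEvent, Step.isCrash, canonStep]
  have key2 : ∀ s : Step I, (canonStep s).isCoordEvent = s.isCoordEvent := by
    intro s
    rcases s with i | ⟨c | ⟨i, l⟩, T, h, a⟩
    · rfl
    · rfl
    · cases a <;> rfl
  clear hE
  induction E with
  | nil => rfl
  | cons s E ih =>
    have ih := ih fun s hs => key s (List.mem_cons_of_mem _ hs)
    unfold clean at ih ⊢
    by_cases h1 : s.isCoordEvent = true
    · obtain ⟨h2, h3⟩ := key s List.mem_cons_self h1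
      simp [h2, h3, h1, ih]
    · by_cases h2 : s.isCrash = true
      · simp [h2, h1, ih]
      · simp [h2, h1, ih, key2]

/-- A handler is named after the message that triggers it, so before the receipt no process runs a
handler of that name. Thus the process reserved for it is idle. -/
theorem Inv.not_running_of_transit {E : List (Step I)} {C : Config I} (hi : Inv E C)
    {q : Packet I} (hq : q ∈ C.transit) {p : Proc n} {r : Running I} (hr : C.running p = some r)
    (h1 : r.txn.id = q.txn.id) (h2 : r.hid = q.idx :: q.src) : False := by
  obtain ⟨⟨p', h3⟩, h4⟩ := (hi.transit q).1 hq
  rcases p with c | ⟨i, l⟩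
  · rw [(hi.client _ _ hr).1] at h2; cases h2
  · obtain ⟨-, -, ⟨m, h5⟩, -⟩ := hi.node _ _ _ hr
    have := hi.id_inj _ _ (hi.invoked _ _ _ _ h5) (hi.invoked _ _ _ _ h3) h1
    rw [this, h2] at h5
    exact h4 _ h5 (.inl ⟨_, _, rfl⟩)

theorem upd_node (ro : Option (Running I)) (i : Fin n) (l l' : ℕ) (T : Txn Item Val) (h : HId)
    (a : Act I) : upd ro (.act (.node i l) T h a) = upd ro (.act (.node i l') T h a) := by
  cases a <;> rfl

theorem upd_keeps {ro : Option (Running I)} {p : Proc n} {T : Txn Item Val} {h h' : HId} {a : Act I}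
    {k : ℕ} {loc : I.CState ⊕ I.HState} (hro : ro = some ⟨T, h, k, loc⟩) (h1 : a ≠ .invoke)
    (h2 : ∀ m, a ≠ .start m) {r : Running I} (hr : upd ro (.act p T h' a) = some r) :
    r.txn = T ∧ r.hid = h := by
  subst hro
  rcases p with c | ⟨i, l⟩ <;> cases a <;> simp_all [upd] <;> subst hr <;> exact ⟨rfl, rfl⟩

-- The original and the cleaned configuration differ only in crashed nodes and in the placement of
-- the node handlers, which correspond one to one. Without crashes more steps are possible, and with
-- one process per handler no two handlers ever compete for a process.
set_option maxHeartbeats 1000000 in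
theorem Reaches.clean {E : List (Step I)} {C : Config I} (hE : Reaches E C) :
    ∃ D, Reaches (clean E) D ∧ D.mem = C.mem ∧ D.crashed = ∅ ∧ D.used = C.used ∧
      D.transit = C.transit ∧ (∀ c, D.running (.client c) = C.running (.client c)) ∧
      (∀ i l r, C.running (.node i l) = some r →
        D.running (.node i (procCode r.txn r.hid)) = some r) ∧
      ∀ i l r, D.running (.node i l) = some r → l = procCode r.txn r.hid ∧
        ∃ l', C.running (.node i l') = some r := by
  induction hE with
  | nil => exact ⟨_, .nil, rfl, rfl, rfl, rfl, fun _ => rfl, by simp [initConfig], by simp [initConfig]⟩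
  | @snoc E C C' s hE ht ih =>
    obtain ⟨D, hD, h1, h2, h3, h4, h5, h6, h7⟩ := ih
    have hi := hE.inv
    by_cases hs : ∃ i, s = .crash i
    · obtain ⟨i, rfl⟩ := hs
      rw [clean_snoc]
      cases ht
      exact ⟨D, hD, h1, h2, h3, h4, h5, h6, h7⟩
    have hcr : s.isCrash = false := by
      rcases s with i | _
      · exact absurd ⟨i, rfl⟩ hs
      · rfl
    rw [clean_snoc, hcr]
    -- Once the step itself is transferred, the correspondence of the running handlers follows from
    -- `Trans.running_eq`.
    suffices hD' : ∃ D', Trans D (canonStep s) D' ∧ D'.mem = C'.mem ∧ D'.crashed = ∅ ∧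
        D'.used = C'.used ∧ D'.transit = C'.transit by
      obtain ⟨D', t1, t2, t3, t4, t5⟩ := hD'
      refine ⟨D', hD.snoc t1, t2, t3, t4, t5, ?_⟩
      rcases s with i | ⟨c | ⟨i, l⟩, T, h, a⟩
      · exact absurd ⟨i, rfl⟩ hs
      · have g1 := ht.running_eq
        have g2 := t1.running_eq
        refine ⟨fun c' => ?_, fun i l r hr => ?_, fun i l r hr => ?_⟩
        · by_cases hc : c = c'
          · subst hc
            rw [(g1 _).1 rfl, (g2 _).1 rfl, h5]; rfl
          · rw [(g1 _).2 (by simpa [Step.proc] using hc),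
              (g2 _).2 (by simpa [Step.proc, canonStep] using hc), h5]
        · rw [(g1 _).2 (by simp [Step.proc])] at hr
          rw [(g2 _).2 (by simp [Step.proc, canonStep])]
          exact h6 _ _ _ hr
        · rw [(g2 _).2 (by simp [Step.proc, canonStep])] at hr
          obtain ⟨g3, l', g4⟩ := h7 _ _ _ hr
          refine ⟨g3, l', ?_⟩
          rw [(g1 _).2 (by simp [Step.proc])]
          exact g4
      · have g1 := ht.running_eq
        have g2 := t1.running_eq
        have hcase : ∀ r, (C'.running (.node i l) = some r ∨
            D'.running (.node i (procCode T h)) = some r) → r.txn = T ∧ r.hid = h := by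
          rw [(g1 _).1 rfl, (g2 _).1 rfl]
          dsimp only [canonStep]
          intro r hr
          have h8 : ∀ k loc, C.running (.node i l) = some ⟨T, h, k, loc⟩ →
              D.running (.node i (procCode T h)) = some ⟨T, h, k, loc⟩ := fun k loc h => h6 _ _ _ h
          cases ht
          case start => rcases hr with hr | hr <;> cases hr <;> exact ⟨rfl, rfl⟩
          all_goals
            rcases hr with hr | hr
            · exact upd_keeps ‹_› (by simp) (by simp) hr
            · exact upd_keeps (h8 _ _ ‹_›) (by simp) (by simp) hr
        have hsame : D'.running (.node i (procCode T h)) = C'.running (.node i l) := by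
          rw [(g1 _).1 rfl, (g2 _).1 rfl]
          have h8 : ∀ k loc, C.running (.node i l) = some ⟨T, h, k, loc⟩ →
              D.running (.node i (procCode T h)) = C.running (.node i l) :=
            fun k loc h => (h6 _ _ _ h).trans h.symm
          cases ht
          case start => rfl
          all_goals
            rw [h8 _ _ ‹_›]
            exact upd_node _ _ _ _ _ _ _
        -- Only the process taking the step can be running a handler of this name, so moving that
        -- handler disturbs no other one.
        have hother : ∀ i' l' r, C.running (.node i' l') = some r → r.txn.id = T.id → r.hid = h →
            i' = i ∧ l' = l ∧ C.running (.node i l) = some r := by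
          intro i' l' r hr e1 e2
          have h8 : ∀ k loc, C.running (.node i l) = some ⟨T, h, k, loc⟩ →
              i' = i ∧ l' = l ∧ C.running (.node i l) = some r := by
            intro k loc h9
            obtain ⟨-, -, ⟨m, h10⟩, -⟩ := hi.node _ _ _ h9
            obtain ⟨-, -, ⟨m', h11⟩, -⟩ := hi.node _ _ _ hr
            have e3 := hi.id_inj _ _ (hi.invoked _ _ _ _ h11) (hi.invoked _ _ _ _ h10) e1
            have := hi.inj _ _ _ _ hr h9 e3 e2
            cases this
            exact ⟨rfl, rfl, hr⟩
          cases ht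
          case start => exact (hi.not_running_of_transit ‹_› hr e1 e2).elim
          all_goals exact h8 _ _ ‹_›
        refine ⟨fun c => ?_, fun i' l' r hr => ?_, fun i' l' r hr => ?_⟩
        · rw [(g1 _).2 (by simp [Step.proc]), (g2 _).2 (by simp [Step.proc, canonStep]), h5]
        · by_cases he : (Proc.node i' l' : Proc n) = .node i l
          · cases he
            obtain ⟨e1, e2⟩ := hcase r (.inl hr)
            rw [e1, e2, hsame, hr]
          · rw [(g1 _).2 (by simpa [Step.proc] using fun e1 e2 => he (by rw [e1, e2]))] at hr
            rw [(g2 _).2, h6 _ _ _ hr]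
            intro h8
            simp only [canonStep, Step.proc, Option.some.injEq, Proc.node.injEq] at h8
            obtain ⟨e1, e2⟩ := procCode_inj h8.2
            obtain ⟨e3, e4, -⟩ := hother _ _ _ hr e1.symm e2.symm
            exact he (by rw [e3, e4])
        · by_cases he : (Proc.node i' l' : Proc n) = .node i (procCode T h)
          · cases he
            obtain ⟨e1, e2⟩ := hcase r (.inr hr)
            exact ⟨by rw [e1, e2], l, by rw [← hsame, hr]⟩
          · rw [(g2 _).2 (by simpa [Step.proc, canonStep] using
              fun e1 e2 => he (by rw [e1, e2]))] at hr
            obtain ⟨g3, l'', g4⟩ := h7 _ _ _ hr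
            refine ⟨g3, l'', ?_⟩
            rw [(g1 _).2, g4]
            intro h8
            simp only [Step.proc, Option.some.injEq, Proc.node.injEq] at h8
            obtain ⟨rfl, rfl⟩ := h8
            have h9 : ∀ k loc, C.running (.node i l) = some ⟨T, h, k, loc⟩ → False := by
              intro k loc h9
              rw [g4] at h9
              cases h9
              exact he (by rw [g3])
            cases ht
            case start idle _ => rw [g4] at idle; cases idle
            all_goals exact h9 _ _ ‹_›
    cases ht
    case crash => exact absurd ⟨_, rfl⟩ hs
    case invoke idle new =>
      exact ⟨_, .invoke _ _ _ ((h5 _).trans idle) (h3 ▸ new), h1, h2,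
        congrArg (insert _) h3, h4⟩
    case coordSend run next =>
      exact ⟨_, .coordSend _ _ _ _ _ _ _ _ _ ((h5 _).trans run) next, h1, h2, h3,
        congrArg (insert _) h4⟩
    case coordRecv run next sent =>
      exact ⟨_, .coordRecv _ _ _ _ _ _ _ _ _ _ ((h5 _).trans run) next (h4 ▸ sent), h1, h2, h3,
        congrArg (· \ _) h4⟩
    case respond run next =>
      exact ⟨_, .respond _ _ _ _ _ _ _ _ ((h5 _).trans run) next, h1, h2, h3, h4⟩
    case start i l T src j m live idle sent =>
      refine ⟨_, .start _ _ _ _ _ _ _ (by rw [h2]; simp) ?_ (h4 ▸ sent), h1, h2, h3,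
        congrArg (· \ _) h4⟩
      -- If the reserved process were busy, it would be running the very handler whose triggering
      -- message is still in transit.
      cases hr : D.running (.node i (procCode T (j :: src))) with
      | none => rfl
      | some r =>
        obtain ⟨e1, l', e2⟩ := h7 _ _ _ hr
        obtain ⟨e3, e4⟩ := procCode_inj e1
        exact (hi.not_running_of_transit sent e2 e3.symm e4.symm).elim
    case prim i l T h k s x op f live run next =>
      have := Trans.prim D i _ T h k s x op f (by rw [h2]; simp) (h6 _ _ _ run) next
      rw [h1] at this
      refine ⟨_, this, ?_, h2, h3, h4⟩
      simp [Config.setRunning, Config.setObj, h1]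
    case handlerSend run next =>
      exact ⟨_, .handlerSend _ _ _ _ _ _ _ _ _ _ (by rw [h2]; simp) (h6 _ _ _ run) next, h1, h2,
        h3, congrArg (insert _) h4⟩
    case handlerRecv run next sent =>
      exact ⟨_, .handlerRecv _ _ _ _ _ _ _ _ _ _ _ _ (by rw [h2]; simp) (h6 _ _ _ run) next
        (h4 ▸ sent), h1, h2, h3, congrArg (· \ _) h4⟩
    case finish run next =>
      exact ⟨_, .finish _ _ _ _ _ _ _ (by rw [h2]; simp) (h6 _ _ _ run) next, h1, h2, h3, h4⟩

theorem IsExec.clean {E : List (Step I)} (hE : IsExec E) : IsExec (clean E) := by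
  obtain ⟨C, hC⟩ := hE
  obtain ⟨D, hD, -⟩ := hC.clean
  exact ⟨D, hD⟩

end PDTS

namespace PDTS

variable {n : ℕ} {Item : Type u} {Val : Type v} {I : Implementation.{u, v, w} n Item Val}

/-! ### Fair extensions -/

theorem Step.Receives.recv_facts {E : List (Step I)} {s : Step I} {T : Txn Item Val} {src : HId}
    {k : ℕ} (hr : s.Receives T src k) (hE : IsExec (E ++ [s])) :
    (∀ s' ∈ E, ¬ s'.Receives T src k) ∧ Invoked E T ∧
      (∀ i l, s.proc = some (.node i l) → ¬ Crashed E i) := by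
  obtain ⟨C, C', hC, ht⟩ := isExec_snoc_iff.1 hE
  have hi := hC.inv
  have key : ∀ d m, (⟨T, src, k, d, m⟩ : Packet I) ∈ C.transit →
      (∀ s' ∈ E, ¬ s'.Receives T src k) ∧ Invoked E T := by
    intro d m h
    obtain ⟨⟨p, h1⟩, h2⟩ := (hi.transit _).1 h
    exact ⟨h2, hi.invoked _ _ _ _ h1⟩
  have hlive : ∀ i, i ∉ C.crashed → ¬ Crashed E i := fun i h1 h2 => h1 ((hC.crashed_iff i).2 h2)
  rcases hr with ⟨p, m, rfl⟩ | ⟨p, h, m, rfl⟩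
  · cases ht
    refine ⟨(key _ _ ‹_›).1, (key _ _ ‹_›).2, ?_⟩
    rintro i l ⟨⟩
    exact hlive _ ‹_›
  · cases ht
    · refine ⟨(key _ _ ‹_›).1, (key _ _ ‹_›).2, ?_⟩
      rintro i l ⟨⟩
    · refine ⟨(key _ _ ‹_›).1, (key _ _ ‹_›).2, ?_⟩
      rintro i l ⟨⟩
      exact hlive _ ‹_›

/-- A message that can be received can still be received after a local step. -/
theorem receivable_persists {E : List (Step I)} {s l : Step I} {T : Txn Item Val} {src : HId}
    {k : ℕ} (hs : IsExec (E ++ [s])) (hr : s.Receives T src k) (hl : IsExec (E ++ [l]))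
    (hloc : l.IsLocal) : IsExec (E ++ [l] ++ [s]) := by
  obtain ⟨p, h, a, rfl⟩ := hr.exists_act
  have hinv : a ≠ .invoke := by
    rintro rfl; rw [receives_act] at hr; simp at hr
  obtain ⟨h1, h2, h3⟩ := hr.recv_facts hs
  -- A process able to receive is idle or waiting for a message, and then it has no local step to
  -- take.
  have hpl : l.proc ≠ some p := by
    intro hp
    obtain ⟨C, C', hC, ht⟩ := isExec_snoc_iff.1 hs
    obtain ⟨D, D', hD, ht'⟩ := isExec_snoc_iff.1 hl
    have hrun : C.running p = D.running p := by rw [hC.running_eq, hD.running_eq]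
    rw [receives_act] at hr
    obtain ⟨-, ⟨-, m, rfl⟩ | ⟨m, rfl⟩⟩ := hr
    · cases ht
      cases ht' <;> simp_all [Step.IsLocal, Step.proc]
    · cases ht <;> cases ht' <;> simp_all [Step.IsLocal, Step.proc]
  have hll : ∀ T src k, ¬ l.Receives T src k := by
    intro T src k hlr
    rcases hlr with ⟨p, m, rfl⟩ | ⟨p, h, m, rfl⟩ <;> exact hloc
  have hlc : l.isCrash = false := by
    cases l
    · exact hloc.elim
    · rfl
  have := hl.transfer_fix (E₀ := E) hs (by rw [proj_append]; simp [proj, hpl])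
    (fun i l' hp hc => by
      rcases List.mem_append.1 hc with hc | hc
      · exact h3 i l' (by rw [hp]; rfl) hc
      · rw [List.mem_singleton] at hc
        subst hc
        simp [Step.isCrash] at hlc)
    (fun h => absurd h hinv) (fun src' k' _ s' hs' _ => List.mem_append_left _ hs')
    (fun src' k' hr' s' hs' hs'r => by
      rcases List.mem_append.1 hs' with hs' | hs'
      · exact (hr'.recv_facts hs).1 _ hs' hs'r
      · rw [List.mem_singleton] at hs'
        subst hs'
        exact hll _ _ _ hs'r)
  rwa [fixRet_eq_self] at this
  intro i l' T' hid x op r he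
  cases he
  rw [receives_act] at hr
  simp at hr

/-- A finite execution involves only finitely many of the processes of a node. -/
theorem exists_idle (E : List (Step I)) (i : Fin n) : ∃ l, proj (.node i l) E = [] := by
  classical
  let f : Step I → ℕ := fun s => match s with
    | .act (.node _ l) _ _ _ => l
    | _ => 0
  obtain ⟨l, hl⟩ := Infinite.exists_notMem_finset (E.map f).toFinset
  refine ⟨l, ?_⟩
  rw [proj, List.filter_eq_nil_iff]
  intro s hs hp
  apply hl
  rw [List.mem_toFinset, List.mem_map]
  refine ⟨s, hs, ?_⟩
  rcases s with j | ⟨c | ⟨j, l'⟩, T, h, a⟩ <;> simp_all [Step.proc, f]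

/-- A message to a node can be received by a new handler as long as it has not been received. -/
theorem start_enabled {E : List (Step I)} (hE : IsExec E) {p : Proc n} {T : Txn Item Val}
    {src : HId} {k : ℕ} {i : Fin n} {m : I.Msg}
    (hs : Step.act p T src (.send k (.toNode (.fresh i)) m) ∈ E)
    (hr : ∀ s ∈ E, ¬ s.Receives T src k) (hc : ¬ Crashed E i) :
    ∃ s, IsExec (E ++ [s]) ∧ s.Receives T src k := by
  obtain ⟨C, hC⟩ := hE
  obtain ⟨l, hl⟩ := exists_idle E i
  refine ⟨.act (.node i l) T (k :: src) (.start m), isExec_snoc_iff.2 ⟨C, _, hC,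
    .start C i l T src k m (fun h => hc ((hC.crashed_iff i).1 h)) ?_ ?_⟩, .inl ⟨_, _, rfl⟩⟩
  · rw [hC.running_eq, runOf, hl]; rfl
  · exact (hC.inv.transit _).2 ⟨⟨p, hs⟩, hr⟩

theorem exists_proc_surjection (n : ℕ) : ∃ f : ℕ → Proc n, f.Surjective := by
  have : Countable (Proc n) := by
    let g : Proc n → ℕ ⊕ (Fin n × ℕ) := fun p => match p with
      | .client c => .inl c
      | .node i l => .inr (i, l)
    refine Function.Injective.countable (f := g) ?_
    rintro (c | ⟨i, l⟩) (c' | ⟨i', l'⟩) h <;> simp_all [g]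
  have : Nonempty (Proc n) := ⟨.client 0⟩
  exact exists_surjective_nat _

/-- The number of a message. -/
def msgCode (T : Txn Item Val) (src : HId) (k : ℕ) : ℕ := Encodable.encode (T.id, src, k)

/-- A message with number `c` is received in step `s`, which is possible after `E`. -/
def CanReceive (E : List (Step I)) (c : ℕ) (s : Step I) : Prop :=
  IsExec (E ++ [s]) ∧ ∃ T src k, s.Receives T src k ∧ msgCode T src k = c

open Classical in
/-- One step of a fair scheduler: in even rounds the processes take turns, in odd rounds the
message with the least number is received. -/
noncomputable def schedule (f : ℕ → Proc n) (E : List (Step I)) (t : ℕ) : List (Step I) :=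
  if t % 2 = 0 then
    if h : ∃ s, IsExec (E ++ [s]) ∧ s.proc = some (f (t / 2).unpair.1) ∧ s.IsLocal then
      E ++ [h.choose]
    else E
  else
    if h : ∃ c s, CanReceive E c s then E ++ [(Nat.find_spec h).choose] else E

/-- The execution `E` continued by a fair scheduler. -/
noncomputable def continued (f : ℕ → Proc n) (E : List (Step I)) : ℕ → List (Step I)
  | 0 => E
  | t + 1 => schedule f (continued f E t) t

theorem schedule_cases (f : ℕ → Proc n) (E : List (Step I)) (t : ℕ) :
    schedule f E t = E ∨ ∃ s, schedule f E t = E ++ [s] ∧ IsExec (E ++ [s]) ∧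
      (s.IsLocal ∨ ∃ T src k, s.Receives T src k) := by
  unfold schedule
  split_ifs with h1 h2 h2
  · exact .inr ⟨_, rfl, h2.choose_spec.1, .inl h2.choose_spec.2.2⟩
  · exact .inl rfl
  · classical
    obtain ⟨g1, T, src, k, g2, -⟩ := (Nat.find_spec h2).choose_spec
    exact .inr ⟨_, rfl, g1, .inr ⟨_, _, _, g2⟩⟩
  · exact .inl rfl

theorem continued_isExec (f : ℕ → Proc n) {E : List (Step I)} (hE : IsExec E) (t : ℕ) :
    IsExec (continued f E t) := by
  induction t with
  | zero => exact hE
  | succ t ih =>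
    rcases schedule_cases f _ t with h | ⟨s, h, h1, -⟩
    · rw [continued, h]; exact ih
    · rw [continued, h]; exact h1

theorem continued_succ (f : ℕ → Proc n) (E : List (Step I)) (t : ℕ) :
    continued f E (t + 1) = continued f E t ∨
      ∃ s, continued f E (t + 1) = continued f E t ++ [s] ∧
        (s.IsLocal ∨ ∃ T src k, s.Receives T src k) := by
  rcases schedule_cases f _ t with h | ⟨s, h, -, h1⟩
  · exact .inl h
  · exact .inr ⟨s, h, h1⟩

theorem continued_mono (f : ℕ → Proc n) (E : List (Step I)) {t t' : ℕ}
    (h : t ≤ t') : continued f E t <+: continued f E t' := by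
  induction t', h using Nat.le_induction with
  | base => exact List.prefix_refl _
  | succ t' _ ih =>
    rcases continued_succ f E t' with h | ⟨s, h, -⟩
    · rwa [h]
    · rw [h]; exact ih.trans (List.prefix_append _ _)

open Classical in
/-- The numbers up to `c` of the messages received in `E`. -/
noncomputable def receivedCodes (c : ℕ) (E : List (Step I)) : Finset ℕ :=
  (Finset.range (c + 1)).filter fun c' =>
    ∃ s ∈ E, ∃ T src k, s.Receives T src k ∧ msgCode T src k = c'

/-- Whenever the message with number `c` is receivable in an odd round, that round receives a
message with a number at most `c`. No number is received twice, so this happens at most `c + 1`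
times. -/
theorem continued_eventually (f : ℕ → Proc n) {E : List (Step I)} (hE : IsExec E)
    (T : Txn Item Val) (src : HId) (k : ℕ) :
    ∃ t, ∀ t', t ≤ t' → ¬ ∃ s, IsExec (continued f E t' ++ [s]) ∧ s.Receives T src k := by
  classical
  by_contra! hcon
  set c := msgCode T src k with hc
  set g := fun t => (receivedCodes c (continued f E t)).card with hg
  -- A message receivable in an even round is still so in the following odd round, since the even
  -- round takes at most one local step.
  have hodd : ∀ t, ∃ t' ≥ t, t' % 2 = 1 ∧
      ∃ s, IsExec (continued f E t' ++ [s]) ∧ s.Receives T src k := by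
    intro t
    obtain ⟨t', h1, s, h2, h3⟩ := hcon t
    by_cases h4 : t' % 2 = 0
    · refine ⟨t' + 1, by omega, by omega, s, ?_, h3⟩
      have h5 : continued f E (t' + 1) = schedule f (continued f E t') t' := rfl
      rw [h5]
      unfold schedule
      rw [if_pos h4]
      split_ifs with h6
      · exact receivable_persists h2 h3 h6.choose_spec.1 h6.choose_spec.2.2
      · exact h2
    · exact ⟨t', h1, by omega, s, h2, h3⟩
  have hmono : ∀ t t', t ≤ t' →
      receivedCodes c (continued f E t) ⊆ receivedCodes c (continued f E t') := by
    intro t t' h x hx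
    simp only [receivedCodes, Finset.mem_filter] at hx ⊢
    obtain ⟨h1, s, h2, h3⟩ := hx
    exact ⟨h1, s, (continued_mono f E h).subset h2, h3⟩
  have hstep : ∀ t, ∃ t', g t < g t' := by
    intro t
    obtain ⟨t1, h1, h2, s, h3, h4⟩ := hodd t
    have hex : ∃ c s, CanReceive (continued f E t1) c s := ⟨c, s, h3, T, src, k, h4, rfl⟩
    have h5 : continued f E (t1 + 1) = continued f E t1 ++ [(Nat.find_spec hex).choose] := by
      have : continued f E (t1 + 1) = schedule f (continued f E t1) t1 := rfl
      rw [this]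
      unfold schedule
      rw [if_neg (by omega), dif_pos hex]
    obtain ⟨g1, T', src', k', g2, g3⟩ := (Nat.find_spec hex).choose_spec
    have hle : Nat.find hex ≤ c := Nat.find_min' hex ⟨s, h3, T, src, k, h4, rfl⟩
    refine ⟨t1 + 1, lt_of_le_of_lt (Finset.card_le_card (hmono t t1 h1)) ?_⟩
    refine Finset.card_lt_card ((Finset.ssubset_iff_of_subset (hmono _ _ (Nat.le_succ _))).2
      ⟨Nat.find hex, ?_, ?_⟩)
    · rw [receivedCodes, Finset.mem_filter]
      exact ⟨Finset.mem_range.2 (by omega), _, by rw [h5]; simp, T', src', k', g2, g3⟩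
    -- The number just received is new: within one execution identifiers determine transactions, so
    -- an equal number means the same message, which cannot be received again.
    · intro hmem
      rw [receivedCodes, Finset.mem_filter] at hmem
      obtain ⟨-, s', h6, T'', src'', k'', h7, h8⟩ := hmem
      obtain ⟨f1, f2, -⟩ := g2.recv_facts g1
      have hEx := continued_isExec f hE t1
      have h9 := Encodable.encode_injective (g3.trans h8.symm)
      simp only [Prod.mk.injEq] at h9
      obtain ⟨h9, rfl, rfl⟩ := h9
      obtain ⟨p', h', a', rfl⟩ := h7.exists_act
      obtain rfl := hEx.id_inj f2 (hEx.invoked h6) h9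
      exact f1 _ h6 h7
  have hunb : ∀ m, ∃ t, m ≤ g t := by
    intro m
    induction m with
    | zero => exact ⟨0, Nat.zero_le _⟩
    | succ m ih =>
      obtain ⟨t, ht⟩ := ih
      obtain ⟨t', ht'⟩ := hstep t
      exact ⟨t', by omega⟩
  obtain ⟨t, ht⟩ := hunb (c + 2)
  have : g t ≤ (Finset.range (c + 1)).card := Finset.card_le_card (Finset.filter_subset _ _)
  rw [Finset.card_range] at this
  omega

theorem IsRun.mono {ρ : ℕ → List (Step I)} (h : IsRun ρ) {t t' : ℕ} (htt : t ≤ t') :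
    ρ t <+: ρ t' := by
  induction t', htt using Nat.le_induction with
  | base => exact List.prefix_refl _
  | succ t' _ ih =>
    rcases (h.2 t').2 with h | ⟨s, h⟩
    · rwa [h]
    · rw [h]; exact ih.trans (List.prefix_append _ _)

/-- Every execution extends to a fair one in which no further transactions are invoked and no
further nodes crash. -/
theorem exists_fair_run {E : List (Step I)} (hE : IsExec E) :
    ∃ ρ : ℕ → List (Step I), IsRun ρ ∧ Fair ρ ∧ ρ E.length = E ∧
      ∀ t, ∀ s ∈ ρ t, s ∈ E ∨ (s.isCrash = false ∧ ∀ p T h, s ≠ .act p T h .invoke) := by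
  obtain ⟨f, hf⟩ := exists_proc_surjection n
  -- A run has to grow from the empty execution, so `E` is replayed step by step before the
  -- scheduler takes over.
  let ρ : ℕ → List (Step I) := fun t =>
    if t < E.length then E.take t else continued f E (t - E.length)
  have h1 : ∀ t, ρ (E.length + t) = continued f E t := by
    intro t
    simp [ρ]
  refine ⟨ρ, ⟨?_, fun t => ?_⟩, ⟨fun p t => ?_, fun T src k => ?_⟩, ?_, fun t s hs => ?_⟩
  · by_cases h : 0 < E.length
    · simp [ρ, h]
    · have h : E.length = 0 := by omega
      have h2 := List.length_eq_zero_iff.1 h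
      simp [ρ, h2, continued]
  · by_cases h : t < E.length
    · have h2 : ρ t = E.take t := if_pos h
      have h3 : ρ (t + 1) = E.take (t + 1) := by
        by_cases h4 : t + 1 < E.length
        · exact if_pos h4
        · have h5 : E.length = t + 1 := by omega
          have := h1 0
          rw [add_zero, h5] at this
          rw [this, ← h5, List.take_length, continued]
      refine ⟨by rw [h2]; exact hE.of_prefix (List.take_prefix _ _), .inr ⟨E[t], ?_⟩⟩
      rw [h2, h3, List.take_append_getElem h]
    · obtain ⟨d, rfl⟩ := Nat.exists_eq_add_of_le (Nat.le_of_not_lt h)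
      rw [add_assoc, h1, h1]
      refine ⟨continued_isExec f hE d, ?_⟩
      rcases continued_succ f _ d with h | ⟨s, h, -⟩
      · exact .inl h
      · exact .inr ⟨s, h⟩
  · obtain ⟨a, rfl⟩ := hf p
    have hle := Nat.right_le_pair a t
    -- In the even round `2 * Nat.pair a t` of the scheduler it is the turn of process `f a`, and `t
    -- ≤ Nat.pair a t` makes this round late enough.
    refine ⟨E.length + 2 * Nat.pair a t, by omega, ?_⟩
    rw [add_assoc, h1, h1]
    have h5 : continued f E (2 * Nat.pair a t + 1) =
      schedule f (continued f E (2 * Nat.pair a t)) (2 * Nat.pair a t) := rfl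
    rw [h5]
    unfold schedule
    rw [if_pos (by omega), Nat.mul_div_cancel_left _ (by norm_num), Nat.unpair_pair]
    split_ifs with h6
    · exact .inl ⟨_, rfl, h6.choose_spec.2.1⟩
    · exact .inr h6
  · obtain ⟨t, ht⟩ := continued_eventually f hE T src k
    refine ⟨E.length + t, fun t' ht' => ?_⟩
    obtain ⟨d, rfl⟩ := Nat.exists_eq_add_of_le (show E.length ≤ t' by omega)
    rw [h1]
    exact ht d (by omega)
  · have := h1 0
    rwa [add_zero, continued] at this
  · by_cases h : t < E.length
    · have h2 : ρ t = E.take t := if_pos h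
      rw [h2] at hs
      exact .inl (List.mem_of_mem_take hs)
    · obtain ⟨d, rfl⟩ := Nat.exists_eq_add_of_le (Nat.le_of_not_lt h)
      rw [h1] at hs
      clear h
      induction d with
      | zero => exact .inl hs
      | succ d ih =>
        rcases continued_succ f _ d with h | ⟨s', h, h2⟩
        · rw [h] at hs; exact ih hs
        · rw [h, List.mem_append, List.mem_singleton] at hs
          rcases hs with hs | rfl
          · exact ih hs
          · right
            rcases h2 with h2 | ⟨T, src, k, ⟨p, m, rfl⟩ | ⟨p, h, m, rfl⟩⟩
            · rcases s with i | ⟨p, T, h, a⟩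
              · exact h2.elim
              · refine ⟨rfl, ?_⟩
                rintro p' T' h' ⟨⟩
                exact h2
            · simp [Step.isCrash]
            · simp [Step.isCrash]

end PDTS

namespace PDTS

variable {n : ℕ} {Item : Type u} {Val : Type v} {I : Implementation.{u, v, w} n Item Val}

/-! ### Consequences of progress -/

/-- After the response no client runs `T`, and its identifier is used, so `T` cannot be invoked
again. -/
theorem no_client_step_after_decided {P Q : List (Step I)} (hQ : IsExec (P ++ Q))
    {T : Txn Item Val} (hd : Decided P T) {c : ℕ} {h : HId} {a : Act I} :
    Step.act (.client c) T h a ∉ Q := by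
  intro hs
  obtain ⟨A, B, rfl⟩ := List.append_of_mem hs
  have hQ' : IsExec (P ++ A ++ [Step.act (.client c) T h a]) :=
    hQ.of_prefix ⟨B, by simp⟩
  obtain ⟨C, C', hC, ht⟩ := isExec_snoc_iff.1 hQ'
  have hd' : Decided (P ++ A) T := hd.mono ⟨A, rfl⟩
  have hrun : ∀ h k loc, C.running (.client c) ≠ some ⟨T, h, k, loc⟩ := fun h k loc h1 =>
    (hC.inv.client _ _ h1).2.2.2 hd'
  cases ht
  case invoke =>
    exact absurd ((hC.used_iff _).2 ⟨_, hd'.invoked hQ'.of_append, rfl⟩) ‹_›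
  all_goals exact hrun _ _ _ ‹_›

/-- This is where client-driven replication enters: a message to a node cannot come from a node. -/
theorem send_fresh_client (hcd : I.ClientDriven) {E : List (Step I)} (hE : IsExec E) {p : Proc n}
    {T : Txn Item Val} {h : HId} {k : ℕ} {d : NodeDest n} {m : I.Msg}
    (hs : Step.act p T h (.send k (.toNode d) m) ∈ E) : ∃ c, p = .client c ∧ h = [] := by
  rcases hE.begun hs with ⟨c, rfl, rfl, -⟩ | ⟨i, l, k', src, m', rfl, rfl, -⟩
  · exact ⟨c, rfl, rfl⟩
  · have := hcd E hE _ _ _ _ _ _ _ hs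
    cases this

theorem eventually_all {α : Type*} {l : List α} {P : α → ℕ → Prop}
    (hm : ∀ s t t', t ≤ t' → P s t → P s t') (h : ∀ s ∈ l, ∃ t, P s t) : ∃ t, ∀ s ∈ l, P s t := by
  induction l with
  | nil => exact ⟨0, by simp⟩
  | cons a l ih =>
    obtain ⟨t1, h1⟩ := ih fun s hs => h s (List.mem_cons_of_mem _ hs)
    obtain ⟨t2, h2⟩ := h a List.mem_cons_self
    refine ⟨max t1 t2, fun s hs => ?_⟩
    rcases List.mem_cons.1 hs with rfl | hs
    · exact hm _ _ _ (le_max_right _ _) h2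
    · exact hm _ _ _ (le_max_left _ _) (h1 s hs)

/-- A message meant for a new handler cannot be picked up by a running one, because the destination
is part of the packet and each message is sent once. -/
theorem start_of_receives_fresh {E : List (Step I)} (hE : IsExec E) {p : Proc n}
    {T : Txn Item Val} {h : HId} {k : ℕ} {i : Fin n} {m : I.Msg}
    (hs : Step.act p T h (.send k (.toNode (.fresh i)) m) ∈ E) {s : Step I} (hs' : s ∈ E)
    (hr : s.Receives T h k) : ∃ q m', s = Step.act q T (k :: h) (.start m') := by
  rcases hr with ⟨q, m', rfl⟩ | ⟨q, h', m', rfl⟩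
  · exact ⟨q, m', rfl⟩
  · obtain ⟨C, hC, hi⟩ := hE.inv
    obtain ⟨p', d, h1, h2⟩ := hi.recv_sent _ _ _ _ _ _ hs'
    have := hi.send_eq hs h1 ⟨_, _, _, rfl⟩ ⟨_, _, _, rfl⟩
    simp only [Step.act.injEq, Act.send.injEq] at this
    obtain ⟨-, -, -, -, rfl, -⟩ := this
    simp at h2

/-- In fair failure-free executions the intervals of decided transactions end. -/
theorem exists_intervalOver (hcd : I.ClientDriven) {f : ℕ} (hhr : I.HandlersReturn f)
    {ρ : ℕ → List (Step I)} (hρ : IsRun ρ) (hfair : Fair ρ) (hff : ∀ t, FailureFree (ρ t))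
    {T : Txn Item Val} {t₀ : ℕ} (hd : Decided (ρ t₀) T) : ∃ t, t₀ ≤ t ∧ IntervalOver (ρ t) T := by
  have hex := fun t => (hρ.2 t).1
  have hcr : ∀ t i, ¬ Crashed (ρ t) i := fun t i => crashed_false (hff t) i
  -- Only the coordinator sends to nodes, and it is silent after its response. Hence the messages
  -- that have to be received before the interval ends are all sent by time `t₀`, and there are
  -- finitely many.
  have hsend : ∀ t p h k i m, Step.act p T h (.send k (.toNode (.fresh i)) m) ∈ ρ t →
      Step.act p T h (.send k (.toNode (.fresh i)) m) ∈ ρ t₀ := by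
    intro t p h k i m hs
    obtain ⟨c, rfl, rfl⟩ := send_fresh_client hcd (hex t) hs
    rcases le_total t t₀ with h | h
    · exact (hρ.mono h).subset hs
    · obtain ⟨Q, hQ⟩ := hρ.mono h
      rw [← hQ] at hs
      rcases List.mem_append.1 hs with hs | hs
      · exact hs
      · exact absurd hs (no_client_step_after_decided (hQ ▸ hex t) hd)
  obtain ⟨t₁, h₁⟩ := eventually_all (l := ρ t₀) (P := fun s t => ∀ p h k i m,
      s = Step.act p T h (.send k (.toNode (.fresh i)) m) →
        ∃ q m', Step.act q T (k :: h) (.start m') ∈ ρ t)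
    (fun s t t' htt h1 p h k i m hs => by
      obtain ⟨q, m', h2⟩ := h1 p h k i m hs
      exact ⟨q, m', (hρ.mono htt).subset h2⟩)
    (fun s hs => by
      by_cases hs' : ∃ p h k i m, s = Step.act p T h (.send k (.toNode (.fresh i)) m)
      · obtain ⟨p, h, k, i, m, rfl⟩ := hs'
        obtain ⟨t, ht⟩ := hfair.2 T h k
        have hst : Step.act p T h (.send k (.toNode (.fresh i)) m) ∈ ρ (max t t₀) :=
          (hρ.mono (le_max_right _ _)).subset hs
        have : ∃ s ∈ ρ (max t t₀), s.Receives T h k := by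
          by_contra! hcon
          exact ht _ (le_max_left _ _) (start_enabled (hex _) hst hcon (hcr _ _))
        obtain ⟨s, h1, h2⟩ := this
        obtain ⟨q, m', rfl⟩ := start_of_receives_fresh (hex _) hst h1 h2
        refine ⟨max t t₀, fun p' h' k' i' m'' he => ?_⟩
        cases he
        exact ⟨q, m', h1⟩
      · exact ⟨0, fun p h k i m he => absurd ⟨p, h, k, i, m, he⟩ hs'⟩)
  -- By time `t₁` all handlers of `T` have started; `t₂` is a time by which they have all finished.
  obtain ⟨t₂, h₂⟩ := eventually_all (l := ρ t₁) (P := fun s t => ∀ i l h m,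
      s = Step.act (.node i l) T h (.start m) → Step.act (.node i l) T h .finish ∈ ρ t)
    (fun s t t' htt h1 i l h m hs => (hρ.mono htt).subset (h1 i l h m hs))
    (fun s hs => by
      by_cases hs' : ∃ i l h m, s = Step.act (.node i l) T h (.start m)
      · obtain ⟨i, l, h, m, rfl⟩ := hs'
        obtain ⟨t, ht⟩ := hhr ρ hρ hfair (fun t => by rw [hff t]; exact Nat.zero_le _) _ _ _ _ _ _ hs
        refine ⟨t, fun i' l' h' m' he => ?_⟩
        cases he
        exact ht.resolve_right (hcr _ _)
      · exact ⟨0, fun i l h m he => absurd ⟨i, l, h, m, he⟩ hs'⟩)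
  set t := max t₀ (max t₁ t₂)
  have ht0 : t₀ ≤ t := le_max_left _ _
  have ht1 : t₁ ≤ t := (le_max_left _ _).trans (le_max_right _ _)
  have ht2 : t₂ ≤ t := (le_max_right _ _).trans (le_max_right _ _)
  refine ⟨t, ht0, hd.mono (hρ.mono ht0), fun p h k i m hs _ => ?_, fun i l h m hs _ => ?_⟩
  · obtain ⟨q, m', h3⟩ := h₁ _ (hsend _ _ _ _ _ _ hs) _ _ _ _ _ rfl
    exact ⟨q, m', (hρ.mono ht1).subset h3⟩
  · rcases (hex t).begun hs with ⟨c, h3, -⟩ | ⟨i', l', k, src, m', -, rfl, -⟩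
    · cases h3
    obtain ⟨C, hC, hi⟩ := (hex t).inv
    obtain ⟨p, h3⟩ := hi.start_sent _ _ _ _ _ _ hs
    obtain ⟨q, m', h4⟩ := h₁ _ (hsend _ _ _ _ _ _ h3) _ _ _ _ _ rfl
    have := hi.recv_eq hs ((hρ.mono ht1).subset h4) (.inl ⟨_, _, rfl⟩) (.inl ⟨_, _, rfl⟩)
    rw [← this] at h4
    exact (hρ.mono ht2).subset (h₂ _ h4 _ _ _ _ rfl)

/-- A failure-free execution extends to one in which a given transaction is decided. -/
theorem exists_decided {f : ℕ} (hwp : I.WeakProgress f) {E : List (Step I)} (hE : IsExec E)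
    (hff : FailureFree E) {T : Txn Item Val} (hT : Invoked E T) :
    ∃ E', E <+: E' ∧ IsExec E' ∧ FailureFree E' ∧ Decided E' T := by
  obtain ⟨ρ, h1, h2, h3, h4⟩ := exists_fair_run hE
  have hffρ : ∀ t, FailureFree (ρ t) := by
    intro t
    rw [failureFree_iff] at hff ⊢
    intro s hs
    rcases h4 t s hs with h | h
    · exact hff s h
    · exact h.1
  obtain ⟨⟨t, ht⟩, -⟩ := hwp ρ h1 h2 (fun t => by rw [hffρ t]; exact Nat.zero_le _) T E.length
    (by rwa [h3])
  refine ⟨ρ (max E.length t), ?_, (h1.2 _).1, hffρ _, ht.mono (h1.mono (le_max_right _ _))⟩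
  conv_lhs => rw [← h3]
  exact h1.mono (le_max_left _ _)

/-- A new transaction invoked when all others are over commits, and its interval ends. -/
theorem exists_committed (hcd : I.ClientDriven) {f : ℕ} (hhr : I.HandlersReturn f)
    (hwp : I.WeakProgress f) {E : List (Step I)} (hE : IsExec E) (hff : FailureFree E)
    {T : Txn Item Val} (hnew : ∀ T', Invoked E T' → T'.id ≠ T.id) {c : ℕ}
    (hidle : proj (.client c) E = []) (hover : ∀ T', Invoked E T' → IntervalOver E T') :
    ∃ E', E ++ [.act (.client c) T [] .invoke] <+: E' ∧ IsExec E' ∧ FailureFree E' ∧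
      IntervalOver E' T ∧ Committed E' T ∧ ∀ T', Invoked E' T' → T' = T ∨ Invoked E T' := by
  set E₁ := E ++ [Step.act (.client c) T [] .invoke] with hE₁
  have hE₁ex : IsExec E₁ := by
    obtain ⟨C, hC⟩ := hE
    refine isExec_snoc_iff.2 ⟨C, _, hC, .invoke C c T ?_ fun h => ?_⟩
    · rw [hC.running_eq, runOf, hidle]; rfl
    · obtain ⟨T', h1, h2⟩ := (hC.used_iff _).1 h
      exact hnew T' h1 h2
  have hE₁ff : FailureFree E₁ := by
    rw [failureFree_iff] at hff ⊢
    intro s hs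
    rcases List.mem_append.1 hs with hs | hs
    · exact hff s hs
    · rw [List.mem_singleton] at hs; subst hs; rfl
  have hE₁inv : ∀ T', Invoked E₁ T' → T' = T ∨ Invoked E T' := by
    intro T' h
    rw [hE₁, invoked_snoc] at h
    rcases h with h | ⟨p, hid, h⟩
    · exact .inr h
    · cases h; exact .inl rfl
  obtain ⟨ρ, h1, h2, h3, h4⟩ := exists_fair_run hE₁ex
  have hffρ : ∀ t, FailureFree (ρ t) := by
    intro t
    rw [failureFree_iff] at hE₁ff ⊢
    intro s hs
    rcases h4 t s hs with h | h
    · exact hE₁ff s h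
    · exact h.1
  have hinvρ : ∀ t T', Invoked (ρ t) T' → T' = T ∨ Invoked E T' := by
    rintro t T' ⟨p, h, hs⟩
    rcases h4 t _ hs with h | ⟨-, h⟩
    · exact hE₁inv _ ⟨_, _, h⟩
    · exact absurd rfl (h _ _ _)
  have hcmp : ∀ t, E <+: ρ t ∨ ρ t <+: E := by
    intro t
    have hp : E <+: ρ (max E₁.length t) :=
      (List.prefix_append _ _).trans (h3 ▸ h1.mono (le_max_left _ _))
    exact List.prefix_or_prefix_of_prefix hp (h1.mono (le_max_right _ _))
  have hTinv : Invoked E₁ T := ⟨_, _, List.mem_append_right _ (List.mem_singleton.2 rfl)⟩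
  have hTnot : ¬ Invoked E T := fun h => hnew T h rfl
  have hcr : ∀ t, numCrashes (ρ t) ≤ f := fun t => by rw [hffρ t]; exact Nat.zero_le _
  obtain ⟨-, hcom⟩ := hwp ρ h1 h2 hcr T E₁.length (by rwa [h3])
  -- `T` is not concurrent with any other transaction: those are over at the end of `E`, where `T`
  -- has not been invoked yet.
  obtain ⟨t, ops, ht⟩ := hcom fun T' t' hcon => by
    obtain ⟨g1, g2, g3, g4, g5⟩ := hcon
    rcases hinvρ _ _ g3 with h | h
    · exact g1 h.symm
    · rcases hcmp t' with h5 | h5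
      · exact g5 ⟨E, h5, hover _ h, hTnot⟩
      · exact hTnot (g2.mono h5)
  obtain ⟨t', htt, ht'⟩ := exists_intervalOver hcd hhr h1 h2 hffρ
    (t₀ := max E₁.length t) (T := T)
    (Decided.mono (h1.mono (le_max_right _ _)) ⟨_, _, ht⟩)
  refine ⟨ρ t', ?_, (h1.2 _).1, hffρ _, ht', ⟨ops, ?_⟩, hinvρ t'⟩
  · have := h1.mono ((le_max_left _ _).trans htt)
    rwa [h3] at this
  · obtain ⟨p, h, hs⟩ := ht
    exact ⟨p, h, (h1.mono ((le_max_right _ _).trans htt)).subset hs⟩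

end PDTS

namespace PDTS

variable {n : ℕ} {Item : Type u} {Val : Type v} {I : Implementation.{u, v, w} n Item Val}

/-! ### Read-then-write transactions -/

open Classical in
/-- The transaction that reads `y` and, if it finds the initial value, writes `x`. -/
noncomputable def condTxn (init alt : Item → Val) (k : ℕ) (y x : Item) : Txn Item Val :=
  ⟨k, .read y fun a => if a = init y then .write x (alt x) .done else .done⟩

variable {init alt : Item → Val}

/-- The operations of `condTxn` when it finds the initial value. -/
def condOps (init alt : Item → Val) (y x : Item) : List (Op Item Val) :=
  [.read y (init y), .write x (alt x)]

theorem fullRun_done {ops : List (Op Item Val)} (h : Prog.done.FullRun ops) : ops = [] := by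
  cases ops with
  | nil => rfl
  | cons a l => simp [Prog.FullRun] at h

theorem fullRun_write {x : Item} {a : Val} {k : Prog Item Val} {ops : List (Op Item Val)}
    (h : (Prog.write x a k).FullRun ops) : ∃ l, ops = .write x a :: l ∧ k.FullRun l := by
  cases ops with
  | nil => simp [Prog.FullRun] at h
  | cons o l =>
    cases o with
    | read y b => simp [Prog.FullRun] at h
    | write y b =>
      simp only [Prog.FullRun] at h
      obtain ⟨rfl, rfl, h⟩ := h
      exact ⟨l, rfl, h⟩

theorem fullRun_read {x : Item} {k : Val → Prog Item Val} {ops : List (Op Item Val)}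
    (h : (Prog.read x k).FullRun ops) : ∃ a l, ops = .read x a :: l ∧ (k a).FullRun l := by
  cases ops with
  | nil => simp [Prog.FullRun] at h
  | cons o l =>
    cases o with
    | read y b =>
      simp only [Prog.FullRun] at h
      obtain ⟨rfl, h⟩ := h
      exact ⟨b, l, rfl, h⟩
    | write y b => simp [Prog.FullRun] at h

theorem condTxn_fullRun {k : ℕ} {y x : Item} {ops : List (Op Item Val)}
    (h : (condTxn init alt k y x).prog.FullRun ops) :
    ops = condOps init alt y x ∨ ∃ a, a ≠ init y ∧ ops = [.read y a] := by
  obtain ⟨a, l, rfl, hl⟩ := fullRun_read h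
  clear h
  split_ifs at hl with ha
  · obtain ⟨l', rfl, hl'⟩ := fullRun_write hl
    rw [fullRun_done hl', ha]
    exact .inl rfl
  · rw [fullRun_done hl]
    exact .inr ⟨a, ha, rfl⟩

/-- Partial runs are needed because a transaction disturbed by others might abort; its data set has
to be bounded whatever it returns. -/
theorem condTxn_dataSet {k : ℕ} {y x : Item} {ops : List (Op Item Val)}
    (h : (condTxn init alt k y x).prog.PartialRun ops) : dataSet ops ⊆ {y, x} := by
  have hd : ∀ l : List (Op Item Val), Prog.done.PartialRun l → l = [] := by
    intro l h
    cases l <;> simp_all [Prog.PartialRun]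
  have hw : ∀ l : List (Op Item Val), (Prog.write x (alt x) .done).PartialRun l →
      ∀ o ∈ l, o = .write x (alt x) := by
    intro l h
    rcases l with _ | ⟨o | o, l⟩
    · simp
    · simp [Prog.PartialRun] at h
    · simp only [Prog.PartialRun] at h
      obtain ⟨rfl, rfl, h⟩ := h
      rw [hd _ h]
      simp
  have key : ∀ o ∈ ops, (∃ a, o = .read y a) ∨ ∃ a, o = .write x a := by
    rcases ops with _ | ⟨⟨z, a⟩ | o, l⟩
    · simp
    · simp only [condTxn, Prog.PartialRun] at h
      obtain ⟨rfl, h⟩ := h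
      intro o ho
      rcases List.mem_cons.1 ho with rfl | ho
      · exact .inl ⟨_, rfl⟩
      · split_ifs at h
        · exact .inr ⟨_, hw _ h _ ho⟩
        · rw [hd _ h] at ho; cases ho
    · simp [condTxn, Prog.PartialRun] at h
  rintro z (⟨a, ha⟩ | ⟨a, ha⟩)
  · rcases key _ ha with ⟨b, hb⟩ | ⟨b, hb⟩ <;> cases hb; exact .inl rfl
  · rcases key _ ha with ⟨b, hb⟩ | ⟨b, hb⟩ <;> cases hb; exact .inr rfl

/-! ### Legal sequences of operations -/

/-- The contents of `x` stay equal to `a`, since every write to `x` in the list writes `a` again. -/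
theorem Legal.read_eq {db : Item → Val} {l : List (Op Item Val)} (h : Legal db l) {x : Item} {a : Val}
    (hdb : db x = a) (hw : ∀ b, Op.write x b ∈ l → b = a) {b : Val} (hr : Op.read x b ∈ l) :
    b = a := by
  classical
  induction l generalizing db with
  | nil => cases hr
  | cons o l ih =>
    have hw' : ∀ b, Op.write x b ∈ l → b = a := fun b hb => hw b (List.mem_cons_of_mem _ hb)
    cases o with
    | read y c =>
      simp only [Legal] at h
      rcases List.mem_cons.1 hr with hr | hr
      · cases hr; rw [← h.1, hdb]
      · exact ih h.2 hdb hw' hr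
    | write y c =>
      simp only [Legal] at h
      rcases List.mem_cons.1 hr with hr | hr
      · cases hr
      · refine ih h ?_ hw' hr
        by_cases hxy : x = y
        · subst hxy
          rw [Function.update_self]
          exact hw _ List.mem_cons_self
        · rw [Function.update_of_ne hxy]; exact hdb

/-- After a transaction that overwrote `x` no transaction can read the initial value of `x`. -/
theorem not_legal_of_stale_read (hne : ∀ x, alt x ≠ init x) {y x : Item}
    {T : Txn Item Val} {rest : List (Txn Item Val × List (Op Item Val))}
    (h : Legal init (((T, condOps init alt y x) :: rest).flatMap Prod.snd))
    (hw : ∀ q ∈ rest, ∀ b, Op.write x b ∈ q.2 → b = alt x) {q : Txn Item Val × List (Op Item Val)}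
    (hq : q ∈ rest) (hr : Op.read x (init x) ∈ q.2) : False := by
  classical
  rw [List.flatMap_cons] at h
  simp only [condOps, List.cons_append, List.nil_append, Legal] at h
  refine hne x (h.2.read_eq (by rw [Function.update_self]) (fun b hb => ?_)
    (List.mem_flatMap.2 ⟨q, hq, hr⟩)).symm
  obtain ⟨q', h1, h2⟩ := List.mem_flatMap.1 hb
  exact hw q' h1 b h2

theorem write_mem_condOps {y x z : Item} {b : Val} (h : Op.write z b ∈ condOps init alt y x) :
    z = x ∧ b = alt x := by
  simp only [condOps, List.mem_cons, reduceCtorEq, Op.write.injEq, List.not_mem_nil, or_false,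
    false_or] at h
  exact h

/-- The only committed transaction of an execution reads initial values. -/
theorem condTxn_solo_ops (hrp : I.RespectsPrograms) (hser : I.Serializable init) {E : List (Step I)}
    (hE : IsExec E) {k : ℕ} {y x : Item} {ops : List (Op Item Val)}
    (hr : Returns E (condTxn init alt k y x) .commit ops)
    (hsolo : ∀ T', Invoked E T' → T' = condTxn init alt k y x) : ops = condOps init alt y x := by
  rcases condTxn_fullRun ((hrp E _ _ _ hE hr).2 rfl) with h | ⟨a, ha, rfl⟩
  · exact h
  obtain ⟨L, -, hL, hleg⟩ := hser E hE
  rcases L with _ | ⟨⟨T', ops'⟩, L⟩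
  · have := (hL _ _).2 hr
    cases this
  · have h1 := (hL T' ops').1 List.mem_cons_self
    obtain rfl := hsolo _ (Decided.invoked hE ⟨_, _, h1⟩)
    obtain ⟨-, rfl⟩ := hE.returns_eq h1 hr
    rw [List.flatMap_cons] at hleg
    simp only [List.cons_append, Legal] at hleg
    exact absurd hleg.1.symm ha

/-- Two committed transactions, one of which reads what the other writes and vice versa, cannot both
read initial values. -/
theorem condTxn_pair_ops (hne : ∀ x, alt x ≠ init x) (hrp : I.RespectsPrograms)
    (hser : I.Serializable init) {E : List (Step I)}
    (hE : IsExec E) {k k' : ℕ} {y x : Item} (hxy : x ≠ y) {ops : List (Op Item Val)}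
    (hU : Returns E (condTxn init alt k' x y) .commit (condOps init alt x y))
    (hr : Returns E (condTxn init alt k y x) .commit ops) (hk : k ≠ k')
    (hsolo : ∀ T', Invoked E T' → T' = condTxn init alt k y x ∨ T' = condTxn init alt k' x y) :
    ∃ a, ops = [.read y a] := by
  rcases condTxn_fullRun ((hrp E _ _ _ hE hr).2 rfl) with rfl | ⟨a, ha, rfl⟩
  · exfalso
    have hTU : condTxn init alt k y x ≠ condTxn init alt k' x y := fun h => hk (congrArg Txn.id h)
    obtain ⟨L, -, hL, hleg⟩ := hser E hE
    have hall : ∀ q ∈ L, q = (condTxn init alt k y x, condOps init alt y x) ∨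
        q = (condTxn init alt k' x y, condOps init alt x y) := by
      rintro ⟨T', ops'⟩ hq
      have h1 := (hL T' ops').1 hq
      rcases hsolo _ (Decided.invoked hE ⟨_, _, h1⟩) with rfl | rfl
      · obtain ⟨-, rfl⟩ := hE.returns_eq h1 hr; exact .inl rfl
      · obtain ⟨-, rfl⟩ := hE.returns_eq h1 hU; exact .inr rfl
    have hTL := (hL _ _).2 hr
    have hUL := (hL _ _).2 hU
    have hw : ∀ q ∈ L, ∀ z b, Op.write z b ∈ q.2 → b = alt z := by
      intro q hq z b hb
      rcases hall q hq with rfl | rfl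
      · obtain ⟨rfl, rfl⟩ := write_mem_condOps hb; rfl
      · obtain ⟨rfl, rfl⟩ := write_mem_condOps hb; rfl
    -- Whichever of the two comes first in the serial order overwrites the item that the other one
    -- claims to read with its initial value.
    rcases L with _ | ⟨q, L⟩
    · cases hTL
    · rcases hall q List.mem_cons_self with rfl | rfl
      · have hUL' : (condTxn init alt k' x y, condOps init alt x y) ∈ L := by
          rcases List.mem_cons.1 hUL with h | h
          · exact absurd (congrArg Prod.fst h).symm hTU
          · exact h
        exact not_legal_of_stale_read hne hleg
          (fun q hq b hb => hw q (List.mem_cons_of_mem _ hq) _ b hb) hUL' (by simp [condOps])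
      · have hTL' : (condTxn init alt k y x, condOps init alt y x) ∈ L := by
          rcases List.mem_cons.1 hTL with h | h
          · exact absurd (congrArg Prod.fst h) hTU
          · exact h
        exact not_legal_of_stale_read hne hleg
          (fun q hq b hb => hw q (List.mem_cons_of_mem _ hq) _ b hb) hTL' (by simp [condOps])
  · exact ⟨a, rfl⟩

/-! ### The depth of transactions that read one item -/

/-- All steps may be placed at time `0`, so no delay ever exceeds `Δ`: synchrony restricts nothing
in a model without clocks. -/
theorem synchronous_of_pos {Δ : ℝ} (hΔ : 0 < Δ) (E : List (Step I)) : Synchronous Δ E :=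
  ⟨fun _ => 0, fun _ _ _ => le_rfl, fun i j s T src k _ _ _ _ h => by
    simp only [zero_add] at h
    exact absurd h (not_lt.2 hΔ.le)⟩

/-- With a larger depth, fast decision could be used twice, at partial depths zero and two, and
would make two items known. But an item with a known value is one that `T` reads, and there is only
`y`. -/
theorem txnDepth_le_four {Δ : ℝ} (hΔ : 0 < Δ) (hfd : I.FastDeciding Δ) {E : List (Step I)}
    (hE : IsExec E) (hff : FailureFree E) {T : Txn Item Val} {o : Outcome}
    {ops : List (Op Item Val)} (hr : Returns E T o ops) (hsolo : ∀ T', Invoked E T' → T' = T)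
    {y : Item} (hy : ∀ x a, Op.read x a ∈ ops → x = y) : txnDepth E T ≤ 4 := by
  by_contra! hlt
  have hd : Decided E T := ⟨_, _, hr⟩
  have hconc : ∀ T', ¬ Concurrent E T T' := fun T' h => h.1 (hsolo T' h.2.2.1).symm
  have h0 : partialDepth E T [] = 0 := by simp [partialDepth]
  obtain ⟨P₁, h1, h2, h3, h4⟩ := hfd E hE hff (synchronous_of_pos hΔ E) T hd hconc []
    (List.nil_prefix) (by simp [Decided, Returns]) (by rw [h0]; omega)
  rw [h0, zero_add] at h3
  obtain ⟨P₂, h5, h6, h7, h8⟩ := hfd E hE hff (synchronous_of_pos hΔ E) T hd hconc P₁ h1 h2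
    (by rw [h3]; omega)
  have hle : numKnown T P₂ ≤ 1 := by
    have hsub : {x | ∃ p a, Knows p P₂ (ValueDecided T x a)} ⊆ ({y} : Set Item) := by
      rintro x ⟨p, a, hk⟩
      -- What is known in `P₂` is true in `P₂`, hence visible in what `T` returns in the extension
      -- `E`.
      have := hk P₂ (hE.of_prefix h5) rfl E hE h5 o ops hr
      exact hy x a this
    calc numKnown T P₂ ≤ ({y} : Set Item).encard := Set.encard_le_encard hsub
      _ = 1 := Set.encard_singleton y
  have hpos : 1 ≤ numKnown T P₁ := Order.one_le_iff_pos.2 (lt_of_le_of_lt bot_le h4)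
  exact absurd (lt_of_le_of_lt hpos h8) (not_lt.2 hle)

theorem stepDepth_le_txnDepth {E : List (Step I)} {T : Txn Item Val} {j : ℕ}
    (h : IsResponse E T j) : stepDepth E j ≤ txnDepth E T := by
  classical
  have hj : j ∈ Finset.range E.length := by
    obtain ⟨p, hid, o, ops, h⟩ := h
    exact Finset.mem_range.2 (List.getElem?_eq_some_iff.1 h).1
  have := Finset.le_sup (f := fun j => if IsResponse E T j then stepDepth E j else 0) hj
  simp only [h, if_true] at this
  exact this

end PDTS

namespace PDTS

variable {n : ℕ} {Item : Type u} {Val : Type v} {I : Implementation.{u, v, w} n Item Val}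

/-! ### Depth of steps -/

/-- The process is a client. -/
def Step.IsClient (s : Step I) : Prop := ∃ c T h a, s = .act (.client c) T h a

/-- The process is a node process. -/
def Step.IsNode (s : Step I) : Prop := ∃ i l T h a, s = .act (.node i l) T h a

theorem take_snoc_prefix {E : List (Step I)} {j : ℕ} {s : Step I} (h : E[j]? = some s) :
    E.take j ++ [s] <+: E := by
  obtain ⟨hj, rfl⟩ := List.getElem?_eq_some_iff.1 h
  rw [List.take_append_getElem hj]
  exact List.take_prefix _ _

theorem mem_take_iff {E : List (Step I)} {j : ℕ} {s : Step I} :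
    s ∈ E.take j ↔ ∃ i < j, E[i]? = some s := by
  rw [List.mem_iff_getElem?]
  constructor
  · rintro ⟨i, hi⟩
    rw [List.getElem?_take] at hi
    split_ifs at hi with h
    exact ⟨i, h, hi⟩
  · rintro ⟨i, h, hi⟩
    exact ⟨i, by rw [List.getElem?_take, if_pos h, hi]⟩

variable {E : List (Step I)}

theorem IsExec.exists_msgEdge (hE : IsExec E) {j : ℕ} {s : Step I} (hj : E[j]? = some s)
    {T : Txn Item Val} {src : HId} {k : ℕ} (hr : s.Receives T src k) :
    ∃ i s', i < j ∧ E[i]? = some s' ∧ s'.Sends T src k ∧ MsgEdge E i j := by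
  have hE' := hE.of_prefix (take_snoc_prefix hj)
  obtain ⟨C, C', hC, ht⟩ := isExec_snoc_iff.1 hE'
  have key : ∀ d m, (⟨T, src, k, d, m⟩ : Packet I) ∈ C.transit →
      ∃ i s', i < j ∧ E[i]? = some s' ∧ s'.Sends T src k ∧ MsgEdge E i j := by
    intro d m h
    obtain ⟨⟨p, h1⟩, -⟩ := (hC.inv.transit _).1 h
    obtain ⟨i, h2, h3⟩ := mem_take_iff.1 h1
    exact ⟨i, _, h2, h3, ⟨_, _, _, rfl⟩, h2, _, _, _, _, _, h3, hj, ⟨_, _, _, rfl⟩, hr⟩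
  rcases hr with ⟨p, m, rfl⟩ | ⟨p, h, m, rfl⟩
  · cases ht; exact key _ _ ‹_›
  · cases ht <;> exact key _ _ ‹_›

theorem MsgEdge.depth {i j : ℕ} (h : MsgEdge E i j) : stepDepth E i + 1 ≤ stepDepth E j := by
  classical
  conv_rhs => rw [stepDepth]
  have := Finset.le_sup (f := fun i : Fin j => if MsgEdge E i j then stepDepth E i + 1
    else if HandlerEdge E i j ∨ MemEdge E i j then stepDepth E i else 0)
    (Finset.mem_univ (⟨i, h.1⟩ : Fin j))
  simp only [h, if_true] at this
  exact this

theorem depth_le_of_edge {i j : ℕ} (h : HandlerEdge E i j ∨ MemEdge E i j) :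
    stepDepth E i ≤ stepDepth E j := by
  classical
  by_cases hm : MsgEdge E i j
  · have := hm.depth; omega
  conv_rhs => rw [stepDepth]
  have hij : i < j := h.elim (fun h => h.1) (fun h => h.1)
  have := Finset.le_sup (f := fun i : Fin j => if MsgEdge E i j then stepDepth E i + 1
    else if HandlerEdge E i j ∨ MemEdge E i j then stepDepth E i else 0)
    (Finset.mem_univ (⟨i, hij⟩ : Fin j))
  simp only [h, hm, if_true, if_false] at this
  exact this

/-- The supremum defining the depth is attained, which gives an immediate predecessor to argue by
induction from. -/
theorem depth_eq_zero_or (E : List (Step I)) (j : ℕ) : stepDepth E j = 0 ∨ ∃ i < j,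
    (MsgEdge E i j ∧ stepDepth E j = stepDepth E i + 1) ∨
      ((HandlerEdge E i j ∨ MemEdge E i j) ∧ stepDepth E j = stepDepth E i) := by
  classical
  rcases Nat.eq_zero_or_pos j with rfl | hj
  · left
    rw [stepDepth]
    simp
  · have : Nonempty (Fin j) := ⟨⟨0, hj⟩⟩
    obtain ⟨i, -, hi⟩ := Finset.exists_mem_eq_sup Finset.univ Finset.univ_nonempty
      (fun i : Fin j => if MsgEdge E i j then stepDepth E i + 1
        else if HandlerEdge E i j ∨ MemEdge E i j then stepDepth E i else 0)
    have hd : stepDepth E j = if MsgEdge E i j then stepDepth E i + 1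
        else if HandlerEdge E i j ∨ MemEdge E i j then stepDepth E i else 0 := by
      conv_lhs => rw [stepDepth]
      exact hi
    split_ifs at hd with h1 h2
    · exact .inr ⟨i, i.2, .inl ⟨h1, hd⟩⟩
    · exact .inr ⟨i, i.2, .inr ⟨h2, hd⟩⟩
    · exact .inl hd

theorem client_send_toNode (hE : IsExec E) {c : ℕ} {T : Txn Item Val} {h : HId} {k : ℕ}
    {d : Dest n} {m : I.Msg} (hs : Step.act (.client c) T h (.send k d m) ∈ E) :
    ∃ d', d = .toNode d' := by
  obtain ⟨A, C, C', -, -, ht⟩ := hE.trans_of_mem hs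
  cases ht
  exact ⟨_, rfl⟩

theorem start_node (hE : IsExec E) {p : Proc n} {T : Txn Item Val} {h : HId} {m : I.Msg}
    (hs : Step.act p T h (.start m) ∈ E) : ∃ i l, p = .node i l := by
  obtain ⟨A, C, C', -, -, ht⟩ := hE.trans_of_mem hs
  cases ht
  exact ⟨_, _, rfl⟩

/-- Nodes send to the client only, and a coordinator can only send to nodes, so every message
changes sides. -/
theorem MsgEdge.kinds (hcd : I.ClientDriven) (hE : IsExec E) {i j : ℕ} (h : MsgEdge E i j) :
    ∃ s s', E[i]? = some s ∧ E[j]? = some s' ∧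
      ((s.IsClient ∧ s'.IsNode) ∨ (s.IsNode ∧ s'.IsClient)) := by
  obtain ⟨-, s, s', T, src, k, hi, hj, hs, hr⟩ := h
  refine ⟨s, s', hi, hj, ?_⟩
  obtain ⟨C, hC, hI⟩ := hE.inv
  have hsE := List.mem_of_getElem? hi
  have hsE' := List.mem_of_getElem? hj
  rcases hr with ⟨p, m, rfl⟩ | ⟨p, hh, m, rfl⟩
  · obtain ⟨i, l, rfl⟩ := start_node hE hsE'
    obtain ⟨p', h1⟩ := hI.start_sent _ _ _ _ _ _ hsE'
    obtain rfl := hI.send_eq h1 hsE ⟨_, _, _, rfl⟩ hs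
    obtain ⟨c, rfl, rfl⟩ := send_fresh_client hcd hE h1
    exact .inl ⟨⟨_, _, _, _, rfl⟩, _, _, _, _, _, rfl⟩
  · obtain ⟨p', d, h1, h2⟩ := hI.recv_sent _ _ _ _ _ _ hsE'
    obtain rfl := hI.send_eq h1 hsE ⟨_, _, _, rfl⟩ hs
    rcases h2 with ⟨c, rfl, rfl⟩ | ⟨i, l, k', src', rfl, rfl, rfl⟩
    · rcases p' with c' | ⟨i, l⟩
      · obtain ⟨d', h3⟩ := client_send_toNode hE h1
        cases h3
      · exact .inr ⟨⟨_, _, _, _, _, rfl⟩, _, _, _, _, rfl⟩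
    · obtain ⟨c, rfl, rfl⟩ := send_fresh_client hcd hE h1
      exact .inl ⟨⟨_, _, _, _, rfl⟩, _, _, _, _, _, rfl⟩

/-- The name of a handler tells the side: `[]` runs on a client, all others on nodes. -/
theorem HandlerEdge.kinds (hE : IsExec E) {i j : ℕ} (h : HandlerEdge E i j) :
    ∃ s s', E[i]? = some s ∧ E[j]? = some s' ∧
      ((s.IsClient ∧ s'.IsClient) ∨ (s.IsNode ∧ s'.IsNode)) := by
  obtain ⟨-, p, p', T, hh, a, a', hi, hj⟩ := h
  refine ⟨_, _, hi, hj, ?_⟩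
  have h1 := hE.begun (List.mem_of_getElem? hi)
  have h2 := hE.begun (List.mem_of_getElem? hj)
  rcases h1 with ⟨c, rfl, rfl, -⟩ | ⟨i, l, k, src, m, rfl, rfl, -⟩ <;>
    rcases h2 with ⟨c', rfl, h, -⟩ | ⟨i', l', k', src', m', rfl, h, -⟩
  · exact .inl ⟨⟨_, _, _, _, rfl⟩, _, _, _, _, rfl⟩
  · cases h
  · cases h
  · exact .inr ⟨⟨_, _, _, _, _, rfl⟩, _, _, _, _, _, rfl⟩

theorem MemEdge.kinds {i j : ℕ} (h : MemEdge E i j) :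
    ∃ s s', E[i]? = some s ∧ E[j]? = some s' ∧ s.IsNode ∧ s'.IsNode := by
  obtain ⟨-, ν, x, T, l, h, op, r, l', h', op', r', h1, h2, -⟩ := h
  exact ⟨_, _, h1, h2, ⟨_, _, _, _, _, rfl⟩, _, _, _, _, _, rfl⟩

theorem Step.IsNode.not_isClient {s : Step I} (h : s.IsNode) : ¬ s.IsClient := by
  obtain ⟨i, l, T, hh, a, rfl⟩ := h
  rintro ⟨c, T', h', a', h⟩
  cases h

/-- Every step on a node has a cause: a start has its message, any later step the start of its
handler. This keeps node steps from having depth zero. -/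
theorem IsExec.exists_pred_of_isNode (hE : IsExec E) {j : ℕ} {s : Step I} (hj : E[j]? = some s)
    (hs : s.IsNode) : ∃ i, MsgEdge E i j ∨ HandlerEdge E i j := by
  obtain ⟨i, l, T, h, a, rfl⟩ := hs
  have hE' := hE.of_prefix (take_snoc_prefix hj)
  rcases hE'.begun (List.mem_append_right _ (List.mem_singleton.2 rfl)) with
    ⟨c, h1, -⟩ | ⟨i', l', k, src, m, h1, rfl, h2⟩
  · cases h1
  · by_cases ha : ∃ m', a = .start m'
    · obtain ⟨m', rfl⟩ := ha
      obtain ⟨b, s', -, -, -, h3⟩ := hE.exists_msgEdge hj (T := T) (.inl ⟨_, _, rfl⟩)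
      exact ⟨b, .inl h3⟩
    · rcases List.mem_append.1 h2 with h2 | h2
      · obtain ⟨b, h3, h4⟩ := mem_take_iff.1 h2
        exact ⟨b, .inr ⟨h3, _, _, _, _, _, _, h4, hj⟩⟩
      · rw [List.mem_singleton] at h2
        cases h2
        exact absurd ⟨_, rfl⟩ ha

/-- Clients take steps of even depth, nodes of odd depth. -/
theorem depth_parity (hcd : I.ClientDriven) (hE : IsExec E) (j : ℕ) (s : Step I)
    (hj : E[j]? = some s) :
    (s.IsClient → stepDepth E j % 2 = 0) ∧ (s.IsNode → stepDepth E j % 2 = 1) := by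
  induction j using Nat.strong_induction_on generalizing s with
  | _ j ih =>
    -- By this, depth zero on a node is impossible; otherwise the zero case of `depth_eq_zero_or`
    -- would spoil the parity.
    have hedge : ∀ i < j, (MsgEdge E i j ∨ HandlerEdge E i j ∨ MemEdge E i j) → s.IsNode →
        1 ≤ stepDepth E j := by
      rintro i hi (h | h) hs
      · have := h.depth; omega
      · have h1 := depth_le_of_edge h
        have : ∃ s', E[i]? = some s' ∧ s'.IsNode := by
          rcases h with h | h
          · obtain ⟨s1, s2, h2, h3, h4⟩ := h.kinds hE
            rw [hj] at h3
            cases h3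
            rcases h4 with h4 | h4
            · exact absurd h4.2 hs.not_isClient
            · exact ⟨s1, h2, h4.1⟩
          · obtain ⟨s1, s2, h2, h3, h4⟩ := h.kinds
            exact ⟨s1, h2, h4.1⟩
        obtain ⟨s', h2, h3⟩ := this
        have := (ih i hi s' h2).2 h3
        omega
    rcases depth_eq_zero_or E j with h | ⟨i, hij, ⟨h, hd⟩ | ⟨h, hd⟩⟩
    · refine ⟨fun _ => by omega, fun hs => ?_⟩
      obtain ⟨i, hi⟩ := hE.exists_pred_of_isNode hj hs
      have hij : i < j := hi.elim (fun h => h.1) (fun h => h.1)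
      have := hedge i hij (hi.imp id .inl) hs
      omega
    · obtain ⟨s1, s2, h2, h3, h4⟩ := h.kinds hcd hE
      rw [hj] at h3
      cases h3
      have := ih i hij s1 h2
      rcases h4 with h4 | h4
      · have h5 := this.1 h4.1
        exact ⟨fun h => absurd h h4.2.not_isClient, fun _ => by omega⟩
      · have h5 := this.2 h4.1
        exact ⟨fun _ => by omega, fun h => absurd h4.2 h.not_isClient⟩
    · have : ∃ s1, E[i]? = some s1 ∧
          ((s1.IsClient ∧ s.IsClient) ∨ (s1.IsNode ∧ s.IsNode)) := by
        rcases h with h | h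
        · obtain ⟨s1, s2, h2, h3, h4⟩ := h.kinds hE
          rw [hj] at h3
          cases h3
          exact ⟨s1, h2, h4⟩
        · obtain ⟨s1, s2, h2, h3, h4⟩ := h.kinds
          rw [hj] at h3
          cases h3
          exact ⟨s1, h2, .inr h4⟩
      obtain ⟨s1, h2, h3⟩ := this
      have := ih i hij s1 h2
      rcases h3 with h3 | h3
      · have h5 := this.1 h3.1
        exact ⟨fun _ => by omega, fun h => absurd h3.2 h.not_isClient⟩
      · have h5 := this.2 h3.1
        exact ⟨fun h => absurd h h3.2.not_isClient, fun _ => by omega⟩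

/-! ### Executions of a single transaction -/

/-- `F` is an execution of the single transaction `T`, invoked by client `c`, with one
process per handler, in which `T` commits with the operations `ops`. -/
structure Solo (F : List (Step I)) (T : Txn Item Val) (c : ℕ) (ops : List (Op Item Val)) : Prop where
  exec : IsExec F
  canon : Canon F
  only : ∀ s ∈ F, s.txn = some T
  client : ∀ c' h a, Step.act (.client c') T h a ∈ F → c' = c
  returns : Returns F T .commit ops

section

variable {F : List (Step I)} {T : Txn Item Val} {c : ℕ} {ops : List (Op Item Val)}

theorem Solo.kind (hF : Solo F T c ops) {s : Step I} (hs : s ∈ F) :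
    (∃ a, s = .act (.client c) T [] a) ∨
      ∃ i k src a, s = .act (.node i (procCode T (k :: src))) T (k :: src) a := by
  have h1 := hF.only s hs
  rcases s with i | ⟨p, T', h, a⟩
  · cases h1
  · cases h1
    rcases hF.exec.begun hs with ⟨c', rfl, rfl, -⟩ | ⟨i, l, k, src, m, rfl, rfl, -⟩
    · obtain rfl := hF.client _ _ _ hs
      exact .inl ⟨a, rfl⟩
    · obtain rfl := hF.canon _ _ _ _ _ hs
      exact .inr ⟨i, k, src, a, rfl⟩

/-- Steps of the same process belong to the same handler. -/
theorem Solo.handlerEdge (hF : Solo F T c ops) {i j : ℕ} (hij : i < j) {s s' : Step I}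
    (hi : F[i]? = some s) (hj : F[j]? = some s') (hp : s.proc = s'.proc) : HandlerEdge F i j := by
  refine ⟨hij, ?_⟩
  rcases hF.kind (List.mem_of_getElem? hi) with ⟨a, rfl⟩ | ⟨ν, k, src, a, rfl⟩ <;>
    rcases hF.kind (List.mem_of_getElem? hj) with ⟨a', rfl⟩ | ⟨ν', k', src', a', rfl⟩
  · exact ⟨_, _, _, _, _, _, hi, hj⟩
  · cases hp
  · cases hp
  · simp only [Step.proc, Option.some.injEq, Proc.node.injEq] at hp
    obtain ⟨-, h1⟩ := procCode_inj hp.2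
    rw [h1] at hi
    exact ⟨_, _, _, _, _, _, hi, hj⟩

end

end PDTS

/-! ### The standing assumptions, and executions that do without one node -/

namespace PDTS

variable {n : ℕ} {Item : Type u} {Val : Type v} {I : Implementation.{u, v, w} n Item Val}

/-- The guarantees of the implementation, for `f` tolerated crashes, initial values `init` and delay
bound `Δ`. -/
structure Guarantees (I : Implementation.{u, v, w} n Item Val) (f : ℕ) (init : Item → Val)
    (Δ : ℝ) : Prop where
  programs : I.RespectsPrograms
  handlers : I.HandlersReturn f
  clientDriven : I.ClientDriven
  progress : I.WeakProgress f
  seamless : I.Seamless 1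
  delay_pos : 0 < Δ
  fast : I.FastDeciding Δ
  invisible : I.InvisibleReads
  disjoint : I.DisjointAccessParallel
  serializable : I.Serializable init

theorem mem_proj {E : List (Step I)} {p : Proc n} {s : Step I} :
    s ∈ proj p E ↔ s ∈ E ∧ s.proc = some p := by
  simp [proj]

/-! ### Executions that avoid a node -/

theorem no_step_after_crash {i : Fin n} {E : List (Step I)} (hE : IsExec (.crash i :: E)) {l : ℕ}
    {T : Txn Item Val} {h : HId} {a : Act I} :
    Step.act (.node i l) T h a ∉ Step.crash i :: E := by
  intro hs
  obtain ⟨A, C, C', hA, hC, ht⟩ := hE.trans_of_mem hs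
  have hcr : i ∉ C.crashed := by cases ht <;> assumption
  rw [hC.crashed_iff] at hcr
  rcases A with _ | ⟨b, A⟩
  · rw [List.nil_append, List.cons_prefix_cons] at hA
    cases hA.1
  · rw [List.cons_append, List.cons_prefix_cons] at hA
    rw [hA.1] at hcr
    exact hcr List.mem_cons_self

theorem mem_iff_of_coordEvents {E F : List (Step I)}
    (h : F.filter Step.isCoordEvent = E.filter Step.isCoordEvent) {s : Step I}
    (hs : s.isCoordEvent = true) : s ∈ F ↔ s ∈ E := by
  have h1 := List.mem_filter (p := Step.isCoordEvent) (as := F) (x := s)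
  have h2 := List.mem_filter (p := Step.isCoordEvent) (as := E) (x := s)
  rw [h] at h1
  simp only [hs, and_true] at h1 h2
  exact h1.symm.trans h2

theorem invoked_iff_of_coordEvents {E F : List (Step I)}
    (h : F.filter Step.isCoordEvent = E.filter Step.isCoordEvent) {T : Txn Item Val} :
    Invoked F T ↔ Invoked E T := by
  unfold Invoked
  simp only [mem_iff_of_coordEvents h (s := Step.act _ _ _ .invoke) rfl]

theorem returns_iff_of_coordEvents {E F : List (Step I)}
    (h : F.filter Step.isCoordEvent = E.filter Step.isCoordEvent) {T : Txn Item Val} {o : Outcome}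
    {ops : List (Op Item Val)} : Returns F T o ops ↔ Returns E T o ops := by
  unfold Returns
  simp only [mem_iff_of_coordEvents h (s := Step.act _ _ _ (.respond _ _)) rfl]

/-- Every failure-free execution can be replaced by one with the same calls and returns that does not
use a given node. -/
theorem exists_avoiding (hs : I.Seamless 1) {E : List (Step I)} (hE : IsExec E)
    (hff : FailureFree E) (ν : Option (Fin n)) :
    ∃ F, IsExec F ∧ FailureFree F ∧ Canon F ∧
      F.filter Step.isCoordEvent = E.filter Step.isCoordEvent ∧
      ∀ i ∈ ν, ∀ l T h a, Step.act (.node i l) T h a ∉ F := by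
  rcases ν with _ | i
  · exact ⟨clean E, hE.clean, failureFree_clean E, canon_clean E, clean_coordEvents hE, by simp⟩
  -- The node crashes after the empty prefix, so it takes no step at all; deleting the crash
  -- afterwards makes the execution failure-free again.
  · obtain ⟨E', h1, ⟨E₂, h2⟩, h3, -⟩ := hs.2 E hE hff [] List.nil_prefix rfl i (by simp [Crashed])
    refine ⟨clean E', h1.clean, failureFree_clean _, canon_clean _,
      (clean_coordEvents h1).trans h3, ?_⟩
    rintro i' hi l T h a hs
    obtain rfl : i = i' := by simpa using hi
    obtain ⟨-, l', h4⟩ := mem_clean_node.1 hs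
    rw [← h2] at h1 h4
    exact no_step_after_crash h1 h4

theorem IsExec.invoke_eq {E : List (Step I)} (hE : IsExec E) {p p' : Proc n} {T : Txn Item Val}
    {h h' : HId} (hs : Step.act p T h .invoke ∈ E) (hs' : Step.act p' T h' .invoke ∈ E) :
    p = p' ∧ h = h' := by
  obtain ⟨C, -, hI⟩ := hE.inv
  have := pairwise_unique (R := fun s => ∃ p h, s = Step.act p T h .invoke)
    (hI.invoke_uniq.imp ?_) hs hs' ⟨_, _, rfl⟩ ⟨_, _, rfl⟩
  · simp only [Step.act.injEq] at this
    exact ⟨this.1, this.2.2.1⟩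
  · rintro s s' h1 ⟨p, h, rfl⟩ ⟨p', h', rfl⟩
    exact h1 _ _ _ _ _ rfl rfl

theorem IsExec.client_eq {E : List (Step I)} (hE : IsExec E) {c c' : ℕ} {T : Txn Item Val}
    {h h' : HId} {a : Act I} (hs : Step.act (.client c) T h .invoke ∈ E)
    (hs' : Step.act (.client c') T h' a ∈ E) : c' = c := by
  rcases hE.begun hs' with ⟨c'', h1, -, h2⟩ | ⟨i, l, k, src, m, h1, -⟩
  · have := (hE.invoke_eq hs h2).1
    cases this
    rfl
  · cases h1

/-! ### Runs in which a transaction finds the initial value, and runs in which it does not -/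

variable {f : ℕ} {init alt : Item → Val} {Δ : ℝ}

/-- A `condTxn` can be run alone, without using a given node, and within four message delays. -/
theorem Guarantees.exists_solo (hI : Guarantees I f init Δ) (alt : Item → Val) (k c : ℕ)
    (y x : Item) (ν : Option (Fin n)) :
    ∃ F : List (Step I), Solo F (condTxn init alt k y x) c (condOps init alt y x) ∧
      (∀ i ∈ ν, ∀ l T h a, Step.act (.node i l) T h a ∉ F) ∧
      ∀ j, IsResponse F (condTxn init alt k y x) j → stepDepth F j ≤ 4 := by
  set T := condTxn init alt k y x with hT
  have hni : ∀ T', ¬ Invoked ([] : List (Step I)) T' := by simp [Invoked]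
  obtain ⟨E, h1, h2, h3, -, ⟨ops, h4⟩, h5⟩ := exists_committed hI.clientDriven hI.handlers
    hI.progress (E := []) IsExec.nil rfl (T := T) (fun T' h => absurd h (hni T')) (c := c) rfl
    (fun T' h => absurd h (hni T'))
  have h6 : ∀ T', Invoked E T' → T' = T := fun T' h => (h5 T' h).resolve_right (hni T')
  obtain rfl := condTxn_solo_ops hI.programs hI.serializable h2 h4 h6
  obtain ⟨F, g1, g2, g3, g4, g5⟩ := exists_avoiding hI.seamless h2 h3 ν
  have g6 : ∀ T', Invoked F T' → T' = T := fun T' h => h6 T' ((invoked_iff_of_coordEvents g4).1 h)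
  have g7 : Returns F T .commit (condOps init alt y x) := (returns_iff_of_coordEvents g4).2 h4
  have g8 : Step.act (.client c) T [] .invoke ∈ F :=
    (mem_iff_of_coordEvents g4 rfl).2 (h1.subset (by simp))
  refine ⟨F, ⟨g1, g3, fun s hs => ?_, fun c' h a hs => g1.client_eq g8 hs, g7⟩, g5,
    fun j hj => (stepDepth_le_txnDepth hj).trans ?_⟩
  · rcases s with i | ⟨p, T', h, a⟩
    · exact absurd hs (crashed_false g2 i)
    · exact congrArg some (g6 _ (g1.invoked hs))
  -- Fast decision is applied to the cleaned execution `F` itself, so nothing has to be known about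
  -- how cleaning affects depths.
  · refine txnDepth_le_four hI.delay_pos hI.fast g1 g2 g7 g6 (y := y) fun z a hz => ?_
    simp only [condOps, List.mem_cons, Op.read.injEq, reduceCtorEq, List.not_mem_nil, or_false] at hz
    exact hz.1

/-- After a transaction that overwrote `y` with the initial value of `x`, the transaction
`condTxn init alt k y x` commits after a single read, also without using a given node. -/
theorem Guarantees.exists_reading (hI : Guarantees I f init Δ) (hne : ∀ x, alt x ≠ init x)
    (k k' c : ℕ) {y x : Item} (hk : k ≠ k') (hxy : x ≠ y) (ν : Option (Fin n)) :
    ∃ (E : List (Step I)) (a : Val), IsExec E ∧ FailureFree E ∧ Returns E (condTxn init alt k y x) .commit [.read y a] ∧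
      Step.act (.client c) (condTxn init alt k y x) [] .invoke ∈ E ∧
      (∀ T h a, Step.act (.client c) T h a ∈ E → T = condTxn init alt k y x) ∧
      ∀ i ∈ ν, ∀ l T h a, Step.act (.node i l) T h a ∉ E := by
  set T := condTxn init alt k y x with hT
  set U := condTxn init alt k' x y with hU
  have hTU : T ≠ U := fun h => hk (congrArg Txn.id h)
  have hni : ∀ T', ¬ Invoked ([] : List (Step I)) T' := by simp [Invoked]
  obtain ⟨E, h1, h2, h3, h3', ⟨ops, h4⟩, h5⟩ := exists_committed hI.clientDriven hI.handlers
    hI.progress (E := []) IsExec.nil rfl (T := U) (fun T' h => absurd h (hni T')) (c := c + 1) rfl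
    (fun T' h => absurd h (hni T'))
  have h6 : ∀ T', Invoked E T' → T' = U := fun T' h => (h5 T' h).resolve_right (hni T')
  obtain rfl := condTxn_solo_ops hI.programs hI.serializable h2 h4 h6
  have hUi : Step.act (.client (c + 1)) U [] .invoke ∈ E := h1.subset (by simp)
  obtain ⟨E₂, g1, g2, g3, -, ⟨ops, g4⟩, g5⟩ := exists_committed hI.clientDriven hI.handlers
    hI.progress h2 h3 (T := T) (fun T' h => by rw [h6 T' h]; exact fun h => hk h.symm)
    (c := c) (by
      refine List.eq_nil_iff_forall_not_mem.2 ?_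
      rintro (i | ⟨p, T', h, a⟩) hs <;> obtain ⟨hs, hp⟩ := mem_proj.1 hs
      · cases hp
      · cases hp
        have h7 := h6 _ (h2.invoked hs)
        rw [h7] at hs
        have := h2.client_eq hUi hs
        omega)
    (fun T' h => by rw [h6 T' h]; exact h3')
  have g6 : ∀ T', Invoked E₂ T' → T' = T ∨ T' = U := fun T' h => (g5 T' h).imp id (h6 T')
  have hsub : E <+: E₂ := (List.prefix_append _ _).trans g1
  have hUr : Returns E₂ U .commit (condOps init alt x y) := by
    obtain ⟨p, h, hs⟩ := h4
    exact ⟨p, h, hsub.subset hs⟩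
  -- `U` committed on the initial value of `x`. Were `T` also to find the initial value of `y`,
  -- serializability would fail; so `T` finds another value and writes nothing.
  obtain ⟨a, rfl⟩ := condTxn_pair_ops hne hI.programs hI.serializable g2 hxy hUr g4 hk g6
  obtain ⟨F, e1, e2, e3, e4, e5⟩ := exists_avoiding hI.seamless g2 g3 ν
  refine ⟨F, a, e1, e2, (returns_iff_of_coordEvents e4).2 g4,
    (mem_iff_of_coordEvents e4 rfl).2 (g1.subset (by simp)), fun T' h a' hs => ?_, e5⟩
  rcases g6 T' ((invoked_iff_of_coordEvents e4).1 (e1.invoked hs)) with h | rfl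
  · exact h
  · have := e1.client_eq ((mem_iff_of_coordEvents e4 rfl).2 (hsub.subset hUi)) hs
    omega

end PDTS

namespace PDTS

variable {n : ℕ} {Item : Type u} {Val : Type v} {I : Implementation.{u, v, w} n Item Val}

/-! ### Clients are deterministic between receipts -/

/-- Locates a step of a projection in the execution: `A` is what precedes it there. -/
theorem prefix_of_proj_snoc {E u : List (Step I)} {s : Step I} {p : Proc n}
    (h : u ++ [s] <+: proj p E) : ∃ A, A ++ [s] <+: E ∧ proj p A = u := by
  induction E using List.reverseRecOn with
  | nil =>
    have := h.length_le
    simp [proj] at this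
  | append_singleton E s' ih =>
    by_cases hs : s'.proc = some p
    · have h1 : proj p (E ++ [s']) = proj p E ++ [s'] := by
        rw [proj_append]; simp [proj, hs]
      rw [h1, List.prefix_concat_iff] at h
      rcases h with h | h
      · obtain ⟨h2, h3⟩ := List.append_inj' h rfl
        cases h3
        exact ⟨E, List.prefix_rfl, h2.symm⟩
      · obtain ⟨A, h2, h3⟩ := ih h
        exact ⟨A, h2.trans (List.prefix_append _ _), h3⟩
    · have h1 : proj p (E ++ [s']) = proj p E := by
        rw [proj_append]; simp [proj, hs]
      rw [h1] at h
      obtain ⟨A, h2, h3⟩ := ih h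
      exact ⟨A, h2.trans (List.prefix_append _ _), h3⟩

/-- The client state is a function of its earlier steps, and only a receipt leaves the environment a
choice. For an idle client the next step is an invocation, which is fixed by the common transaction.
-/
theorem client_step_unique {E E' u : List (Step I)} (hE : IsExec E) (hE' : IsExec E') {c : ℕ}
    {T : Txn Item Val} {s s' : Step I} (h : u ++ [s] <+: proj (.client c) E)
    (h' : u ++ [s'] <+: proj (.client c) E') (hT : s.txn = some T) (hT' : s'.txn = some T)
    (hr : ∀ src k, ¬ s.Receives T src k) : s = s' := by
  have hp : s.proc = some (.client c) ∧ s'.proc = some (.client c) := by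
    have h1 : s ∈ proj (.client c) E := h.subset (by simp)
    have h2 : s' ∈ proj (.client c) E' := h'.subset (by simp)
    rw [mem_proj] at h1 h2
    exact ⟨h1.2, h2.2⟩
  obtain ⟨A, hA, hu⟩ := prefix_of_proj_snoc h
  obtain ⟨A', hA', hu'⟩ := prefix_of_proj_snoc h'
  obtain ⟨C, C₁, hC, ht⟩ := isExec_snoc_iff.1 (hE.of_prefix hA)
  obtain ⟨D, D₁, hD, ht'⟩ := isExec_snoc_iff.1 (hE'.of_prefix hA')
  have hrun : C.running (.client c) = D.running (.client c) := by
    rw [hC.running_eq, hD.running_eq, runOf, runOf, hu, hu']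
  have hrecv : ∀ h src k m, s ≠ .act (.client c) T h (.recv src k m) :=
    fun h src k m he => hr src k (he ▸ .inr ⟨_, _, _, rfl⟩)
  clear hr h h' hA hA' hC hD
  cases ht
  case coordRecv =>
    cases hT
    cases hp.1
    exact absurd rfl (hrecv _ _ _ _)
  all_goals cases ht' <;> simp_all [Step.proc, Step.txn]

/-! ### Depth zero -/

theorem proj_take_succ {E : List (Step I)} {j : ℕ} {s : Step I} (hj : E[j]? = some s) (p : Proc n) :
    proj p (E.take (j + 1)) = proj p (E.take j) ++ proj p [s] := by
  rw [← proj_append, List.take_add_one, hj]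
  rfl

theorem exists_snoc_prefix {α : Type*} {u l : List α} (h : u <+: l) {a : α} (ha : a ∈ l)
    (hn : a ∉ u) : ∃ b, u ++ [b] <+: l := by
  obtain ⟨t, rfl⟩ := h
  cases t with
  | nil => simp [hn] at ha
  | cons b t => exact ⟨b, t, by simp⟩

/-- The steps that a client takes before it has received a message are the same in every execution in
which it decides the transaction. -/
theorem Solo.proj_prefix {F : List (Step I)} {T : Txn Item Val} {c : ℕ} {ops : List (Op Item Val)}
    (hF : Solo F T c ops) {E : List (Step I)} (hE : IsExec E)
    (hr : ∃ o ops', Step.act (.client c) T [] (.respond o ops') ∈ E)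
    (hc : ∀ T' h a, Step.act (.client c) T' h a ∈ E → T' = T) {j : ℕ}
    (hd : ∀ b < j, ∀ s, F[b]? = some s → s.IsClient → stepDepth F b = 0) :
    proj (.client c) (F.take j) <+: proj (.client c) E := by
  induction j with
  | zero => simp [proj]
  | succ j ih =>
    have ih := ih fun b hb => hd b (by omega)
    rcases hj : F[j]? with _ | s
    · rwa [List.take_add_one, hj, Option.toList_none, List.append_nil]
    rw [proj_take_succ hj]
    by_cases hp : s.proc = some (.client c)
    swap
    · simpa [proj, hp] using ih
    have h1 : proj (.client c) [s] = [s] := by simp [proj, hp]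
    rw [h1]
    obtain ⟨o, ops', hresp⟩ := hr
    have hsT : s.txn = some T := hF.only _ (List.mem_of_getElem? hj)
    have hsc : s.IsClient := by
      rcases s with i | ⟨p, T', h, a⟩
      · cases hp
      · cases hp; exact ⟨_, _, _, _, rfl⟩
    obtain ⟨s', hs'⟩ := exists_snoc_prefix ih
      (a := Step.act (.client c) T [] (.respond o ops')) (mem_proj.2 ⟨hresp, rfl⟩)
      (fun h => by
        have h2 : Step.act (.client c) T [] (.respond o ops') ∈ F.take j := (mem_proj.1 h).1
        rcases s with i | ⟨p, T', h, a⟩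
        · cases hp
        · cases hp
          cases hsT
          have h3 : IsExec (F.take j ++ [Step.act (.client c) T h a]) :=
            hF.exec.of_prefix (take_snoc_prefix hj)
          exact no_client_step_after_decided h3 ⟨o, ops', _, _, h2⟩ (List.mem_singleton.2 rfl))
    have hT' : s'.txn = some T := by
      have h2 : s' ∈ proj (.client c) E := hs'.subset (by simp)
      rw [mem_proj] at h2
      rcases s' with i | ⟨p, T', h, a⟩
      · cases h2.2
      · cases h2.2
        exact congrArg some (hc _ _ _ h2.1)
    have h5 : proj (.client c) (F.take j) ++ [s] <+: proj (.client c) F := by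
      have h6 : proj (.client c) (F.take j ++ [s]) <+: proj (.client c) F := by
        obtain ⟨t, ht⟩ := take_snoc_prefix hj
        conv_rhs => rw [← ht, proj_append]
        exact List.prefix_append _ _
      rwa [proj_append, h1] at h6
    -- A receipt would have depth at least one, so `s` is not a receipt and its counterpart in `E`
    -- equals it.
    have := client_step_unique hF.exec hE h5 hs' hsT hT' fun src k hrec => by
      obtain ⟨i, s₁, h6, h7, h8, h9⟩ := hF.exec.exists_msgEdge hj hrec
      have := h9.depth
      have := hd j (by omega) s hj hsc
      omega
    rwa [this]

/-! ### Selected steps of an execution -/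

open Classical in
/-- The steps of `F` before position `j` at positions satisfying `D`. -/
noncomputable def select (F : List (Step I)) (D : ℕ → Prop) (j : ℕ) : List (Step I) :=
  ((List.range j).filter fun b => D b).filterMap fun b => F[b]?

open Classical in
theorem select_succ (F : List (Step I)) (D : ℕ → Prop) (j : ℕ) :
    select F D (j + 1) = select F D j ++ if D j then F[j]?.toList else [] := by
  unfold select
  rw [List.range_succ, List.filter_append, List.filterMap_append]
  congr 1
  by_cases h : D j
  · rcases h' : F[j]? with _ | s <;> simp [h, h']
  · simp [h]

theorem mem_select {F : List (Step I)} {D : ℕ → Prop} {j : ℕ} {s : Step I} :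
    s ∈ select F D j ↔ ∃ b < j, D b ∧ F[b]? = some s := by
  simp [select, and_assoc]

/-- Dropping steps that do not contribute is harmless; this is used both for projections and for
memory effects. -/
theorem filterMap_select {β : Type*} (g : Step I → Option β) {F : List (Step I)} {D : ℕ → Prop}
    {j : ℕ} (h : ∀ b < j, ∀ s, F[b]? = some s → g s ≠ none → D b) :
    (select F D j).filterMap g = (F.take j).filterMap g := by
  induction j with
  | zero => simp [select]
  | succ j ih =>
    rw [select_succ, List.take_add_one, List.filterMap_append, List.filterMap_append,
      ih fun b hb => h b (by omega)]
    congr 1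
    split_ifs with hD
    · rfl
    · rcases hs : F[j]? with _ | s
      · rfl
      · by_cases hg : g s = none
        · simp [hg]
        · exact absurd (h j (by omega) s hs hg) hD

theorem proj_select {p : Proc n} {F : List (Step I)} {D : ℕ → Prop} {j : ℕ}
    (h : ∀ b < j, ∀ s, F[b]? = some s → s.proc = some p → D b) :
    proj p (select F D j) = proj p (F.take j) := by
  classical
  unfold proj
  have h1 := fun l : List (Step I) =>
    congrFun (List.filterMap_eq_filter (p := fun s : Step I => decide (s.proc = some p))) l
  rw [← h1, ← h1]
  refine filterMap_select _ fun b hb s hs hg => h b hb s hs ?_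
  by_contra hp
  exact hg (by simp [Option.guard, hp])

theorem mops_select {i : Fin n} {x : I.Obj} {F : List (Step I)} {D : ℕ → Prop} {j : ℕ}
    (h : ∀ b < j, ∀ s, F[b]? = some s → stepMop i x s ≠ none → D b) :
    mops i x (select F D j) = mops i x (F.take j) :=
  filterMap_select _ h

theorem stepMop_ne_none {i : Fin n} {x : I.Obj} {s : Step I} (h : stepMop i x s ≠ none) :
    ∃ l T hid op r, s = .act (.node i l) T hid (.prim x op r) ∧ NonTrivial op := by
  unfold stepMop at h
  split at h
  · split_ifs at h with h1
    · obtain ⟨rfl, rfl, h2⟩ := h1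
      exact ⟨_, _, _, _, _, rfl, h2⟩
    · exact absurd rfl h
  · exact absurd rfl h

theorem mops_eq_nil {i : Fin n} {x : I.Obj} {E : List (Step I)}
    (h : ∀ l T hid op r, Step.act (.node i l) T hid (.prim x op r) ∈ E → ¬ NonTrivial op) :
    mops i x E = [] := by
  refine List.filterMap_eq_nil_iff.2 fun s hs => ?_
  by_contra hne
  obtain ⟨l, T, hid, op, r, rfl, h1⟩ := stepMop_ne_none hne
  exact h _ _ _ _ _ hs h1

/-! ### The node that receives a message -/

/-- Whatever a handler receives is addressed to it by name, and the message that triggered it fixes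
the node. With `IsExec.recv_target` this shows that such messages cannot be received on another
node, even in a different execution. -/
theorem IsExec.recv_source {E : List (Step I)} (hE : IsExec E) {i : Fin n} {l : ℕ}
    {T : Txn Item Val} {h : HId} {a : Act I} (hs : Step.act (.node i l) T h a ∈ E) :
    ∃ k' h', h = k' :: h' ∧ (∃ q m, Step.act (.node i q) T h (.start m) ∈ E) ∧
      (∃ p m, Step.act p T h' (.send k' (.toNode (.fresh i)) m) ∈ E) ∧
      ∀ src k, (Step.act (.node i l) T h a).Receives T src k → (src = h' ∧ k = k') ∨
        ∃ p m, Step.act p T src (.send k (.toNode (.running k' h')) m) ∈ E := by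
  obtain ⟨C, -, hI⟩ := hE.inv
  rcases hE.begun hs with ⟨c, h1, -⟩ | ⟨i', l', k', h', m', h1, rfl, h2⟩
  · cases h1
  cases h1
  obtain ⟨p, hp⟩ := hI.start_sent _ _ _ _ _ _ h2
  refine ⟨k', h', rfl, ⟨_, _, h2⟩, ⟨p, m', hp⟩, fun src k hr => ?_⟩
  rw [receives_act] at hr
  obtain ⟨-, ⟨hr, -⟩ | ⟨m, rfl⟩⟩ := hr
  · cases hr; exact .inl ⟨rfl, rfl⟩
  · obtain ⟨p', d, h3, ⟨c, h4, -⟩ | ⟨i'', l'', k'', src', -, h4, rfl⟩⟩ :=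
      hI.recv_sent _ _ _ _ _ _ hs
    · cases h4
    · cases h4; exact .inr ⟨_, _, h3⟩

theorem IsExec.recv_target {E : List (Step I)} (hE : IsExec E) {i : Fin n} {p : Proc n}
    {T : Txn Item Val} {h' src : HId} {k' k : ℕ} {m : I.Msg}
    (h1 : Step.act p T h' (.send k' (.toNode (.fresh i)) m) ∈ E) {s : Step I} (hs : s ∈ E)
    (hr : s.Receives T src k) (h2 : (src = h' ∧ k = k') ∨
      ∃ p m, Step.act p T src (.send k (.toNode (.running k' h')) m) ∈ E) :
    ∃ l h a, s = .act (.node i l) T h a := by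
  obtain ⟨C, -, hI⟩ := hE.inv
  have key : ∀ i' l m', Step.act (.node i' l) T (k' :: h') (.start m') ∈ E → i' = i := by
    intro i' l m' h3
    obtain ⟨p', h4⟩ := hI.start_sent _ _ _ _ _ _ h3
    have := hI.send_eq h1 h4 ⟨_, _, _, rfl⟩ ⟨_, _, _, rfl⟩
    simp only [Step.act.injEq, Act.send.injEq, Dest.toNode.injEq, NodeDest.fresh.injEq] at this
    exact this.2.2.2.2.1.symm
  rcases h2 with ⟨rfl, rfl⟩ | ⟨p', m', h2⟩
  · obtain ⟨q, m', rfl⟩ := start_of_receives_fresh hE h1 hs hr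
    obtain ⟨i', l, rfl⟩ := start_node hE hs
    rw [key _ _ _ hs]
    exact ⟨_, _, _, rfl⟩
  · rcases hr with ⟨q, m₂, rfl⟩ | ⟨q, hid, m₂, rfl⟩
    · obtain ⟨i', l, rfl⟩ := start_node hE hs
      obtain ⟨p₂, h4⟩ := hI.start_sent _ _ _ _ _ _ hs
      have := hI.send_eq h2 h4 ⟨_, _, _, rfl⟩ ⟨_, _, _, rfl⟩
      simp at this
    · obtain ⟨p₂, d, h3, h4⟩ := hI.recv_sent _ _ _ _ _ _ hs
      have := hI.send_eq h2 h3 ⟨_, _, _, rfl⟩ ⟨_, _, _, rfl⟩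
      simp only [Step.act.injEq, Act.send.injEq] at this
      obtain ⟨-, -, -, -, rfl, -⟩ := this
      rcases h4 with ⟨c, -, h5⟩ | ⟨i', l, k'', src', rfl, rfl, h5⟩
      · cases h5
      · cases h5
        rcases hE.begun hs with ⟨c, h6, -⟩ | ⟨i₂, l₂, k₂, src₂, m₃, h6, -, h7⟩
        · cases h6
        · rw [key _ _ _ h7]
          exact ⟨_, _, _, rfl⟩

/-! ### Primitives of depth one -/

variable {f : ℕ} {init alt : Item → Val} {Δ : ℝ}

/-- In another execution `E` the transaction reads a non-initial value and commits without writing,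
node `i` taking no part. The client sends the same messages of depth zero there, and those for node
`i` are still in transit. So the steps of `F` of depth one on node `i` can be appended to `E`, and
weak invisible reads applies to them. -/
theorem Guarantees.depth_one_trivial (hI : Guarantees I f init Δ) (hne : ∀ x, alt x ≠ init x)
    {k c : ℕ} {y x : Item} (hxy : x ≠ y) {F : List (Step I)}
    (hF : Solo F (condTxn init alt k y x) c (condOps init alt y x)) {b : ℕ} {i : Fin n} {l : ℕ}
    {T : Txn Item Val} {h : HId} {z : I.Obj} {op : I.OVal → I.OVal × I.Ret} {r : I.Ret}
    (hb : F[b]? = some (.act (.node i l) T h (.prim z op r))) (hd : stepDepth F b = 1) :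
    ¬ NonTrivial op := by
  obtain ⟨E, v, hE, hff, ⟨p, hid, hret⟩, hinv, hcl, hav⟩ :=
    hI.exists_reading hne k (k + 1) c (by omega) hxy (some i)
  have hav : ∀ l T h a, Step.act (.node i l) T h a ∉ E := hav i rfl
  have hT := hF.only _ (List.mem_of_getElem? hb)
  cases hT
  set T := condTxn init alt k y x
  have hpar := fun j s => depth_parity hI.clientDriven hF.exec j s
  have hresp : Step.act (.client c) T [] (.respond .commit [.read y v]) ∈ E := by
    obtain ⟨A, C, C', -, -, ht⟩ := hE.trans_of_mem hret
    have : ∃ c', p = .client c' := by cases ht; exact ⟨_, rfl⟩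
    obtain ⟨c', rfl⟩ := this
    obtain rfl := hE.client_eq hinv hret
    rcases hE.begun hret with ⟨c'', -, rfl, -⟩ | ⟨_, _, _, _, _, h1, -⟩
    · exact hret
    · cases h1
  -- Client steps of depth zero precede any receipt, so they occur in `E` as well.
  have hzero : ∀ b s, F[b]? = some s → s.IsClient → stepDepth F b = 0 → s ∈ E := by
    intro b s hs hc h0
    have hcl' : ∀ {b' : ℕ} {s'}, F[b']? = some s' → s'.IsClient → s'.proc = some (.client c) := by
      rintro b' s' hs' ⟨c', T', h', a', rfl⟩
      rcases hF.kind (List.mem_of_getElem? hs') with ⟨a, h1⟩ | ⟨_, _, _, _, h1⟩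
      · cases h1; rfl
      · cases h1
    have h1 := hF.proj_prefix hE ⟨_, _, hresp⟩ hcl (j := b + 1) fun b' hb' s' hs' hc' => by
      rcases Nat.lt_succ_iff_lt_or_eq.1 hb' with h2 | rfl
      · have := depth_le_of_edge (.inl (hF.handlerEdge h2 hs' hs
          ((hcl' hs' hc').trans (hcl' hs hc).symm)))
        omega
      · exact h0
    rw [proj_take_succ hs] at h1
    exact (mem_proj.1 (h1.subset (List.mem_append_right _ (mem_proj.2
      ⟨List.mem_singleton.2 rfl, hcl' hs hc⟩)))).1
  -- The positions to be appended to `E`, in the order of `F`.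
  set D : ℕ → Prop := fun b => stepDepth F b = 1 ∧ ∃ l T h a, F[b]? = some (.act (.node i l) T h a)
    with hD
  have htriv : ∀ j, IsExec (E ++ select F D j) → ∀ p T h x op r,
      Step.act p T h (.prim x op r) ∈ select F D j → ¬ NonTrivial op := by
    intro j hj p T' h x op r hs
    obtain ⟨b, -, -, h1⟩ := mem_select.1 hs
    have := hF.only _ (List.mem_of_getElem? h1)
    cases this
    refine hI.invisible.1 _ hj _ _ [.read y v] ⟨_, _, List.mem_append_left _ hresp⟩ ?_ _ _ _ _ _
      (List.mem_append_right _ hs)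
    ext z
    simp [writeSet]
  have hall : ∀ j, IsExec (E ++ select F D j) := by
    intro j
    induction j with
    | zero => simpa [select] using hE
    | succ j ih =>
      rw [select_succ]
      split_ifs with hDj
      swap
      · simpa using ih
      obtain ⟨hd1, l, T', h, a, hs⟩ := hDj
      have hT : T' = T := by
        have := hF.only _ (List.mem_of_getElem? hs)
        cases this
        rfl
      subst hT
      rw [hs, Option.toList_some, ← List.append_assoc]
      have hE₀ : IsExec (F.take j ++ [.act (.node i l) T h a]) :=
        hF.exec.of_prefix (take_snoc_prefix hs)
      -- Earlier steps of the same process have depth at most one, hence exactly one by parity, so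
      -- they have been appended too.
      have hsame : ∀ b < j, ∀ s', F[b]? = some s' → s'.proc = some (.node i l) → D b := by
        intro b hb s' hs' hp
        have h1 := depth_le_of_edge (.inl (hF.handlerEdge hb hs' hs hp))
        rcases s' with i' | ⟨p', T', h', a'⟩
        · cases hp
        · cases hp
          have := (hpar _ _ hs').2 ⟨_, _, _, _, _, rfl⟩
          exact ⟨by omega, _, _, _, _, hs'⟩
      have hprojE : proj (.node i l) E = [] := by
        refine List.eq_nil_iff_forall_not_mem.2 ?_
        rintro (i' | ⟨p', T', h', a'⟩) h1 <;> obtain ⟨h1, hp⟩ := mem_proj.1 h1 <;> cases hp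
        exact hav _ _ _ _ h1
      obtain ⟨k', h', rfl, ⟨q, m, hst⟩, ⟨p', m', hfr⟩, hsrc⟩ :=
        hE₀.recv_source (List.mem_append_right _ (List.mem_singleton.2 rfl))
      -- What is received at depth at most one was sent at depth zero, therefore by the client, and
      -- `hzero` finds it in `E`.
      have hsend : ∀ b s' src k, F[b]? = some s' → s'.Sends T src k → b < j →
          (∃ b' ≤ j, MsgEdge F b b' ∧ stepDepth F b' ≤ 1) → s' ∈ E := by
        rintro b s' src k hs' hss hbj ⟨b', -, h2, h3⟩
        have h4 := h2.depth
        refine hzero b s' hs' ?_ (by omega)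
        rcases hF.kind (List.mem_of_getElem? hs') with ⟨a', rfl⟩ | ⟨ν, k₂, src₂, a', rfl⟩
        · exact ⟨_, _, _, _, rfl⟩
        · have := (hpar _ _ hs').2 ⟨_, _, _, _, _, rfl⟩
          omega
      have hrecvdep : ∀ src k, (Step.act (.node i l) T (k' :: h') a).Receives T src k →
          ∀ s' ∈ F.take j, s'.Sends T src k → s' ∈ E := by
        intro src k hr s' hs' hss
        obtain ⟨b, hbj, hb'⟩ := mem_take_iff.1 hs'
        exact hsend b s' src k hb' hss hbj
          ⟨j, le_rfl, ⟨hbj, _, _, _, _, _, hb', hs, hss, hr⟩, hd1.le⟩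
      have hfrE : Step.act p' T h' (.send k' (.toNode (.fresh i)) m') ∈ E := by
        have hmem : Step.act p' T h' (.send k' (.toNode (.fresh i)) m') ∈ F.take j := by
          rcases List.mem_append.1 hfr with h1 | h1
          · exact h1
          · rw [List.mem_singleton] at h1
            simp at h1
        obtain ⟨b, hbj, hb'⟩ := mem_take_iff.1 hmem
        have hst' : ∃ b' ≤ j, F[b']? = some (Step.act (.node i q) T (k' :: h') (.start m)) := by
          rcases List.mem_append.1 hst with h1 | h1
          · obtain ⟨b', h2, h3⟩ := mem_take_iff.1 h1
            exact ⟨b', h2.le, h3⟩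
          · rw [List.mem_singleton] at h1
            exact ⟨j, le_rfl, by rw [hs, h1]⟩
        obtain ⟨b', hb'j, hb''⟩ := hst'
        have hdb' : stepDepth F b' ≤ 1 := by
          rcases hb'j.lt_or_eq with h1 | rfl
          · have := depth_le_of_edge (E := F) (i := b') (j := j)
              (.inl ⟨h1, _, _, _, _, _, _, hb'', hs⟩)
            omega
          · exact hd1.le
        obtain ⟨b₂, s₂, h1, h2, h3, h4⟩ := hF.exec.exists_msgEdge hb'' (T := T) (.inl ⟨_, _, rfl⟩)
        obtain rfl := hF.exec.send_index hb' h2 ⟨_, _, _, rfl⟩ h3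
        exact hsend _ _ _ _ hb' ⟨_, _, _, rfl⟩ hbj ⟨b', hb'j, h4, hdb'⟩
      have hnew := ih.transfer_fix hE₀ (by rw [proj_append, hprojE, proj_select hsame]; rfl)
        (fun i' l' _ hcr => by
          rcases List.mem_append.1 hcr with h1 | h1
          · exact crashed_false hff _ h1
          · obtain ⟨b, -, ⟨-, l₂, T₂, h₂, a₂, h3⟩, h4⟩ := mem_select.1 h1
            rw [h4] at h3
            cases h3)
        (fun ha => by
          subst ha
          obtain ⟨C, C', hC, ht⟩ := isExec_snoc_iff.1 hE₀
          cases ht)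
        (fun src k hr s' hs' hss => List.mem_append_left _ (hrecvdep src k hr s' hs' hss))
        -- A receipt in `E` would take place on node `i`, which `E` does not use; a receipt among
        -- the appended steps would be an earlier receipt of the same message in `F`.
        (fun src k hr s' hs' hr' => by
          rcases List.mem_append.1 hs' with h1 | h1
          · obtain ⟨l₂, h₂, a₂, rfl⟩ := hE.recv_target hfrE h1 hr' (by
              rcases hsrc src k hr with h2 | ⟨p₂, m₂, h2⟩
              · exact .inl h2
              · rcases List.mem_append.1 h2 with h3 | h3
                · exact .inr ⟨_, _, hrecvdep src k hr _ h3 ⟨_, _, _, rfl⟩⟩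
                · rw [List.mem_singleton, Step.act.injEq] at h3
                  rw [receives_act, ← h3.2.2.2] at hr
                  simp at hr)
            exact hav _ _ _ _ h1
          · obtain ⟨b, hbj, -, h3⟩ := mem_select.1 h1
            have := hF.exec.recv_index h3 hs hr' hr
            omega)
      rwa [fixRet_eq_self] at hnew
      intro i' l' T' h₂ z op r he
      cases he
      -- `E` leaves the memory of node `i` untouched, and non-trivial primitives on `z` preceding
      -- this step in `F` happened before it, hence have depth one and are selected.
      have h1 : memOf (E ++ select F D j) i z = memOf (F.take j) i z := by
        unfold memOf
        rw [mops_append, mops_eq_nil (E := E) fun l T h op r hs => absurd hs (hav _ _ _ _),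
          List.nil_append, mops_select]
        intro b hb s' hs' hm
        obtain ⟨l₂, T₂, hid₂, op₂, r₂, rfl, hnt⟩ := stepMop_ne_none hm
        have hT₂ := hF.only _ (List.mem_of_getElem? hs')
        cases hT₂
        have h2 := depth_le_of_edge (.inr ⟨hb, _, _, _, _, _, _, _, _, _, _, _, hs', hs, hnt⟩)
        have := (hpar _ _ hs').2 ⟨_, _, _, _, _, rfl⟩
        exact ⟨by omega, _, _, _, _, hs'⟩
      rw [h1]
      exact hE₀.prim_ret.symm
  exact htriv (b + 1) (hall _) _ _ _ _ _ _
    (mem_select.2 ⟨b, by omega, ⟨hd, _, _, _, _, hb⟩, hb⟩)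

end PDTS

namespace PDTS

variable {n : ℕ} {Item : Type u} {Val : Type v} {I : Implementation.{u, v, w} n Item Val}

/-! ### Interleaving executions of different transactions -/

/-- Executions `F i` of single transactions `T i`, invoked by different clients, in which the response
has depth `R i ≤ 4` and the primitives of depth one are trivial. -/
structure Family {ι : Type} (F : ι → List (Step I)) (T : ι → Txn Item Val)
    (ops : ι → List (Op Item Val)) (R : ι → ℕ) : Prop where
  solo : ∀ i, Solo (F i) (T i) (T i).id (ops i)
  id_inj : ∀ i i', (T i).id = (T i').id → i = i'
  parity : ∀ i a s, (F i)[a]? = some s →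
    (s.IsClient → stepDepth (F i) a % 2 = 0) ∧ (s.IsNode → stepDepth (F i) a % 2 = 1)
  trivial : ∀ i a j l U h x op r, (F i)[a]? = some (.act (.node j l) U h (.prim x op r)) →
    stepDepth (F i) a = 1 → ¬ NonTrivial op
  even : ∀ i, R i % 2 = 0
  response : ∀ i, ∃ a, IsResponse (F i) (T i) a ∧ stepDepth (F i) a = R i
  le_four : ∀ i, R i ≤ 4

variable {ι : Type} {F : ι → List (Step I)} {T : ι → Txn Item Val}
  {ops : ι → List (Op Item Val)} {R : ι → ℕ}

/-- The steps at the given positions. -/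
def stepsOf (F : ι → List (Step I)) (Ω : List (ι × ℕ)) : List (Step I) :=
  Ω.filterMap fun q => (F q.1)[q.2]?

theorem mem_stepsOf {Ω : List (ι × ℕ)} {s : Step I} :
    s ∈ stepsOf F Ω ↔ ∃ i a, (i, a) ∈ Ω ∧ (F i)[a]? = some s := by
  simp [stepsOf]

theorem stepsOf_append (Ω Ω' : List (ι × ℕ)) :
    stepsOf F (Ω ++ Ω') = stepsOf F Ω ++ stepsOf F Ω' := List.filterMap_append

theorem stepsOf_singleton {i : ι} {a : ℕ} {s : Step I} (h : (F i)[a]? = some s) :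
    stepsOf F [(i, a)] = [s] := by
  simp [stepsOf, h]

/-- If `s` is a primitive, then it returns its value also after the steps `Ω`. -/
def Matches (F : ι → List (Step I)) (Ω : List (ι × ℕ)) (s : Step I) : Prop :=
  ∀ j l U h x op r, s = .act (.node j l) U h (.prim x op r) →
    (op (foldMem I j x (mops j x (stepsOf F Ω)))).2 = r

/-- Step `a` of `F i` is not in `Ω`, but all steps that it needs are. -/
def Enabled (F : ι → List (Step I)) (Ω : List (ι × ℕ)) (i : ι) (a : ℕ) (s : Step I) : Prop :=
  (F i)[a]? = some s ∧ (i, a) ∉ Ω ∧ ∀ b < a, ∀ s', (F i)[b]? = some s' →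
    (s'.proc = s.proc ∨ MsgEdge (F i) b a) → (i, b) ∈ Ω

/-- Interleavings in which every step finds the messages and memory contents that it needs. -/
inductive Valid (F : ι → List (Step I)) : List (ι × ℕ) → Prop
  | nil : Valid F []
  | snoc {Ω : List (ι × ℕ)} {i : ι} {a : ℕ} {s : Step I} :
      Valid F Ω → Enabled F Ω i a s → Matches F Ω s → Valid F (Ω ++ [(i, a)])

/-- Clients are numbered by transaction identifiers and node processes by `procCode`, which encodes
them, so different solo runs share no process. -/
theorem Family.proc_inj (hF : Family F T ops R) {i i' : ι} {s s' : Step I} (hs : s ∈ F i)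
    (hs' : s' ∈ F i') (hp : s.proc = s'.proc) : i = i' := by
  apply hF.id_inj
  rcases (hF.solo i).kind hs with ⟨a, rfl⟩ | ⟨ν, k, src, a, rfl⟩ <;>
    rcases (hF.solo i').kind hs' with ⟨a', rfl⟩ | ⟨ν', k', src', a', rfl⟩
  · simpa [Step.proc] using hp
  · cases hp
  · cases hp
  · simp only [Step.proc, Option.some.injEq, Proc.node.injEq] at hp
    exact (procCode_inj hp.2).1

theorem take_proj_eq {E : List (Step I)} {p : Proc n} {a₀ a : ℕ} (h : a₀ ≤ a)
    (hb : ∀ b s, a₀ ≤ b → b < a → E[b]? = some s → s.proc ≠ some p) :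
    proj p (E.take a) = proj p (E.take a₀) := by
  induction a, h using Nat.le_induction with
  | base => rfl
  | succ a ha ih =>
    rw [List.take_add_one, proj_append, ih fun b s h1 h2 => hb b s h1 (by omega)]
    rcases hs : E[a]? with _ | s
    · simp [proj]
    · simp [proj, hb a s ha (by omega) hs]

/-- Since every enabled step finds all earlier steps of its process in place, an interleaving
contains an initial segment of the history of each process. -/
theorem Family.exists_bound (hF : Family F T ops R) {Ω : List (ι × ℕ)} (hΩ : Valid F Ω) (i : ι)
    (p : Proc n) (hp : ∃ s ∈ F i, s.proc = some p) :
    ∃ a₀, proj p (stepsOf F Ω) = proj p ((F i).take a₀) ∧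
      ∀ b s, (F i)[b]? = some s → s.proc = some p → ((i, b) ∈ Ω ↔ b < a₀) := by
  induction hΩ with
  | nil => exact ⟨0, by simp [stepsOf, proj], by simp⟩
  | @snoc Ω i₁ a s _ he _ ih =>
    obtain ⟨a₀, h1, h2⟩ := ih
    obtain ⟨hs, hnot, hdep⟩ := he
    rw [stepsOf_append, stepsOf_singleton hs, proj_append, h1]
    by_cases hsp : s.proc = some p
    · obtain ⟨s₀, hs₀, hp₀⟩ := hp
      obtain rfl := hF.proc_inj (List.mem_of_getElem? hs) hs₀ (hsp.trans hp₀.symm)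
      have h3 : a₀ ≤ a := by
        by_contra! h
        exact hnot ((h2 a s hs hsp).2 h)
      have h4 : ∀ b s', (F i₁)[b]? = some s' → s'.proc = some p → b < a → b < a₀ :=
        fun b s' hs' hp' hb => (h2 b s' hs' hp').1 (hdep b hb s' hs' (.inl (hp'.trans hsp.symm)))
      refine ⟨a + 1, ?_, fun b s' hs' hp' => ?_⟩
      · rw [proj_take_succ hs, take_proj_eq h3]
        intro b s' hb hb' hs' hp'
        have := h4 b s' hs' hp' hb'
        omega
      · simp only [List.mem_append, List.mem_singleton, Prod.mk.injEq, true_and, h2 b s' hs' hp']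
        have := h4 b s' hs' hp'
        omega
    · refine ⟨a₀, by simp [proj, hsp], fun b s' hs' hp' => ?_⟩
      rw [List.mem_append, h2 b s' hs' hp', or_iff_left]
      intro h
      rw [List.mem_singleton, Prod.mk.injEq] at h
      obtain ⟨rfl, rfl⟩ := h
      rw [hs] at hs'
      cases hs'
      exact hsp hp'

/-- The process has seen exactly its history from `F i`, and its message has been sent and not yet
received. Only the value returned by a primitive can be affected by the other transactions. -/
theorem Family.exec_fix (hF : Family F T ops R) {Ω : List (ι × ℕ)} (hΩ : Valid F Ω)
    (hE : IsExec (stepsOf F Ω)) {i : ι} {a : ℕ} {s : Step I} (he : Enabled F Ω i a s) :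
    IsExec (stepsOf F Ω ++ [fixRet (memOf (stepsOf F Ω)) s]) := by
  obtain ⟨hs, hnot, hdep⟩ := he
  have hsF := List.mem_of_getElem? hs
  have htx := (hF.solo i).only s hsF
  rcases s with ν | ⟨p, T', h, act⟩
  · cases htx
  cases htx
  have hE₀ := (hF.solo i).exec.of_prefix (take_snoc_prefix hs)
  obtain ⟨a₀, h1, h2⟩ := hF.exists_bound hΩ i p ⟨_, hsF, rfl⟩
  have h3 : a₀ ≤ a := by
    by_contra! h
    exact hnot ((h2 a _ hs rfl).2 h)
  have hback : ∀ s' ∈ stepsOf F Ω, s'.txn = some (T i) → ∃ b, (i, b) ∈ Ω ∧ (F i)[b]? = some s' := by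
    intro s' hs' ht
    obtain ⟨i', b, hb, hb'⟩ := mem_stepsOf.1 hs'
    have := (hF.solo i').only _ (List.mem_of_getElem? hb')
    rw [ht, Option.some.injEq] at this
    obtain rfl := hF.id_inj _ _ (congrArg Txn.id this)
    exact ⟨b, hb, hb'⟩
  refine hE.transfer_fix hE₀ ?_ ?_ ?_ ?_ ?_
  · rw [h1, take_proj_eq h3]
    intro b s' hb hb' hs' hp'
    have := (h2 b s' hs' hp').1 (hdep b hb' s' hs' (.inl hp'))
    omega
  · intro ν l _ hcr
    obtain ⟨i', b, -, hb'⟩ := mem_stepsOf.1 hcr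
    have := (hF.solo i').only _ (List.mem_of_getElem? hb')
    cases this
  · rintro rfl T' ⟨p', h', hs'⟩ hid
    obtain ⟨i', b, hb, hb'⟩ := mem_stepsOf.1 hs'
    have hT' := (hF.solo i').only _ (List.mem_of_getElem? hb')
    cases hT'
    obtain rfl := hF.id_inj _ _ hid
    obtain ⟨rfl, rfl⟩ := (hF.solo i').exec.invoke_eq (List.mem_of_getElem? hb') hsF
    have hb₀ := (h2 b _ hb' rfl).1 hb
    obtain ⟨C, C', hC, ht⟩ := isExec_snoc_iff.1 hE₀
    have hinv : Invoked ((F i').take a) (T i') :=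
      ⟨_, _, mem_take_iff.2 ⟨b, by omega, hb'⟩⟩
    cases ht
    exact absurd ((hC.used_iff _).2 ⟨_, hinv, rfl⟩) ‹_›
  · intro src k hr s' hs' hss
    obtain ⟨b, hb, hb'⟩ := mem_take_iff.1 hs'
    exact mem_stepsOf.2 ⟨i, b, hdep b hb s' hb' (.inr ⟨hb, _, _, _, _, _, hb', hs, hss, hr⟩), hb'⟩
  · intro src k hr s' hs' hr'
    have ht : s'.txn = some (T i) := by
      obtain ⟨p', h', a', rfl⟩ := hr'.exists_act
      rfl
    obtain ⟨b, hb, hb'⟩ := hback s' hs' ht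
    have := (hF.solo i).exec.recv_index hb' hs hr' hr
    subst this
    exact hnot hb

theorem Family.exec (hF : Family F T ops R) {Ω : List (ι × ℕ)} (hΩ : Valid F Ω) :
    IsExec (stepsOf F Ω) := by
  induction hΩ with
  | nil => exact IsExec.nil
  | @snoc Ω i a s hΩ he hm ih =>
    have := hF.exec_fix hΩ ih he
    rw [fixRet_eq_self (mem := memOf (stepsOf F Ω)) fun j l U h x op r hs =>
      hm j l U h x op r hs] at this
    rwa [stepsOf_append, stepsOf_singleton he.1]

/-! ### Blocks of steps of the same depth -/

open Classical in
/-- The positions below `N` in `F i` that satisfy `D`. -/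
noncomputable def part (i : ι) (D : ℕ → Prop) (N : ℕ) : List (ι × ℕ) :=
  ((List.range N).filter fun a => D a).map fun a => (i, a)

theorem mem_part {i i' : ι} {D : ℕ → Prop} {N a : ℕ} :
    (i', a) ∈ part i D N ↔ i' = i ∧ a < N ∧ D a := by
  simp only [part, List.mem_map, List.mem_filter, List.mem_range, decide_eq_true_eq, Prod.mk.injEq]
  constructor
  · rintro ⟨b, h, rfl, rfl⟩; exact ⟨rfl, h⟩
  · rintro ⟨rfl, h⟩; exact ⟨a, h, rfl, rfl⟩

open Classical in
theorem part_succ (i : ι) (D : ℕ → Prop) (N : ℕ) :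
    part i D (N + 1) = part i D N ++ if D N then [(i, N)] else [] := by
  unfold part
  rw [List.range_succ, List.filter_append, List.map_append]
  congr 1
  by_cases h : D N <;> simp [h]

theorem stepsOf_part (i : ι) (D : ℕ → Prop) (N : ℕ) :
    stepsOf F (part i D N) = select (F i) D N := by
  unfold stepsOf part select
  rw [List.filterMap_map]
  rfl

/-- `hmem` is granted the validity of the interleaving built so far because
`Family.matches_afterCommit` finds the returned value by applying the guarantees to that very
execution. -/
theorem Valid.append_part {Ω : List (ι × ℕ)} (hΩ : Valid F Ω) {i : ι} {D : ℕ → Prop}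
    (hD : ∀ a, D a → ∃ s, (F i)[a]? = some s) (hfresh : ∀ a, D a → (i, a) ∉ Ω)
    (hdep : ∀ a s, D a → (F i)[a]? = some s → ∀ b < a, ∀ s', (F i)[b]? = some s' →
      (s'.proc = s.proc ∨ MsgEdge (F i) b a) → (i, b) ∈ Ω ∨ D b)
    (hmem : ∀ a s, D a → Valid F (Ω ++ part i D a) → Enabled F (Ω ++ part i D a) i a s →
      Matches F (Ω ++ part i D a) s) (N : ℕ) : Valid F (Ω ++ part i D N) := by
  induction N with
  | zero => simpa [part] using hΩ
  | succ N ih =>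
    rw [part_succ]
    split_ifs with h
    · obtain ⟨s, hs⟩ := hD N h
      rw [← List.append_assoc]
      suffices he : Enabled F (Ω ++ part i D N) i N s from ih.snoc he (hmem N s h ih he)
      refine ⟨hs, fun h1 => ?_, fun b hb s' hs' h1 => ?_⟩
      · rcases List.mem_append.1 h1 with h1 | h1
        · exact hfresh N h h1
        · have := (mem_part.1 h1).2.1
          omega
      · rcases hdep N s h hs b hb s' hs' h1 with h2 | h2
        · exact List.mem_append_left _ h2
        · exact List.mem_append_right _ (mem_part.2 ⟨rfl, hb, h2⟩)
    · simpa using ih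

/-- Position `a` of `F i` holds a step of depth `d ≤ R i`, on node `j` if `ν = some j`. -/
def Sel (F : ι → List (Step I)) (R : ι → ℕ) (i : ι) (d : ℕ) (ν : Option (Fin n)) (a : ℕ) : Prop :=
  (∃ s, (F i)[a]? = some s ∧ ∀ j ∈ ν, ∃ l, s.proc = some (.node j l)) ∧
    stepDepth (F i) a = d ∧ d ≤ R i

/-- All positions that satisfy `Sel F R i d ν`. -/
noncomputable def block (F : ι → List (Step I)) (R : ι → ℕ) (i : ι) (d : ℕ) (ν : Option (Fin n)) :
    List (ι × ℕ) :=
  part i (Sel F R i d ν) (F i).length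

theorem mem_block {i i' : ι} {d : ℕ} {ν : Option (Fin n)} {a : ℕ} :
    (i', a) ∈ block F R i d ν ↔ i' = i ∧ Sel F R i d ν a := by
  rw [block, mem_part]
  refine and_congr_right fun _ => and_iff_right_of_imp fun h => ?_
  obtain ⟨⟨s, hs, -⟩, -⟩ := h
  exact (List.getElem?_eq_some_iff.1 hs).1

theorem Family.exists_proc (hF : Family F T ops R) {i : ι} {a : ℕ} {s : Step I}
    (hs : (F i)[a]? = some s) : (s.IsClient ∧ s.proc = some (.client (T i).id)) ∨
      ∃ j l, s.IsNode ∧ s.proc = some (.node j l) := by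
  rcases (hF.solo i).kind (List.mem_of_getElem? hs) with ⟨a, rfl⟩ | ⟨ν, k, src, a, rfl⟩
  · exact .inl ⟨⟨_, _, _, _, rfl⟩, rfl⟩
  · exact .inr ⟨_, _, ⟨_, _, _, _, _, rfl⟩, rfl⟩

/-- A message needed by a step of depth `d` was sent at smaller depth, and an earlier step of the
same process has smaller depth or is selected itself. -/
theorem Valid.append_sel (hF : Family F T ops R) {Ω : List (ι × ℕ)} (hΩ : Valid F Ω) {i : ι} {d : ℕ}
    {ν : Option (Fin n)} (hfresh : ∀ a, Sel F R i d ν a → (i, a) ∉ Ω)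
    (hdep : d ≤ R i → ∀ a < (F i).length, stepDepth (F i) a < d → (i, a) ∈ Ω)
    (hmem : ∀ a s, Sel F R i d ν a → Valid F (Ω ++ part i (Sel F R i d ν) a) →
      Enabled F (Ω ++ part i (Sel F R i d ν) a) i a s →
      Matches F (Ω ++ part i (Sel F R i d ν) a) s)
    (N : ℕ) : Valid F (Ω ++ part i (Sel F R i d ν) N) := by
  refine hΩ.append_part (fun a h => ?_) hfresh (fun a s h hs b hb s' hs' h1 => ?_) hmem N
  · obtain ⟨⟨s, hs, -⟩, -⟩ := h
    exact ⟨s, hs⟩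
  · obtain ⟨⟨s₁, hs₁, h2⟩, h3, h4⟩ := h
    rw [hs] at hs₁
    cases hs₁
    have hlt := (List.getElem?_eq_some_iff.1 hs').1
    rcases h1 with h1 | h1
    · have := depth_le_of_edge (.inl ((hF.solo i).handlerEdge hb hs' hs h1))
      rcases Nat.lt_or_ge (stepDepth (F i) b) d with h5 | h5
      · exact .inl (hdep h4 b hlt h5)
      · exact .inr ⟨⟨s', hs', fun j hj => by rw [h1]; exact h2 j hj⟩, by omega, h4⟩
    · have := h1.depth
      exact .inl (hdep h4 b hlt (by omega))

/-! ### Memory contents in interleavings -/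

/-- Even depths belong to clients, and primitives of depth one are trivial, so only depth three can
change memory. -/
theorem Family.mops_eq_nil_of_depth (hF : Family F T ops R) {Ω : List (ι × ℕ)}
    (h : ∀ q ∈ Ω, stepDepth (F q.1) q.2 ≠ 3 ∧ stepDepth (F q.1) q.2 ≤ 4) (j : Fin n) (x : I.Obj) :
    mops j x (stepsOf F Ω) = [] := by
  refine mops_eq_nil fun l U hid op r hs => ?_
  obtain ⟨i, a, hq, ha⟩ := mem_stepsOf.1 hs
  have h1 := (hF.parity i a _ ha).2 ⟨_, _, _, _, _, rfl⟩
  have h2 := h _ hq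
  exact hF.trivial i a _ _ _ _ _ _ _ ha (by dsimp only at h2; omega)

theorem mops_eq_nil_of_node {Ω : List (ι × ℕ)} {j : Fin n} {x : I.Obj}
    (h : ∀ i a s l, (i, a) ∈ Ω → (F i)[a]? = some s → s.proc ≠ some (.node j l)) :
    mops j x (stepsOf F Ω) = [] := by
  refine mops_eq_nil fun l U hid op r hs => ?_
  obtain ⟨i, a, hq, ha⟩ := mem_stepsOf.1 hs
  exact absurd rfl (h i a _ _ hq ha)

/-- Any earlier non-trivial primitive on the same object would have depth one as well and be
trivial, so the initial contents are seen. -/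
theorem Family.ret_depth_one (hF : Family F T ops R) {i : ι} {a : ℕ} {j : Fin n} {l : ℕ}
    {U : Txn Item Val} {h : HId} {x : I.Obj} {op : I.OVal → I.OVal × I.Ret} {r : I.Ret}
    (hs : (F i)[a]? = some (.act (.node j l) U h (.prim x op r))) (hd : stepDepth (F i) a = 1) :
    (op (foldMem I j x [])).2 = r := by
  have h1 := ((hF.solo i).exec.of_prefix (take_snoc_prefix hs)).prim_ret
  rw [memOf, mops_eq_nil] at h1
  · exact h1.symm
  · intro l' U' h' op' r' hs' hnt
    obtain ⟨b, hb, hb'⟩ := mem_take_iff.1 hs'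
    have e1 := (hF.solo i).only _ (List.mem_of_getElem? hb')
    have e2 := (hF.solo i).only _ (List.mem_of_getElem? hs)
    cases e1; cases e2
    have h2 := depth_le_of_edge (.inr ⟨hb, _, _, _, _, _, _, _, _, _, _, _, hb', hs, hnt⟩)
    have h3 := (hF.parity i b _ hb').2 ⟨_, _, _, _, _, rfl⟩
    exact hF.trivial i b _ _ _ _ _ _ _ hb' (by omega) hnt

/-- Earlier non-trivial primitives on the object have odd depth at most three, and depth one is
trivial. So in the solo run the memory seen here is made by the selected steps on node `j` alone. -/
theorem Family.ret_depth_three (hF : Family F T ops R) {i : ι} {a : ℕ} {j : Fin n} {l : ℕ}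
    {U : Txn Item Val} {h : HId} {x : I.Obj} {op : I.OVal → I.OVal × I.Ret} {r : I.Ret}
    (hs : (F i)[a]? = some (.act (.node j l) U h (.prim x op r)))
    (hd : Sel F R i 3 (some j) a) :
    (op (foldMem I j x (mops j x (stepsOf F (part i (Sel F R i 3 (some j)) a))))).2 = r := by
  have h1 := ((hF.solo i).exec.of_prefix (take_snoc_prefix hs)).prim_ret
  rw [stepsOf_part, mops_select]
  · exact h1.symm
  · intro b hb s' hb' hm
    obtain ⟨l', U', h', op', r', rfl, hnt⟩ := stepMop_ne_none hm
    have e1 := (hF.solo i).only _ (List.mem_of_getElem? hb')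
    have e2 := (hF.solo i).only _ (List.mem_of_getElem? hs)
    cases e1; cases e2
    have h2 := depth_le_of_edge (.inr ⟨hb, _, _, _, _, _, _, _, _, _, _, _, hb', hs, hnt⟩)
    have h3 := (hF.parity i b _ hb').2 ⟨_, _, _, _, _, rfl⟩
    have h4 : stepDepth (F i) b ≠ 1 := fun h => hF.trivial i b _ _ _ _ _ _ _ hb' h hnt
    refine ⟨⟨_, hb', fun j' hj' => ?_⟩, ?_, hd.2.2⟩
    · cases hj'; exact ⟨_, rfl⟩
    · have := hd.2.1
      omega

/-! ### Phases -/

theorem mem_flatMap_block {S : List ι} {d : ℕ} {ν : Option (Fin n)} {i : ι} {a : ℕ} :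
    (i, a) ∈ S.flatMap (fun i => block F R i d ν) ↔ i ∈ S ∧ Sel F R i d ν a := by
  simp only [List.mem_flatMap, mem_block]
  constructor
  · rintro ⟨i', h, rfl, h'⟩; exact ⟨h, h'⟩
  · rintro ⟨h, h'⟩; exact ⟨i, h, rfl, h'⟩

/-- Outside depth three the transactions can move one after the other: primitives occur only at
depth one, where everyone still sees the initial memory. -/
theorem Family.append_phase (hF : Family F T ops R) {S : List ι} (hS : S.Nodup) {d : ℕ} (hd : d ≠ 3)
    {Ω : List (ι × ℕ)} (hΩ : Valid F Ω) (hfresh : ∀ i ∈ S, ∀ a, Sel F R i d none a → (i, a) ∉ Ω)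
    (hdep : ∀ i ∈ S, d ≤ R i → ∀ a < (F i).length, stepDepth (F i) a < d → (i, a) ∈ Ω)
    (hlow : d = 1 → ∀ q ∈ Ω, stepDepth (F q.1) q.2 ≠ 3 ∧ stepDepth (F q.1) q.2 ≤ 4) :
    Valid F (Ω ++ S.flatMap fun i => block F R i d none) := by
  induction S generalizing Ω with
  | nil => simpa using hΩ
  | cons i S ih =>
    rw [List.flatMap_cons, ← List.append_assoc]
    rw [List.nodup_cons] at hS
    refine ih hS.2 ?_ ?_ ?_ ?_
    · refine hΩ.append_sel hF (hfresh i List.mem_cons_self) (hdep i List.mem_cons_self) ?_ _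
      rintro a s ha - ⟨hs, -⟩ j l U h x op r rfl
      have h1 := (hF.parity i a _ hs).2 ⟨_, _, _, _, _, rfl⟩
      have h2 := hF.le_four i
      obtain ⟨-, h3, h4⟩ := ha
      obtain rfl : d = 1 := by omega
      rw [hF.mops_eq_nil_of_depth]
      · exact hF.ret_depth_one hs h3
      · intro q hq
        rcases List.mem_append.1 hq with hq | hq
        · exact hlow rfl q hq
        · obtain ⟨h5, -, -, h6, -⟩ := mem_part.1 hq
          rw [h5, h6]
          omega
    · intro i' hi' a ha h1
      rcases List.mem_append.1 h1 with h1 | h1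
      · exact hfresh i' (List.mem_cons_of_mem _ hi') a ha h1
      · rw [(mem_block.1 h1).1] at hi'
        exact hS.1 hi'
    · intro i' hi' hR a ha hda
      exact List.mem_append_left _ (hdep i' (List.mem_cons_of_mem _ hi') hR a ha hda)
    · intro h1 q hq
      rcases List.mem_append.1 hq with hq | hq
      · exact hlow h1 q hq
      · obtain ⟨h5, -, h6, h7⟩ := mem_block.1 hq
        have := hF.le_four i
        rw [h5, h6]
        omega

/-- The steps of depth at most two. -/
noncomputable def lowPhases (F : ι → List (Step I)) (R : ι → ℕ) (S : List ι) : List (ι × ℕ) :=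
  S.flatMap (fun i => block F R i 0 none) ++ S.flatMap (fun i => block F R i 1 none) ++
    S.flatMap (fun i => block F R i 2 none)

theorem mem_lowPhases {S : List ι} {i : ι} {a : ℕ} : (i, a) ∈ lowPhases F R S ↔
    i ∈ S ∧ a < (F i).length ∧ stepDepth (F i) a ≤ 2 ∧ stepDepth (F i) a ≤ R i := by
  simp only [lowPhases, List.mem_append, mem_flatMap_block, Sel]
  constructor
  · rintro ((⟨h, ⟨s, hs, -⟩, h2, h3⟩ | ⟨h, ⟨s, hs, -⟩, h2, h3⟩) | ⟨h, ⟨s, hs, -⟩, h2, h3⟩) <;>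
      exact ⟨h, (List.getElem?_eq_some_iff.1 hs).1, by omega, by omega⟩
  · rintro ⟨h, h1, h2, h3⟩
    have h4 : ∃ s, (F i)[a]? = some s ∧ ∀ j ∈ (none : Option (Fin n)), ∃ l,
        s.proc = some (.node j l) := ⟨_, List.getElem?_eq_getElem h1, by simp⟩
    generalize stepDepth (F i) a = d at h2 h3
    interval_cases d
    · exact .inl (.inl ⟨h, h4, rfl, h3⟩)
    · exact .inl (.inr ⟨h, h4, rfl, h3⟩)
    · exact .inr ⟨h, h4, rfl, h3⟩

theorem Family.valid_lowPhases (hF : Family F T ops R) {S : List ι} (hS : S.Nodup) :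
    Valid F (lowPhases F R S) := by
  have hsel : ∀ i a d, stepDepth (F i) a = d → a < (F i).length → d ≤ R i →
      Sel F R i d none a := fun i a d h1 h2 h3 =>
    ⟨⟨_, List.getElem?_eq_getElem h2, by simp⟩, h1, h3⟩
  have h0 : Valid F (S.flatMap fun i => block F R i 0 none) := by
    have := hF.append_phase hS (d := 0) (by omega) Valid.nil (by simp) (by simp) (by simp)
    simpa using this
  have h1 := hF.append_phase hS (d := 1) (by omega) h0
    (fun i _ a ha h => by
      have := (mem_flatMap_block.1 h).2.2.1
      have := ha.2.1
      omega)
    (fun i hi hR a ha hd => mem_flatMap_block.2 ⟨hi, hsel i a 0 (by omega) ha (by omega)⟩)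
    (fun _ q hq => by
      have := (mem_flatMap_block.1 hq).2.2.1
      omega)
  refine hF.append_phase hS (d := 2) (by omega) h1 (fun i _ a ha h => ?_)
    (fun i hi hR a ha hd => ?_) (by omega)
  · have h3 := ha.2.1
    rcases List.mem_append.1 h with h | h
    all_goals
      have := (mem_flatMap_block.1 h).2.2.1
      omega
  · rcases Nat.eq_zero_or_pos (stepDepth (F i) a) with h2 | h2
    · exact List.mem_append_left _ (mem_flatMap_block.2 ⟨hi, hsel i a 0 h2 ha (by omega)⟩)
    · exact List.mem_append_right _ (mem_flatMap_block.2 ⟨hi, hsel i a 1 (by omega) ha (by omega)⟩)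

/-- Append the steps of depth three, node by node. -/
theorem Family.append_node_blocks (hF : Family F T ops R) {bs : List (ι × Fin n)} (hbs : bs.Nodup)
    {Ω : List (ι × ℕ)} (hΩ : Valid F Ω)
    (hlow : ∀ q ∈ Ω, stepDepth (F q.1) q.2 ≠ 3 ∧ stepDepth (F q.1) q.2 ≤ 4)
    (hdep : ∀ q ∈ bs, 3 ≤ R q.1 → ∀ a < (F q.1).length, stepDepth (F q.1) a < 3 → (q.1, a) ∈ Ω)
    (hmem : ∀ pre i j post, bs = pre ++ (i, j) :: post → ∀ a l U h x op r,
      (F i)[a]? = some (.act (.node j l) U h (.prim x op r)) → Sel F R i 3 (some j) a →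
      (op (foldMem I j x (mops j x (stepsOf F (pre.flatMap fun q => block F R q.1 3 (some q.2))) ++
        mops j x (stepsOf F (part i (Sel F R i 3 (some j)) a))))).2 = r) :
    Valid F (Ω ++ bs.flatMap fun q => block F R q.1 3 (some q.2)) := by
  induction bs using List.reverseRecOn with
  | nil => simpa using hΩ
  | append_singleton bs q ih =>
    obtain ⟨i, j⟩ := q
    rw [List.flatMap_append, ← List.append_assoc, List.flatMap_singleton]
    have hnd := List.nodup_append.1 hbs
    have ih := ih hnd.1 (fun q hq => hdep q (List.mem_append_left _ hq))
      (fun pre i' j' post h => hmem pre i' j' (post ++ [(i, j)]) (by rw [h]; simp))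
    refine ih.append_sel hF (fun a ha h1 => ?_) (fun hR a ha hd => ?_) ?_ _
    · rcases List.mem_append.1 h1 with h1 | h1
      · exact (hlow _ h1).1 ha.2.1
      · obtain ⟨⟨i', j'⟩, h2, h3⟩ := List.mem_flatMap.1 h1
        obtain ⟨h4, h5⟩ := mem_block.1 h3
        dsimp only at h4 h5
        subst h4
        obtain ⟨⟨s, hs, hn⟩, -⟩ := ha
        obtain ⟨⟨s', hs', hn'⟩, -⟩ := h5
        rw [hs] at hs'
        cases hs'
        obtain ⟨l, h6⟩ := hn j rfl
        obtain ⟨l', h7⟩ := hn' j' rfl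
        rw [h6] at h7
        cases h7
        exact hnd.2.2 _ h2 _ (List.mem_singleton.2 rfl) rfl
    · exact List.mem_append_left _ (hdep (i, j) (by simp) hR a ha hd)
    · rintro a s ha - ⟨hs, -⟩ j' l U h x op r rfl
      obtain rfl : j' = j := by
        obtain ⟨⟨s, hs', hn⟩, -⟩ := ha
        rw [hs] at hs'
        cases hs'
        obtain ⟨l, h6⟩ := hn j rfl
        cases h6
        rfl
      rw [stepsOf_append, stepsOf_append, mops_append, mops_append, hF.mops_eq_nil_of_depth hlow,
        List.nil_append]
      exact hmem bs i j' [] rfl a l U h x op r hs ha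

end PDTS

namespace PDTS

variable {n : ℕ} {Item : Type u} {Val : Type v} {I : Implementation.{u, v, w} n Item Val}

/-! ### Decided transactions in interleavings -/

/-- If one interval ended before the other transaction was invoked, then that end lies before the
end of `B`, where the former is undecided, or after it, where the latter is already invoked. -/
theorem concurrent_of_prefix {B E : List (Step I)} (h : B <+: E) {T T' : Txn Item Val} (hne : T ≠ T')
    (hT : Invoked B T) (hT' : Invoked B T') (hd : ¬ Decided B T) (hd' : ¬ Decided B T') :
    Concurrent E T T' := by
  have key : ∀ T T', Invoked B T' → ¬ Decided B T → ¬ Precedes E T T' := by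
    rintro T T' hT' hd ⟨P, hP, hov, hn⟩
    rcases List.prefix_or_prefix_of_prefix hP h with h1 | h1
    · exact hd (hov.1.mono h1)
    · exact hn (hT'.mono h1)
  exact ⟨hne, hT.mono h, hT'.mono h, key _ _ hT' hd, key _ _ hT hd'⟩

section

variable {ι : Type} {F : ι → List (Step I)} {T : ι → Txn Item Val}
  {ops : ι → List (Op Item Val)} {R : ι → ℕ}

theorem Family.txn_inj (hF : Family F T ops R) {i i' : ι} (h : T i = T i') : i = i' :=
  hF.id_inj _ _ (congrArg Txn.id h)

theorem Family.of_mem_stepsOf (hF : Family F T ops R) {Ω : List (ι × ℕ)} {s : Step I}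
    (hs : s ∈ stepsOf F Ω) {i : ι} (ht : s.txn = some (T i)) :
    ∃ a, (i, a) ∈ Ω ∧ (F i)[a]? = some s := by
  obtain ⟨i', b, hb, hb'⟩ := mem_stepsOf.1 hs
  have := (hF.solo i').only _ (List.mem_of_getElem? hb')
  rw [ht, Option.some.injEq] at this
  obtain rfl := hF.txn_inj this
  exact ⟨b, hb, hb'⟩

theorem Family.failureFree (hF : Family F T ops R) (Ω : List (ι × ℕ)) :
    FailureFree (stepsOf F Ω) := by
  rw [failureFree_iff]
  intro s hs
  obtain ⟨i, b, -, hb⟩ := mem_stepsOf.1 hs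
  have := (hF.solo i).only _ (List.mem_of_getElem? hb)
  rcases s with _ | _
  · cases this
  · rfl

theorem Family.response_depth (hF : Family F T ops R) {i : ι} {a : ℕ}
    (h : IsResponse (F i) (T i) a) : stepDepth (F i) a = R i := by
  obtain ⟨a', h1, h2⟩ := hF.response i
  rw [(hF.solo i).exec.respond_index h h1, h2]

theorem Family.of_decided (hF : Family F T ops R) {Ω : List (ι × ℕ)} {i : ι}
    (h : Decided (stepsOf F Ω) (T i)) : ∃ a, (i, a) ∈ Ω ∧ stepDepth (F i) a = R i := by
  obtain ⟨o, ops', p, hid, hs⟩ := h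
  obtain ⟨a, ha, ha'⟩ := hF.of_mem_stepsOf hs rfl
  exact ⟨a, ha, hF.response_depth ⟨_, _, _, _, ha'⟩⟩

theorem Family.returns (hF : Family F T ops R) {Ω : List (ι × ℕ)} {i : ι}
    (h : ∀ a < (F i).length, stepDepth (F i) a = R i → (i, a) ∈ Ω) :
    Returns (stepsOf F Ω) (T i) .commit (ops i) := by
  obtain ⟨p, hid, hs⟩ := (hF.solo i).returns
  obtain ⟨a, ha⟩ := List.mem_iff_getElem?.1 hs
  exact ⟨p, hid, mem_stepsOf.2 ⟨i, a, h a (List.getElem?_eq_some_iff.1 ha).1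
    (hF.response_depth ⟨_, _, _, _, ha⟩), ha⟩⟩

theorem stepDepth_zero (E : List (Step I)) : stepDepth E 0 = 0 := by
  rcases depth_eq_zero_or E 0 with h | ⟨i, hi, -⟩
  · exact h
  · omega

theorem Family.length_pos (hF : Family F T ops R) (i : ι) : 0 < (F i).length := by
  obtain ⟨p, hid, hs⟩ := (hF.solo i).returns
  exact List.length_pos_of_mem hs

/-! ### Two transactions, one of which commits first -/

/-- All steps of `F k` of depth at most three, after those of `F i` of depth at most two. -/
noncomputable def beforeCommit (F : ι → List (Step I)) (R : ι → ℕ) (i k : ι) : List (ι × ℕ) :=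
  lowPhases F R [i, k] ++
    ((List.finRange n).map fun j => (k, j)).flatMap fun q => block F R q.1 3 (some q.2)

theorem mem_beforeCommit (hF : Family F T ops R) {i k i' : ι} {a : ℕ} :
    (i', a) ∈ beforeCommit F R i k ↔ (i', a) ∈ lowPhases F R [i, k] ∨
      (i' = k ∧ a < (F k).length ∧ stepDepth (F k) a = 3 ∧ 3 ≤ R k) := by
  rw [beforeCommit, List.mem_append]
  refine or_congr_right ?_
  simp only [List.mem_flatMap, List.mem_map, List.mem_finRange, true_and]
  constructor
  · rintro ⟨-, ⟨j, rfl⟩, h⟩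
    obtain ⟨rfl, ⟨s, hs, -⟩, h1, h2⟩ := mem_block.1 h
    exact ⟨rfl, (List.getElem?_eq_some_iff.1 hs).1, h1, h2⟩
  · rintro ⟨rfl, h1, h2, h3⟩
    have hs := List.getElem?_eq_getElem h1
    rcases hF.exists_proc hs with ⟨h4, -⟩ | ⟨j, l, -, h4⟩
    · have := (hF.parity i' a _ hs).1 h4
      omega
    · refine ⟨_, ⟨j, rfl⟩, mem_block.2 ⟨rfl, ⟨_, hs, fun j' hj' => ?_⟩, h2, h3⟩⟩
      cases hj'
      exact ⟨l, h4⟩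

/-- The steps of `F k` until it commits, after those of `F i` of depth at most two. -/
noncomputable def afterCommit (F : ι → List (Step I)) (R : ι → ℕ) (i k : ι) : List (ι × ℕ) :=
  beforeCommit F R i k ++ [k].flatMap fun k => block F R k 4 none

variable {i k : ι}

theorem Family.valid_beforeCommit (hF : Family F T ops R) (hik : i ≠ k) :
    Valid F (beforeCommit F R i k) := by
  refine hF.append_node_blocks ?_ (hF.valid_lowPhases (by simpa using hik)) ?_ ?_ ?_
  · exact (List.nodup_finRange n).map fun j j' h => (Prod.mk.inj h).2
  · intro q hq
    obtain ⟨-, -, h, -⟩ := mem_lowPhases.1 hq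
    omega
  · intro q hq hR a ha hd
    obtain ⟨j, -, rfl⟩ := List.mem_map.1 hq
    exact mem_lowPhases.2 ⟨by simp, ha, by omega, by dsimp only at *; omega⟩
  · intro pre i' j post hpre a l U h x op r hs ha
    -- Only `k` is active at depth three, and its earlier blocks are on other nodes.
    rw [mops_eq_nil_of_node, List.nil_append]
    · exact hF.ret_depth_three hs ha
    · intro i'' b s l' hb hs' hp
      obtain ⟨⟨k', j'⟩, h1, h2⟩ := List.mem_flatMap.1 hb
      obtain ⟨h3, ⟨⟨s₂, hs₂, hn⟩, -⟩⟩ := mem_block.1 h2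
      dsimp only at h3 hn hs₂
      rw [← h3, hs'] at hs₂
      cases hs₂
      obtain ⟨l₂, hl₂⟩ := hn j' rfl
      rw [hp] at hl₂
      cases hl₂
      have hnd : ((List.finRange n).map fun j => (k, j)).Nodup :=
        (List.nodup_finRange n).map fun j j' h => (Prod.mk.inj h).2
      have hk : ∀ q ∈ (List.finRange n).map fun j => (k, j), q.1 = k := by
        simp only [List.mem_map, List.mem_finRange, true_and]
        rintro q ⟨j, rfl⟩
        rfl
      have e1 := hk (k', j) (by rw [hpre]; exact List.mem_append_left _ h1)
      have e2 := hk (i', j) (by rw [hpre]; simp)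
      dsimp only at e1 e2
      rw [hpre, e2, List.nodup_append] at hnd
      rw [e1] at h1
      exact hnd.2.2 _ h1 _ List.mem_cons_self rfl

theorem Family.valid_afterCommit (hF : Family F T ops R) (hik : i ≠ k) :
    Valid F (afterCommit F R i k) := by
  refine hF.append_phase (by simp) (by omega) (hF.valid_beforeCommit hik) ?_ ?_ (by omega)
  · intro i' _ a ha h
    have h1 := ha.2.1
    rcases (mem_beforeCommit hF).1 h with h2 | ⟨rfl, -, h2, -⟩
    · have := (mem_lowPhases.1 h2).2.2.1
      omega
    · omega
  · intro i' hi' hR a ha hd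
    obtain rfl := List.mem_singleton.1 hi'
    refine (mem_beforeCommit hF).2 ?_
    rcases Nat.lt_or_ge (stepDepth (F i') a) 3 with h | h
    · exact .inl (mem_lowPhases.2 ⟨by simp, ha, by omega, by omega⟩)
    · exact .inr ⟨rfl, ha, by omega, by omega⟩

theorem Family.depth_of_mem_afterCommit (hF : Family F T ops R) (hik : i ≠ k) {a : ℕ}
    (h : (i, a) ∈ afterCommit F R i k) : stepDepth (F i) a ≤ 2 := by
  rcases List.mem_append.1 h with h | h
  · rcases (mem_beforeCommit hF).1 h with h | h
    · exact (mem_lowPhases.1 h).2.2.1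
    · exact absurd h.1 hik
  · exact absurd (List.mem_singleton.1 (mem_flatMap_block.1 h).1) hik

theorem Family.invoked_beforeCommit (hF : Family F T ops R) (hik : i ≠ k) {i' : ι}
    (hi' : i' ∈ [i, k]) : Invoked (stepsOf F (beforeCommit F R i k)) (T i') := by
  have h0 := hF.length_pos i'
  have hs := List.getElem?_eq_getElem h0
  have hmem : (F i')[0] ∈ stepsOf F (beforeCommit F R i k) :=
    mem_stepsOf.2 ⟨i', 0, (mem_beforeCommit hF).2 (.inl (mem_lowPhases.2
      ⟨hi', h0, by rw [stepDepth_zero]; omega, by rw [stepDepth_zero]; omega⟩)), hs⟩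
  have ht := (hF.solo i').only _ (List.getElem_mem h0)
  generalize (F i')[0] = s at hmem ht
  rcases s with _ | _
  · cases ht
  · cases ht
    exact (hF.exec (hF.valid_beforeCommit hik)).invoked hmem

theorem Family.not_decided_beforeCommit (hF : Family F T ops R) (hik : i ≠ k) (hRi : R i = 4)
    (hRk : R k = 4) {i' : ι} (hi' : i' ∈ [i, k]) :
    ¬ Decided (stepsOf F (beforeCommit F R i k)) (T i') := by
  intro h
  obtain ⟨a, h1, h2⟩ := hF.of_decided h
  have hR : R i' = 4 := by
    simp only [List.mem_cons, List.not_mem_nil, or_false] at hi'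
    rcases hi' with rfl | rfl <;> assumption
  rcases (mem_beforeCommit hF).1 h1 with h3 | ⟨rfl, -, h3, -⟩
  · have := (mem_lowPhases.1 h3).2.2.1
    omega
  · omega

theorem Family.returns_afterCommit (hF : Family F T ops R) (hRk : R k = 4) :
    Returns (stepsOf F (afterCommit F R i k)) (T k) .commit (ops k) := by
  refine hF.returns fun a ha hd => ?_
  refine List.mem_append_right _ (mem_flatMap_block.2 ⟨by simp, ⟨_,
    List.getElem?_eq_getElem ha, by simp⟩, by omega, by omega⟩)

theorem mops_filter_append_nil {Ω Ω' : List (ι × ℕ)} {j : Fin n} {x : I.Obj} {p : Step I → Bool}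
    (h : ∀ l U hid op r, Step.act (.node j l) U hid (.prim x op r) ∈ stepsOf F Ω →
      p (.act (.node j l) U hid (.prim x op r)) = true → ¬ NonTrivial op)
    (h' : ∀ s ∈ stepsOf F Ω', p s = true) :
    mops j x ((stepsOf F (Ω ++ Ω')).filter p) = mops j x (stepsOf F Ω') := by
  rw [stepsOf_append, List.filter_append, mops_append, mops_eq_nil, List.nil_append,
    List.filter_eq_self.2 h']
  intro l U hid op r hs
  rw [List.mem_filter] at hs
  exact h _ _ _ _ _ hs.1 hs.2

end

end PDTS

namespace PDTS

variable {n : ℕ} {Item : Type u} {Val : Type v} {I : Implementation.{u, v, w} n Item Val}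

/-! ### What transactions notice of each other -/

variable {ι : Type} {F : ι → List (Step I)} {T : ι → Txn Item Val}
  {ops : ι → List (Op Item Val)} {R : ι → ℕ} {f : ℕ} {init : Item → Val} {Δ : ℝ} {i k : ι}

/-- If `T` and `T'` with disjoint data sets are both invoked but not both decided in an execution, then
they do not interfere in it. -/
theorem Guarantees.trivial_of_disjoint (hI : Guarantees I f init Δ) {E : List (Step I)}
    (hE : IsExec E) (hff : FailureFree E) {T T' : Txn Item Val} (hT : Invoked E T) {o' : Outcome}
    {ops' : List (Op Item Val)} (hT' : Returns E T' o' ops') (hne : T ≠ T')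
    (hdis : ∀ ops, T.prog.PartialRun ops → Disjoint (dataSet ops) (dataSet ops'))
    (hconc : ∀ E', E <+: E' → IsExec E' → FailureFree E' → Concurrent E' T T')
    {j : Fin n} {x : I.Obj} {l l' : ℕ} {h h' : HId} {op op' : I.OVal → I.OVal × I.Ret} {r r' : I.Ret}
    (hs : Step.act (.node j l) T h (.prim x op r) ∈ E)
    (hs' : Step.act (.node j l') T' h' (.prim x op' r') ∈ E) : ¬ NonTrivial op' := by
  intro hnt
  -- Disjoint-access parallelism speaks of decided transactions, so the execution is first continued
  -- until `T` is decided, no matter with which outcome.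
  obtain ⟨E', h1, h2, h3, o, ops, h4⟩ := exists_decided hI.progress hE hff hT
  have h5 : Returns E' T' o' ops' := by
    obtain ⟨p, hid, h5⟩ := hT'
    exact ⟨p, hid, h1.subset h5⟩
  exact hI.disjoint E' h2 T T' o ops o' ops' hne h4 h5 (hdis _ (hI.programs E' T o ops h2 h4).1)
    ⟨hconc E' h1 h2 h3, j, x, l, h, op, r, l', h', op', r', h1.subset hs, h1.subset hs', .inr hnt⟩

open Classical in
/-- After `T k` has committed, `T i` notices nothing of it if its data set is disjoint from the write
set of `T k`: reads are invisible. -/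
theorem Family.matches_afterCommit (hF : Family F T ops R) (hI : Guarantees I f init Δ)
    (hik : i ≠ k) (hRi : R i = 4) (hRk : R k = 4)
    (hdis : ∀ ops', (T i).prog.PartialRun ops' →
      Disjoint (dataSet ops') (dataSet ((ops k).filter Op.isWrite)))
    {j : Fin n} {a : ℕ} {s : Step I} (ha : Sel F R i 3 (some j) a)
    (hv : Valid F (afterCommit F R i k ++ part i (Sel F R i 3 (some j)) a))
    (he : Enabled F (afterCommit F R i k ++ part i (Sel F R i 3 (some j)) a) i a s) :
    Matches F (afterCommit F R i k ++ part i (Sel F R i 3 (some j)) a) s := by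
  have hs := he.1
  rintro j' l U h x op r rfl
  obtain rfl : j' = j := by
    obtain ⟨⟨s, hs', hn⟩, -⟩ := ha
    rw [hs] at hs'
    cases hs'
    obtain ⟨l, h6⟩ := hn j rfl
    cases h6
    rfl
  have hU := (hF.solo i).only _ (List.mem_of_getElem? hs)
  cases hU
  -- The next step of `T i` is taken with whatever value the primitive returns; the rest of the
  -- proof identifies this value with `r`.
  have hEx := hF.exec_fix hv (hF.exec hv) he
  set Ω := afterCommit F R i k ++ part i (Sel F R i 3 (some j')) a with hΩ
  set u := part i (Sel F R i 3 (some j')) a with hu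
  set E := stepsOf F Ω with hE
  set s' : Step I := fixRet (memOf E) (.act (.node j' l) (T i) h (.prim x op r)) with hs'
  have hs'eq : s' = .act (.node j' l) (T i) h (.prim x op (op (memOf E j' x)).2) := rfl
  have hTik : T i ≠ T k := fun h => hik (hF.txn_inj h)
  have hBE : stepsOf F (beforeCommit F R i k) <+: E := by
    rw [hE, hΩ, afterCommit, stepsOf_append, stepsOf_append, List.append_assoc]
    exact List.prefix_append _ _
  have hret : Returns (E ++ [s']) (T k) .commit (ops k) := by
    obtain ⟨p, hid, h1⟩ := hF.returns_afterCommit (i := i) hRk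
    refine ⟨p, hid, List.mem_append_left _ ?_⟩
    rw [hE, hΩ, stepsOf_append]
    exact List.mem_append_left _ h1
  -- The response of `T i` has depth four, while only steps of depth at most three have been taken.
  have hndi : ¬ Decided (E ++ [s']) (T i) := by
    rw [decided_snoc]
    rintro (h1 | ⟨p, h, o, ops, h1⟩)
    · obtain ⟨b, hb, hb'⟩ := hF.of_decided h1
      rcases List.mem_append.1 hb with hb | hb
      · have := hF.depth_of_mem_afterCommit hik hb
        omega
      · have := (mem_part.1 hb).2.2.2.1
        omega
    · rw [hs'eq] at h1
      cases h1
  obtain ⟨E₂, T', hE₂, ⟨A, M, M', B, hEq, hE₂eq, hAB, hMh, hMl, hMh', hMl', hfilt⟩, hret'⟩ :=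
    hI.invisible.2 _ hEx _ _ hret
  -- the last step belongs to `B`
  obtain ⟨B₀, rfl⟩ : ∃ B₀, B = B₀ ++ [s'] := by
    rcases List.eq_nil_or_concat B with rfl | ⟨B₀, b, rfl⟩
    · exfalso
      rcases List.eq_nil_or_concat M with rfl | ⟨M₀, m, rfl⟩
      · cases hMh
      · rw [List.append_nil, List.concat_eq_append, ← List.append_assoc] at hEq
        have h1 := List.append_inj_right' hEq rfl
        cases h1
        rw [List.concat_eq_append, List.getLast?_append] at hMl
        exact hTik (Option.some.inj hMl)
    · rw [List.concat_eq_append, ← List.append_assoc] at hEq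
      have h1 := List.append_inj_right' hEq rfl
      cases h1
      exact ⟨B₀, by simp⟩
  have hEeq : E = A ++ M ++ B₀ := by
    rw [← List.append_assoc] at hEq
    exact List.append_inj_left' hEq rfl
  rw [← List.append_assoc] at hE₂eq
  set E₁ := A ++ M' ++ B₀ with hE₁
  have hTT' : T i ≠ T' := fun h1 => (hAB s' (by simp)).2 (congrArg some h1)
  have hMM' : ∀ s, s.txn ≠ some (T k) → s.txn ≠ some T' → (s ∈ M ↔ s ∈ M') := by
    intro s h1 h2
    have h3 := List.mem_filter (p := fun s : Step I => s.txn ≠ some (T k)) (as := M) (x := s)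
    rw [hfilt, List.mem_filter] at h3
    simp only [h1, h2, ne_eq, not_false_eq_true, decide_true, and_true] at h3
    exact h3.symm
  have hmem : ∀ s, s.txn ≠ some (T k) → s.txn ≠ some T' → (s ∈ E ++ [s'] ↔ s ∈ E₂) := by
    intro s h1 h2
    rw [hEeq, hE₂eq, hE₁]
    simp only [List.mem_append, hMM' s h1 h2]
  have hff₂ : FailureFree E₂ := by
    rw [failureFree_iff]
    rintro (ν | _) h1
    · rw [← hmem _ (by simp [Step.txn]) (by simp [Step.txn])] at h1
      rcases List.mem_append.1 h1 with h1 | h1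
      · exact absurd h1 (crashed_false (hF.failureFree Ω) ν)
      · rw [hs'eq] at h1
        simp at h1
    · rfl
  -- `T i` was invoked before `T k` responded, and the steps of `T k` end with `M`; the replacement
  -- keeps the steps of `T i`.
  have hinv : Invoked (A ++ M') (T i) := by
    obtain ⟨p, hid, h1⟩ := hF.invoked_beforeCommit hik (i' := i) (by simp)
    have hAM : A ++ M <+: E := by rw [hEeq]; exact List.prefix_append _ _
    have h2 : Step.act p (T i) hid .invoke ∈ A ++ M := by
      rcases List.prefix_or_prefix_of_prefix hBE hAM with h2 | h2
      · exact h2.subset h1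
      · exfalso
        obtain ⟨p', hid', h3⟩ := hret
        rw [hEq, List.mem_append] at h3
        rcases h3 with h3 | h3
        · exact hF.not_decided_beforeCommit hik hRi hRk (i' := k) (by simp)
            ⟨_, _, _, _, h2.subset h3⟩
        · exact (hAB _ (List.mem_append_right _ h3)).1 rfl
    rcases List.mem_append.1 h2 with h2 | h2
    · exact ⟨p, hid, List.mem_append_left _ h2⟩
    · exact ⟨p, hid, List.mem_append_right _
        ((hMM' _ (by simpa [Step.txn] using hTik) (by simpa [Step.txn] using hTT')).1 h2)⟩
  have hs'E₂ : s' ∈ E₂ := by rw [hE₂eq]; simp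
  have hconc : ∀ E₃, E₂ <+: E₃ → IsExec E₃ → FailureFree E₃ → Concurrent E₃ (T i) T' := by
    intro E₃ h1 h2 h3
    refine ⟨hTT', (hE₂.invoked (hs'eq ▸ hs'E₂)).mono h1,
      (Decided.invoked hE₂ ⟨_, _, hret'⟩).mono h1, ?_, ?_⟩
    · rintro ⟨P, hP, hov, hn⟩
      rcases List.prefix_or_prefix_of_prefix hP h1 with h4 | h4
      · obtain ⟨o, ops', p, hid, h5⟩ := hov.1.mono h4
        exact hndi ⟨o, ops', p, hid, (hmem _ (by simpa [Step.txn] using hTik)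
          (by simpa [Step.txn] using hTT')).2 h5⟩
      · exact hn ((Decided.invoked hE₂ ⟨_, _, hret'⟩).mono h4)
    · rintro ⟨P, hP, hov, hn⟩
      -- The last step of `M'` belongs to `T'`, so its interval cannot be over earlier, and by the
      -- end of `M'` the transaction `T i` has been invoked.
      have hAM : A ++ M' <+: E₃ := by
        refine List.IsPrefix.trans ?_ h1
        rw [hE₂eq, hE₁, List.append_assoc]
        exact List.prefix_append _ _
      rcases List.prefix_or_prefix_of_prefix hP hAM with ⟨Q, h4⟩ | h4
      · rcases List.eq_nil_or_concat Q with rfl | ⟨Q₀, q, rfl⟩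
        · rw [List.append_nil] at h4
          exact hn (h4 ▸ hinv)
        · rcases List.eq_nil_or_concat M' with rfl | ⟨M₀, m, rfl⟩
          · cases hMh'
          · rw [List.concat_eq_append, List.concat_eq_append, ← List.append_assoc,
              ← List.append_assoc] at h4
            have h5 := List.append_inj_right' h4 rfl
            cases h5
            rw [List.concat_eq_append, List.getLast?_append] at hMl'
            rw [List.concat_eq_append, ← List.append_assoc, ← h4, List.append_assoc] at hAM
            exact no_step_after_over (h2.of_prefix hAM) (h3.of_prefix hAM) hov q (by simp) hMl'
      · exact hn (hinv.mono h4)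
  -- `T'` has a data set disjoint from that of `T i`, so its primitives on `x` are trivial. Without
  -- `T'` and `T k` the two executions agree, and `T i` has changed nothing before depth three.
  have hmops : mops j' x E₁ = mops j' x (stepsOf F u) := by
    have h1 : E₁.filter (fun s => s.txn ≠ some T') = E.filter fun s => s.txn ≠ some (T k) := by
      have hA1 : ∀ s ∈ A, s.txn ≠ some (T k) ∧ s.txn ≠ some T' := fun s hs => hAB s (by simp [hs])
      have hB1 : ∀ s ∈ B₀, s.txn ≠ some (T k) ∧ s.txn ≠ some T' := fun s hs => hAB s (by simp [hs])
      rw [hE₁, hEeq]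
      simp only [List.filter_append]
      rw [hfilt]
      congr 1
      · congr 1
        exact List.filter_congr fun s hs => by simp [hA1 s hs]
      · exact List.filter_congr fun s hs => by simp [hB1 s hs]
    have h2 : mops j' x E₁ = mops j' x (E₁.filter fun s => s.txn ≠ some T') := by
      unfold mops
      rw [List.filterMap_filter]
      refine List.filterMap_congr fun s hs => ?_
      by_cases h3 : s.txn = some T'
      · simp only [h3, ne_eq, not_true_eq_false, decide_false, Bool.false_eq_true, if_false]
        by_contra h4
        obtain ⟨l', U, hid, op', r', rfl, hnt⟩ := stepMop_ne_none h4
        cases h3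
        have hmem₂ : ∀ s ∈ E₁, s ∈ E₂ := fun s hs => by rw [hE₂eq]; exact List.mem_append_left _ hs
        exact hI.trivial_of_disjoint hE₂ hff₂ (hE₂.invoked (hs'eq ▸ hs'E₂)) hret' hTT' hdis hconc
          (hs'eq ▸ hs'E₂) (hmem₂ _ hs) hnt
      · simp [h3]
    rw [h2, h1, hE, hΩ]
    refine mops_filter_append_nil ?_ ?_
    · intro l' U hid op' r' h3 h4 hnt
      obtain ⟨i', b, hb, hb'⟩ := mem_stepsOf.1 h3
      have hU := (hF.solo i').only _ (List.mem_of_getElem? hb')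
      cases hU
      have hi' : i' = i := by
        rcases List.mem_append.1 hb with h5 | h5
        · rcases (mem_beforeCommit hF).1 h5 with h6 | h6
          · have := (mem_lowPhases.1 h6).1
            simp only [List.mem_cons, List.not_mem_nil, or_false] at this
            rcases this with h7 | rfl
            · exact h7
            · simp [Step.txn] at h4
          · rw [h6.1] at h4
            simp [Step.txn] at h4
        · have := List.mem_singleton.1 (mem_flatMap_block.1 h5).1
          rw [this] at h4
          simp [Step.txn] at h4
      subst hi'
      have h5 := hF.depth_of_mem_afterCommit hik hb
      have h6 := (hF.parity i' b _ hb').2 ⟨_, _, _, _, _, rfl⟩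
      exact hF.trivial i' b _ _ _ _ _ _ _ hb' (by omega) hnt
    · intro s hs
      obtain ⟨i', b, hb, hb'⟩ := mem_stepsOf.1 hs
      obtain ⟨rfl, -⟩ := mem_part.1 hb
      have hU := (hF.solo i').only _ (List.mem_of_getElem? hb')
      simp [hU, hTik]
  -- `s'` is the same step in both executions, with one recorded value, although the memory contents
  -- may differ.
  have h1 : (op (memOf E j' x)).2 = (op (memOf E₁ j' x)).2 := by
    rw [hE₂eq, hs'eq] at hE₂
    exact hE₂.prim_ret
  have h2 := hF.ret_depth_three hs ha
  unfold memOf at h1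
  rw [hmops] at h1
  exact h1.trans h2

theorem Family.valid_afterCommit_append (hF : Family F T ops R) (hI : Guarantees I f init Δ)
    (hik : i ≠ k) (hRi : R i = 4) (hRk : R k = 4)
    (hdis : ∀ ops', (T i).prog.PartialRun ops' →
      Disjoint (dataSet ops') (dataSet ((ops k).filter Op.isWrite))) (j : Fin n) (N : ℕ) :
    Valid F (afterCommit F R i k ++ part i (Sel F R i 3 (some j)) N) := by
  refine (hF.valid_afterCommit hik).append_sel hF (fun a ha h => ?_) (fun hR a ha hd => ?_)
    (fun a s ha hv he => hF.matches_afterCommit hI hik hRi hRk hdis ha hv he) N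
  · have := hF.depth_of_mem_afterCommit hik h
    have := ha.2.1
    omega
  · exact List.mem_append_left _ ((mem_beforeCommit hF).2 (.inl (mem_lowPhases.2
      ⟨by simp, ha, by omega, by omega⟩)))

/-! ### The effects of single blocks on the memory of a node -/

theorem block_eq_nil {d : ℕ} {ν : Option (Fin n)} (h : R k < d) : block F R k d ν = [] := by
  refine List.eq_nil_iff_forall_not_mem.2 ?_
  rintro ⟨i, a⟩ h1
  have := (mem_block.1 h1).2.2.2
  omega

theorem mops_flatMap {α : Type*} (g : α → List (ι × ℕ)) (l : List α) (j : Fin n) (x : I.Obj) :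
    mops j x (stepsOf F (l.flatMap g)) = l.flatMap fun q => mops j x (stepsOf F (g q)) := by
  induction l with
  | nil => rfl
  | cons a l ih => rw [List.flatMap_cons, stepsOf_append, mops_append, ih, List.flatMap_cons]

theorem flatMap_eq_of_nodup {α β : Type*} (g : α → List β) {l : List α} (hl : l.Nodup) {q₀ : α}
    (h : ∀ q ∈ l, q ≠ q₀ → g q = []) :
    (q₀ ∈ l → l.flatMap g = g q₀) ∧ (q₀ ∉ l → l.flatMap g = []) := by
  have h0 : ∀ l' ⊆ l, q₀ ∉ l' → l'.flatMap g = [] := fun l' hl' hq =>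
    List.flatMap_eq_nil_iff.2 fun q hq' => h q (hl' hq') fun he => hq (he ▸ hq')
  refine ⟨fun hq => ?_, h0 l (List.Subset.refl _)⟩
  obtain ⟨l₁, l₂, rfl⟩ := List.append_of_mem hq
  have hnd := List.nodup_append.1 hl
  rw [List.flatMap_append, List.flatMap_cons,
    h0 l₁ (fun q hq => List.mem_append_left _ hq) fun hq => hnd.2.2 _ hq _ List.mem_cons_self rfl,
    h0 l₂ (fun q hq => List.mem_append_right _ (List.mem_cons_of_mem _ hq))
      (List.nodup_cons.1 hnd.2.1).1, List.nil_append, List.append_nil]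

theorem mops_block_of_ne {d : ℕ} {j j' : Fin n} (h : j' ≠ j) (x : I.Obj) :
    mops j x (stepsOf F (block F R i d (some j'))) = [] := by
  refine mops_eq_nil_of_node fun i' b s l hb hs hp => ?_
  obtain ⟨rfl, ⟨s', hs', hn⟩, -⟩ := mem_block.1 hb
  rw [hs] at hs'
  cases hs'
  obtain ⟨l', hl'⟩ := hn j' rfl
  rw [hp] at hl'
  cases hl'
  exact h rfl

/-- Low depths and depth four change nothing, and blocks on other nodes do not concern node `j`. -/
theorem Family.mops_afterCommit (hF : Family F T ops R) (j : Fin n) (x : I.Obj)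
    (u : List (ι × ℕ)) : mops j x (stepsOf F (afterCommit F R i k ++ u)) =
      mops j x (stepsOf F (block F R k 3 (some j))) ++ mops j x (stepsOf F u) := by
  have hnd : ((List.finRange n).map fun j => (k, j)).Nodup :=
    (List.nodup_finRange n).map fun j j' h => (Prod.mk.inj h).2
  rw [afterCommit, beforeCommit, stepsOf_append, stepsOf_append, stepsOf_append, mops_append,
    mops_append, mops_append, hF.mops_eq_nil_of_depth (Ω := lowPhases F R [i, k]),
    hF.mops_eq_nil_of_depth (Ω := [k].flatMap _), mops_flatMap,
    (flatMap_eq_of_nodup _ hnd (q₀ := (k, j)) ?_).1 (by simp), List.nil_append, List.append_nil]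
  · rintro ⟨k', j'⟩ hq hne
    obtain ⟨j'', -, h⟩ := List.mem_map.1 hq
    cases h
    exact mops_block_of_ne (fun h => hne (congrArg (Prod.mk k) h)) x
  · intro q hq
    have := (mem_flatMap_block.1 hq).2.2.1
    omega
  · intro q hq
    have := (mem_lowPhases.1 hq).2.2.1
    omega

theorem Family.four_of_three_le (hF : Family F T ops R) (i : ι) (h : 3 ≤ R i) : R i = 4 := by
  have := hF.even i
  have := hF.le_four i
  omega

/-- The values that the primitives of `T i` of depth three return do not depend on whether `T k` has
taken its steps of depth three before, if `T k` writes nothing that `T i` accesses. -/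
theorem Family.ret_after (hF : Family F T ops R) (hI : Guarantees I f init Δ) (hik : i ≠ k)
    (hdis : ∀ ops', (T i).prog.PartialRun ops' →
      Disjoint (dataSet ops') (dataSet ((ops k).filter Op.isWrite))) {j : Fin n} {a l : ℕ}
    {U : Txn Item Val} {h : HId} {x : I.Obj} {op : I.OVal → I.OVal × I.Ret} {r : I.Ret}
    (hs : (F i)[a]? = some (.act (.node j l) U h (.prim x op r))) (ha : Sel F R i 3 (some j) a) :
    (op (foldMem I j x (mops j x (stepsOf F (block F R k 3 (some j))) ++
      mops j x (stepsOf F (part i (Sel F R i 3 (some j)) a))))).2 = r := by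
  rcases Nat.lt_or_ge (R k) 3 with hk | hk
  · rw [block_eq_nil hk]
    exact hF.ret_depth_three hs ha
  have hv := hF.valid_afterCommit_append hI hik (hF.four_of_three_le i ha.2.2)
    (hF.four_of_three_le k hk) hdis j (a + 1)
  classical
  -- Position `a` itself is included, so its recorded value `r` is the one computed from the memory
  -- in the interleaving.
  rw [part_succ, if_pos ha, ← List.append_assoc] at hv
  have hE := hF.exec hv
  rw [stepsOf_append, stepsOf_singleton hs] at hE
  have := hE.prim_ret
  rw [memOf, hF.mops_afterCommit] at this
  exact this.symm

/-- `T k` does not modify objects that `T i` accesses if the data sets are disjoint. -/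
theorem Family.mops_eq_nil_of_disjoint (hF : Family F T ops R) (hI : Guarantees I f init Δ)
    (hik : i ≠ k) (hdis : ∀ ops', (T i).prog.PartialRun ops' →
      Disjoint (dataSet ops') (dataSet (ops k))) {j : Fin n} {a l : ℕ}
    {U : Txn Item Val} {h : HId} {x : I.Obj} {op : I.OVal → I.OVal × I.Ret} {r : I.Ret}
    (hs : (F i)[a]? = some (.act (.node j l) U h (.prim x op r))) (ha : Sel F R i 3 (some j) a) :
    mops j x (stepsOf F (block F R k 3 (some j))) = [] := by
  rcases Nat.lt_or_ge (R k) 3 with hk | hk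
  · rw [block_eq_nil hk]
    rfl
  have hRi := hF.four_of_three_le i ha.2.2
  have hRk := hF.four_of_three_le k hk
  have hsub : dataSet ((ops k).filter Op.isWrite) ⊆ dataSet (ops k) := by
    rintro z (⟨b, hb⟩ | ⟨b, hb⟩)
    · exact .inl ⟨b, List.mem_of_mem_filter hb⟩
    · exact .inr ⟨b, List.mem_of_mem_filter hb⟩
  have hv := hF.valid_afterCommit_append hI hik hRi hRk
    (fun ops' h => (hdis ops' h).mono_right hsub) j (a + 1)
  have hE := hF.exec hv
  have hBE : stepsOf F (beforeCommit F R i k) <+: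
      stepsOf F (afterCommit F R i k ++ part i (Sel F R i 3 (some j)) (a + 1)) := by
    rw [afterCommit, stepsOf_append, stepsOf_append, List.append_assoc]
    exact List.prefix_append _ _
  have hU := (hF.solo i).only _ (List.mem_of_getElem? hs)
  cases hU
  have hs' : Step.act (.node j l) (T i) h (.prim x op r) ∈
      stepsOf F (afterCommit F R i k ++ part i (Sel F R i 3 (some j)) (a + 1)) :=
    mem_stepsOf.2 ⟨i, a, List.mem_append_right _ (mem_part.2 ⟨rfl, by omega, ha⟩), hs⟩
  have hTik : T i ≠ T k := fun h => hik (hF.txn_inj h)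
  refine mops_eq_nil fun l' U hid op' r' h1 => ?_
  obtain ⟨i', b, hb, hb'⟩ := mem_stepsOf.1 h1
  obtain ⟨rfl, hb⟩ := mem_block.1 hb
  have hU := (hF.solo i').only _ (List.mem_of_getElem? hb')
  cases hU
  have h3 : Step.act (.node j l') (T i') hid (.prim x op' r') ∈
      stepsOf F (beforeCommit F R i i') :=
    mem_stepsOf.2 ⟨i', b, (mem_beforeCommit hF).2 (.inr
      ⟨rfl, (List.getElem?_eq_some_iff.1 hb').1, hb.2⟩), hb'⟩
  refine hI.trivial_of_disjoint hE (hF.failureFree _) (hE.invoked hs')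
    -- The two transactions are concurrent in every continuation because both are invoked and
    -- undecided in `beforeCommit`.
    (o' := .commit) (ops' := ops i') ?_ hTik hdis (fun E' h2 _ _ => concurrent_of_prefix
      (hBE.trans h2) hTik (hF.invoked_beforeCommit hik (by simp))
      (hF.invoked_beforeCommit hik (by simp))
      (hF.not_decided_beforeCommit hik hRi hRk (by simp))
      (hF.not_decided_beforeCommit hik hRi hRk (by simp))) hs' (hBE.subset h3)
  obtain ⟨p, hid, h2⟩ := hF.returns_afterCommit (i := i) hRk
  refine ⟨p, hid, ?_⟩
  rw [stepsOf_append]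
  exact List.mem_append_left _ h2

end PDTS

namespace PDTS

variable {n : ℕ} {Item : Type u} {Val : Type v} {I : Implementation.{u, v, w} n Item Val}

/-! ### A cycle of transactions -/

variable {f : ℕ} {init alt : Item → Val} {Δ : ℝ} {m : ℕ}

/-- Transaction `i` of the cycle reads item `i` and conditionally writes item `i + 1`. -/
noncomputable def cycleTxn (init alt : Item → Val) (X : Fin (m + 2) → Item) (i : Fin (m + 2)) :
    Txn Item Val :=
  condTxn init alt i (X i) (X (i + 1))

def cycleOps (init alt : Item → Val) (X : Fin (m + 2) → Item) (i : Fin (m + 2)) :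
    List (Op Item Val) :=
  condOps init alt (X i) (X (i + 1))

theorem succ_ne_self (i : Fin (m + 2)) : i + 1 ≠ i := by
  simp

theorem Guarantees.exists_family (hI : Guarantees I f init Δ) (hne : ∀ x, alt x ≠ init x)
    {X : Fin (m + 2) → Item} (hX : Function.Injective X) :
    ∃ (F : Fin (m + 2) → List (Step I)) (R : Fin (m + 2) → ℕ),
      Family F (cycleTxn init alt X) (cycleOps init alt X) R ∧
      ∀ i (j : Fin n), j.val = i.val → ∀ l T h a, Step.act (.node j l) T h a ∉ F i := by
  -- Transaction `i` avoids the node of the same number, if there is one; its identifier and its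
  -- client also have number `i`, which keeps the runs apart.
  choose F hF hav hle using fun i : Fin (m + 2) => hI.exists_solo alt i i (X i) (X (i + 1))
    (if h : i.val < n then some ⟨i, h⟩ else none)
  have hresp : ∀ i, ∃ a p, IsResponse (F i) (cycleTxn init alt X i) a ∧
      ∃ h o ops, (F i)[a]? = some (.act (.client p) (cycleTxn init alt X i) h (.respond o ops)) := by
    intro i
    obtain ⟨p, hid, hs⟩ := (hF i).returns
    obtain ⟨a, ha⟩ := List.mem_iff_getElem?.1 hs
    obtain ⟨A, C, C', -, -, ht⟩ := (hF i).exec.trans_of_mem hs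
    have : ∃ c, p = .client c := by cases ht; exact ⟨_, rfl⟩
    obtain ⟨c, rfl⟩ := this
    exact ⟨a, c, ⟨_, _, _, _, ha⟩, _, _, _, ha⟩
  choose a p ha hid o ops hresp using hresp
  have hpar : ∀ i b s, (F i)[b]? = some s →
      (s.IsClient → stepDepth (F i) b % 2 = 0) ∧ (s.IsNode → stepDepth (F i) b % 2 = 1) :=
    fun i b s hs => depth_parity hI.clientDriven (hF i).exec b s hs
  refine ⟨F, fun i => stepDepth (F i) (a i), ⟨hF, fun i i' h => Fin.ext h, hpar, ?_,
    fun i => (hpar i _ _ (hresp i)).1 ⟨_, _, _, _, rfl⟩, fun i => ⟨a i, ha i, rfl⟩,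
    fun i => hle i _ (ha i)⟩, ?_⟩
  · intro i b j l U h x op r hs hd
    exact hI.depth_one_trivial hne (fun h => succ_ne_self i (hX h)) (hF i) hs hd
  · rintro i j hij l T h b hs
    refine hav i j ?_ _ _ _ _ hs
    have h1 : i.val < n := hij ▸ j.2
    simp only [h1, dif_pos, Option.mem_some_iff]
    exact Fin.ext hij.symm

/-- An order of the blocks of depth three in which, on every node, transaction `i + 1` never comes after
transaction `i`. -/
def nodeOrder (hn : n ≤ m + 2) : List (Fin (m + 2) × Fin n) :=
  ((List.finRange (m + 2)).filter fun t => t ≠ 0).flatMap fun t =>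
    (List.finRange n).map fun j => (j.castLE hn - t, j)

/-- Omitting `t = 0` loses only the pairs of a transaction and the node that it avoids. -/
theorem mem_nodeOrder (hn : n ≤ m + 2) {i : Fin (m + 2)} {j : Fin n} (h : j.val ≠ i.val) :
    (i, j) ∈ nodeOrder hn := by
  simp only [nodeOrder, List.mem_flatMap, List.mem_filter, List.mem_finRange, true_and,
    decide_eq_true_eq, List.mem_map, Prod.mk.injEq]
  refine ⟨j.castLE hn - i, fun h1 => h ?_, j, by simp, rfl⟩
  have := sub_eq_zero.1 h1
  rw [← this]
  rfl

/-- On a node, `i = j - t` and `i + 1 = j - t'` force `t = t' + 1`. This contradicts `t < t'`,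
unless `t'` is the last index and the sum wraps around to `t = 0`, which has been left out. -/
theorem pairwise_nodeOrder (hn : n ≤ m + 2) :
    (nodeOrder hn).Pairwise fun q q' => q ≠ q' ∧ ¬ (q.2 = q'.2 ∧ q'.1 = q.1 + 1) := by
  unfold nodeOrder
  rw [List.pairwise_flatMap]
  constructor
  · intro t _
    rw [List.pairwise_map]
    refine (List.nodup_finRange n).imp fun {j j'} h => ⟨fun h1 => h (Prod.mk.inj h1).2, fun h1 => h h1.1⟩
  · refine List.Pairwise.imp_of_mem (R := fun t t' => t < t') ?_ ((List.pairwise_lt_finRange _).filter _)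
    intro t t' ht ht' hlt q hq q' hq'
    have ht0 : t ≠ 0 := by simpa using ht
    obtain ⟨j, -, rfl⟩ := List.mem_map.1 hq
    obtain ⟨j', -, rfl⟩ := List.mem_map.1 hq'
    constructor
    · intro h
      obtain ⟨h1, rfl⟩ := Prod.mk.inj h
      exact hlt.ne (sub_right_injective h1)
    · rintro ⟨h1, h2⟩
      dsimp only at h1 h2
      subst h1
      have h3 : t = t' + 1 := by
        have : j.castLE hn - t' + t' + t = j.castLE hn - t + 1 + t' + t := by rw [h2]
        have h4 : j.castLE hn - t + 1 + t' + t = j.castLE hn + (t' + 1) := by abel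
        rw [sub_add_cancel, h4] at this
        exact add_left_cancel this
      rcases Fin.eq_castSucc_or_eq_last t' with ⟨t'', rfl⟩ | rfl
      · rw [Fin.coeSucc_eq_succ] at h3
        subst h3
        exact absurd hlt (not_lt.2 (Fin.castSucc_lt_succ).le)
      · rw [Fin.last_add_one] at h3
        exact ht0 h3

theorem dataSet_cycleOps (X : Fin (m + 2) → Item) (i : Fin (m + 2)) :
    dataSet (cycleOps init alt X i) ⊆ {X i, X (i + 1)} := by
  rintro z (⟨b, hb⟩ | ⟨b, hb⟩) <;> simp [cycleOps, condOps] at hb <;> simp [hb.1]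

theorem dataSet_cycleOps_writes (X : Fin (m + 2) → Item) (i : Fin (m + 2)) :
    dataSet ((cycleOps init alt X i).filter Op.isWrite) ⊆ {X (i + 1)} := by
  rintro z (⟨b, hb⟩ | ⟨b, hb⟩) <;> simp [cycleOps, condOps, Op.isWrite] at hb
  simp [hb.1]

/-- Interleaving the executions of the cycle, no transaction notices the others. -/
theorem Guarantees.exists_cycle (hI : Guarantees I f init Δ) (hne : ∀ x, alt x ≠ init x)
    (hn : n ≤ m + 2) {X : Fin (m + 2) → Item} (hX : Function.Injective X) :
    ∃ E : List (Step I), IsExec E ∧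
      (∀ i, Returns E (cycleTxn init alt X i) .commit (cycleOps init alt X i)) ∧
      ∀ T, Invoked E T → ∃ i, T = cycleTxn init alt X i := by
  obtain ⟨F, R, hF, hav⟩ := hI.exists_family hne hX
  set low := lowPhases F R (List.finRange (m + 2)) with hlow
  have hnd := List.nodup_finRange (m + 2)
  have hpw := pairwise_nodeOrder hn
  have hpart : ∀ i ops', (cycleTxn init alt X i).prog.PartialRun ops' →
      dataSet ops' ⊆ {X i, X (i + 1)} := fun i ops' h => condTxn_dataSet h
  have hv : Valid F (low ++ (nodeOrder hn).flatMap fun q => block F R q.1 3 (some q.2)) := by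
    refine hF.append_node_blocks (hpw.imp fun h => h.1) (hF.valid_lowPhases hnd) ?_ ?_ ?_
    · intro q hq
      have := (mem_lowPhases.1 hq).2.2.1
      omega
    · intro q _ hR a ha hd
      exact mem_lowPhases.2 ⟨by simp, ha, by omega, by omega⟩
    · intro pre i j post hpre a l U h x op r hs ha
      rw [hpre, List.pairwise_append] at hpw
      obtain ⟨hpw1, -, hpw2⟩ := hpw
      have hcross := fun q hq => hpw2 q hq (i, j) List.mem_cons_self
      rw [mops_flatMap]
      -- Of the blocks placed earlier only that of `i + 1` on the same node can matter: any other
      -- transaction there is neither `i` nor `i - 1`, so its data set is disjoint.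
      have hother := flatMap_eq_of_nodup
        (fun q : Fin (m + 2) × Fin n => mops j x (stepsOf F (block F R q.1 3 (some q.2))))
        (hpw1.imp fun h => h.1) (q₀ := (i + 1, j)) (by
          rintro ⟨k, j'⟩ hq hne'
          by_cases hj : j' = j
          swap
          · exact mops_block_of_ne hj x
          subst hj
          obtain ⟨h1, h2⟩ := hcross _ hq
          have hik : i ≠ k := fun h => h1 (by rw [h])
          have hik1 : i ≠ k + 1 := fun h => h2 ⟨rfl, h⟩
          have hki : i + 1 ≠ k := fun h => hne' (by rw [h])
          refine hF.mops_eq_nil_of_disjoint hI hik (fun ops' h => ?_) hs ha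
          refine Set.disjoint_of_subset (hpart i _ h) (dataSet_cycleOps X k) ?_
          simp [hX.eq_iff, hik.symm, hik1.symm, hki.symm])
      by_cases hmem : (i + 1, j) ∈ pre
      · rw [hother.1 hmem]
        -- In a cycle of length two this fails in general; here it follows because `i + 1` acts
        -- before `i` on node `j`, which the order forbids for a successor of `i + 1`.
        have h2 : i ≠ i + 1 + 1 := fun h => (hcross _ hmem).2 ⟨rfl, h⟩
        refine hF.ret_after hI (succ_ne_self i).symm (fun ops' h => ?_) hs ha
        refine Set.disjoint_of_subset (hpart i _ h) (dataSet_cycleOps_writes X (i + 1)) ?_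
        simp [hX.eq_iff, h2.symm]
      · rw [hother.2 hmem]
        exact hF.ret_depth_three hs ha
  have hv' := hF.append_phase hnd (d := 4) (by omega) hv
    (fun i _ a ha h => by
      have h1 := ha.2.1
      rcases List.mem_append.1 h with h | h
      · have := (mem_lowPhases.1 h).2.2.1
        omega
      · obtain ⟨q, -, h2⟩ := List.mem_flatMap.1 h
        obtain ⟨h3, -, h4, -⟩ := mem_block.1 h2
        rw [← h3] at h4
        omega)
    (fun i _ hR a ha hd => by
      rcases Nat.lt_or_ge (stepDepth (F i) a) 3 with h | h
      · exact List.mem_append_left _ (mem_lowPhases.2 ⟨by simp, ha, by omega, by omega⟩)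
      · have hs := List.getElem?_eq_getElem ha
        rcases hF.exists_proc hs with ⟨h4, -⟩ | ⟨j, l, h4, h5⟩
        · have := (hF.parity i a _ hs).1 h4
          omega
        · refine List.mem_append_right _ (List.mem_flatMap.2 ⟨(i, j), mem_nodeOrder hn ?_,
            mem_block.2 ⟨rfl, ⟨_, hs, fun j' hj' => ?_⟩, by change stepDepth (F i) a = 3; omega,
              by dsimp only; omega⟩⟩)
          -- A step of depth three on a node left out of the order would be on the node that this
          -- transaction avoids.
          · intro hij
            obtain ⟨j', l', U, hh, b, h6⟩ := h4
            rw [h6] at h5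
            cases h5
            exact hav i j hij l U hh b (h6 ▸ List.getElem_mem ha)
          · cases hj'
            exact ⟨l, h5⟩)
    (by omega)
  refine ⟨_, hF.exec hv', fun i => hF.returns fun a ha hd => ?_, ?_⟩
  · have h1 := hF.even i
    have h2 := hF.le_four i
    rcases Nat.lt_or_ge (R i) 3 with h | h
    · exact List.mem_append_left _ (List.mem_append_left _
        (mem_lowPhases.2 ⟨by simp, ha, by omega, by omega⟩))
    · exact List.mem_append_right _ (mem_flatMap_block.2 ⟨by simp,
        ⟨_, List.getElem?_eq_getElem ha, by simp⟩, by omega, by omega⟩)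
  · rintro T ⟨p, hid, hs⟩
    obtain ⟨i, b, -, hb⟩ := mem_stepsOf.1 hs
    have := (hF.solo i).only _ (List.mem_of_getElem? hb)
    cases this
    exact ⟨i, rfl⟩

/-- The transactions of a cycle cannot all read initial values. -/
theorem not_serializable_cycle (hne : ∀ x, alt x ≠ init x) (hser : I.Serializable init)
    {X : Fin (m + 2) → Item} {E : List (Step I)} (hE : IsExec E)
    (hret : ∀ i, Returns E (cycleTxn init alt X i) .commit (cycleOps init alt X i))
    (hinv : ∀ T, Invoked E T → ∃ i, T = cycleTxn init alt X i) : False := by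
  obtain ⟨L, -, hL, hleg⟩ := hser E hE
  have hall : ∀ q ∈ L, ∃ i, q = (cycleTxn init alt X i, cycleOps init alt X i) := by
    rintro ⟨T, ops⟩ hq
    have h1 := (hL T ops).1 hq
    obtain ⟨i, rfl⟩ := hinv T (Decided.invoked hE ⟨_, _, h1⟩)
    obtain ⟨-, rfl⟩ := hE.returns_eq h1 (hret i)
    exact ⟨i, rfl⟩
  rcases L with _ | ⟨q, rest⟩
  · have := (hL _ _).2 (hret 0)
    cases this
  -- The first transaction of the serial order overwrites what its successor in the cycle reads.
  obtain ⟨i, rfl⟩ := hall q List.mem_cons_self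
  have h1 : (cycleTxn init alt X (i + 1), cycleOps init alt X (i + 1)) ∈ rest := by
    rcases List.mem_cons.1 ((hL _ _).2 (hret (i + 1))) with h | h
    · exact absurd (Fin.ext (congrArg (fun q => Txn.id (Prod.fst q)) h)) (succ_ne_self i)
    · exact h
  refine not_legal_of_stale_read hne hleg (fun q hq b hb => ?_) h1 (by simp [cycleOps, condOps])
  obtain ⟨i', rfl⟩ := hall q (List.mem_cons_of_mem _ hq)
  obtain ⟨h2, rfl⟩ := write_mem_condOps hb
  rw [h2]

/-! ### The choice of the items, and the conclusion -/

theorem exists_injective_of_le_card {α : Type*} {m : ℕ} (h : (m : ℕ∞) ≤ ENat.card α) :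
    ∃ X : Fin m → α, Function.Injective X := by
  rcases finite_or_infinite α with hα | hα
  · have := Fintype.ofFinite α
    rw [ENat.card_eq_coe_fintype_card, Nat.cast_le] at h
    obtain ⟨e⟩ := Function.Embedding.nonempty_of_card_le (α := Fin m) (β := α) (by simpa using h)
    exact ⟨e, e.injective⟩
  · exact ⟨fun i => Infinite.natEmbedding α i, fun i j h =>
      Fin.ext ((Infinite.natEmbedding α).injective h)⟩

end PDTS

theorem theorem2 {Item : Type u} {Val : Type v} [Nontrivial Val] (n f : ℕ)
    (hItem : ((max n 2 : ℕ) : ℕ∞) ≤ ENat.card Item) (init : Item → Val) (Δ : ℝ) (hΔ : 0 < Δ) :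
    ¬ ∃ I : PDTS.Implementation.{u, v, w} n Item Val,
      I.RespectsPrograms ∧ I.HandlersReturn f ∧ I.ClientDriven ∧ I.WeakProgress f ∧
        I.Seamless 1 ∧ I.FastDeciding Δ ∧ I.InvisibleReads ∧ I.DisjointAccessParallel ∧
        I.Serializable init := by
  rintro ⟨I, h1, h2, h3, h4, h5, h6, h7, h8, h9⟩
  have hI : PDTS.Guarantees I f init Δ := ⟨h1, h2, h3, h4, h5, hΔ, h6, h7, h8, h9⟩
  choose alt halt using fun x => exists_ne (init x)
  -- The length must be at least `n`, so that each node has a transaction avoiding it, and at least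
  -- two, so that the items read and written by a transaction differ.
  obtain ⟨m, hm⟩ : ∃ m, max n 2 = m + 2 := ⟨max n 2 - 2, by omega⟩
  rw [hm] at hItem
  obtain ⟨X, hX⟩ := PDTS.exists_injective_of_le_card hItem
  obtain ⟨E, hE, hret, hinv⟩ := hI.exists_cycle halt (by omega) hX
  exact PDTS.not_serializable_cycle halt h9 hE hret hinv
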